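/- Let $\mathcal E$ be an elementary topos with a natural numbers object, and let $\mathtt R$ be an ordered commutative ring object in $\mathcal E$ (a commutative ring object with a total order compatible with addition and whose nonnegative elements are closed under multiplication, all axioms being read in the internal language; totality says that the join of $\leqslant$ and its opposite is $\mathtt R\times\mathtt R$). Regard $\mathcal E$ as a category with families (CwF) by the local universes construction: a family $A\in\mathcal E(\Gamma)$ is a morphism $\pi:E\to V$ together with a morphism $\chi:\Gamma\to V$, re-indexing is composition with $\chi$, the elements of $A$ are the lifts of $\chi$ along $\pi$, and the comprehension $\Gamma.A\to\Gamma$ is the pullback of $\pi$ along $\chi$. Let $\mathtt R_+=\{i:\mathtt R\mid 0\leqslant i\}$. We use the internal language of $\mathcal E$. For $x,y:\Gamma$ let $x\sim y$ be the object of Moore paths, i.e. pairs $p=(f,i)$ with $f:\mathtt R_+\to\Gamma$, $i:\mathtt R_+$, $f\,0=x$ and $f\,j=y$ for all $j\geqslant i$; write $p\,j$ for $f\,j$ and $|p|=i$ for the shape. The degenerate path $\mathrm{idp}\,x$ is constant of shape $0$. The reverse $\mathrm{rev}\,p:y\sim x$ has shape $|p|$ and $(\mathrm{rev}\,p)\,i=p\,(|p|\mathbin{\dot-}i)$,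 where $\dot-$ is truncated subtraction; the contraction $p_{\leqslant i}:x\sim p\,i$ has shape $\min(|p|,i)$ and value $p\,(\min(k,\min(|p|,i)))$ at $k$. A morphism $\gamma:\Gamma\to\Gamma'$ acts on paths by $(f,i)\mapsto(\gamma\circ f,i)$. A tap (transport-along-paths) structure on $A\in\mathcal E(\Gamma)$ is a family of functions $p\mapsto p_*$, $(x\sim y)\to(A\,x\to A\,y)$, indexed by $x,y:\Gamma$, with $(\mathrm{idp}\,x)_*a=a$; $\mathbf{Fib}(\Gamma)$ is the set of families over $\Gamma$ equipped with a tap structure. A tap structure on $A$ is re-indexed along $\gamma:\Delta\to\Gamma$ by transporting in $A\gamma$ along $p$ as in $A$ along the image of $p$ under $\gamma$. With the elements of the underlying families as elements, $\mathbf{Fib}$ is a CwF. For $A\in\mathbf{Fib}(\Gamma)$, $p:x\sim y$ and $a:A\,x$, let $\mathrm{lift}(p,a):(x,a)\sim(y,p_*a)$ be the path in $\Gamma.A$ of shape $|p|$ whose value at $k\leqslant|p|$ is $(p\,k,(p_{\leqslant k})_*a)$. A CwF supports W-types if it has a family $W\,A\,B$ over $\Gamma$ for all families $A$ over $\Gamma$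 and $B$ over $\Gamma.A$, a constructor $\sup(a,f)$ for $a:A\,x$ and $f:B(x,a)\to W\,A\,B\,x$, and dependent elimination satisfying the computation rule, all strictly stable under re-indexing. Theorem (W-types). The CwF associated with $\mathcal E$ supports W-types. Given any such structure of W-types on it, with formation operation $W\,A\,B=(W_{a:A\,x}B(x,a)\mid x:\Gamma)$, the following holds. For all $\Gamma$, $A\in\mathbf{Fib}(\Gamma)$ and $B\in\mathbf{Fib}(\Gamma.A)$, the family $W\,A\,B\in\mathcal E(\Gamma)$ has a tap structure satisfying $$p_*\sup(a,f)=\sup\bigl(p_*a,\ \lambda b.\ p_*\,f\bigl((\mathrm{rev}(\mathrm{lift}(p,a)))_*\,b\bigr)\bigr)$$ for $p:x\sim y$, $a:A\,x$, $f:B(x,a)\to W\,A\,B\,x$, and these tap structures can be chosen to be stable under re-indexing along all morphisms $\Delta\to\Gamma$ of $\mathcal E$. Moreover, with these fibrations $W\,A\,B\in\mathbf{Fib}(\Gamma)$ and the same constructor $\sup$, the CwF $\mathbf{Fib}$ supports W-types. -/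

import Mathlib

open CategoryTheory MonoidalCategory CartesianMonoidalCategory Limits

universe w v u

/-- A category with families, presented as a natural model: presheaves `Ty` of families (types)
and `Tm` of elements (terms) with a natural typing map `tp`, such that every family `A` over `Γ`
has a comprehension object `ext A`. The set of elements of `A` over `Γ` is `{t : Tm Γ // tp t = A}`.
`tySub σ A` and `tmSub σ t` are re-indexing along `σ`. -/
structure CwF (C : Type u) [Category.{v} C] where
  hasTerminal : HasTerminal C
  Ty : C → Type w
  Tm : C → Type w
  tp {Γ : C} : Tm Γ → Ty Γ
  tySub {Δ Γ : C} (σ : Δ ⟶ Γ) : Ty Γ → Ty Δ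
  tmSub {Δ Γ : C} (σ : Δ ⟶ Γ) : Tm Γ → Tm Δ
  tySub_id {Γ : C} (A : Ty Γ) : tySub (𝟙 Γ) A = A
  tySub_comp {Θ Δ Γ : C} (τ : Θ ⟶ Δ) (σ : Δ ⟶ Γ) (A : Ty Γ) :
    tySub (τ ≫ σ) A = tySub τ (tySub σ A)
  tmSub_id {Γ : C} (t : Tm Γ) : tmSub (𝟙 Γ) t = t
  tmSub_comp {Θ Δ Γ : C} (τ : Θ ⟶ Δ) (σ : Δ ⟶ Γ) (t : Tm Γ) :
    tmSub (τ ≫ σ) t = tmSub τ (tmSub σ t)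
  tp_sub {Δ Γ : C} (σ : Δ ⟶ Γ) (t : Tm Γ) : tp (tmSub σ t) = tySub σ (tp t)
  /-- the comprehension object `Γ.A` -/
  ext {Γ : C} (A : Ty Γ) : C
  /-- the projection `Γ.A ⟶ Γ` -/
  disp {Γ : C} (A : Ty Γ) : ext A ⟶ Γ
  /-- the generic element -/
  var {Γ : C} (A : Ty Γ) : Tm (ext A)
  tp_var {Γ : C} (A : Ty Γ) : tp (var A) = tySub (disp A) A
  pair {Δ Γ : C} (σ : Δ ⟶ Γ) (A : Ty Γ) (t : Tm Δ) (h : tp t = tySub σ A) : Δ ⟶ ext A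
  pair_disp {Δ Γ : C} (σ : Δ ⟶ Γ) (A : Ty Γ) (t : Tm Δ) (h : tp t = tySub σ A) :
    pair σ A t h ≫ disp A = σ
  pair_var {Δ Γ : C} (σ : Δ ⟶ Γ) (A : Ty Γ) (t : Tm Δ) (h : tp t = tySub σ A) :
    tmSub (pair σ A t h) (var A) = t
  ext_hom {Δ Γ : C} {A : Ty Γ} (f g : Δ ⟶ ext A) (h : f ≫ disp A = g ≫ disp A)
    (h' : tmSub f (var A) = tmSub g (var A)) : f = g

namespace CwF

section General

variable {C : Type u} [Category.{v} C] (𝒞 : CwF.{w} C)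

variable {𝒞} in
theorem comp_pair {Θ Δ Γ : C} (τ : Θ ⟶ Δ) (σ : Δ ⟶ Γ) (A : 𝒞.Ty Γ) (t : 𝒞.Tm Δ)
    (h : 𝒞.tp t = 𝒞.tySub σ A) (t' : 𝒞.Tm Θ) (ht : t' = 𝒞.tmSub τ t)
    (σ' : Θ ⟶ Γ) (hσ : σ' = τ ≫ σ) (h' : 𝒞.tp t' = 𝒞.tySub σ' A) :
    τ ≫ 𝒞.pair σ A t h = 𝒞.pair σ' A t' h' := by
  subst ht hσ
  apply 𝒞.ext_hom
  · simp [𝒞.pair_disp]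
  · simp [𝒞.tmSub_comp, 𝒞.pair_var]

variable {𝒞} in
theorem pair_congr {Δ Γ : C} {σ σ' : Δ ⟶ Γ} (hσ : σ = σ') {A : 𝒞.Ty Γ} {t t' : 𝒞.Tm Δ}
    (ht : t = t') (h : 𝒞.tp t = 𝒞.tySub σ A) (h' : 𝒞.tp t' = 𝒞.tySub σ' A) :
    𝒞.pair σ A t h = 𝒞.pair σ' A t' h' := by
  subst hσ ht
  rfl

/-- `σ.A : Δ.Aσ ⟶ Γ.A`, the lifting of `σ : Δ ⟶ Γ` to comprehension objects. -/
def wk {Δ Γ : C} (σ : Δ ⟶ Γ) (A : 𝒞.Ty Γ) : 𝒞.ext (𝒞.tySub σ A) ⟶ 𝒞.ext A :=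
  𝒞.pair (𝒞.disp (𝒞.tySub σ A) ≫ σ) A (𝒞.var (𝒞.tySub σ A))
    (by rw [𝒞.tp_var, 𝒞.tySub_comp])

theorem wk_disp {Δ Γ : C} (σ : Δ ⟶ Γ) (A : 𝒞.Ty Γ) :
    𝒞.wk σ A ≫ 𝒞.disp A = 𝒞.disp (𝒞.tySub σ A) ≫ σ := 𝒞.pair_disp _ _ _ _

theorem wk_var {Δ Γ : C} (σ : Δ ⟶ Γ) (A : 𝒞.Ty Γ) :
    𝒞.tmSub (𝒞.wk σ A) (𝒞.var A) = 𝒞.var (𝒞.tySub σ A) := 𝒞.pair_var _ _ _ _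

theorem pair_wk {Θ Δ Γ : C} (τ : Θ ⟶ Δ) (σ : Δ ⟶ Γ) (A : 𝒞.Ty Γ) (t : 𝒞.Tm Θ)
    (h : 𝒞.tp t = 𝒞.tySub τ (𝒞.tySub σ A)) :
    𝒞.pair τ (𝒞.tySub σ A) t h ≫ 𝒞.wk σ A =
      𝒞.pair (τ ≫ σ) A t (h.trans (𝒞.tySub_comp τ σ A).symm) :=
  comp_pair _ _ _ _ _ _ (𝒞.pair_var _ _ _ _).symm _
    (by rw [← Category.assoc, 𝒞.pair_disp]) _

/-- For `A` a family over `Γ`, `B` over `Γ.A` and `Y` over `Γ`, an element at stage `σ : Δ ⟶ Γ` of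
the family `∑ a : A x, (B (x, a) → Y x)` over `x : Γ`: an element `a` of `Aσ` together with an
element `branch` of `Y` in the context `Δ.T`, where `T` is the family `B⟨σ, a⟩` over `Δ`. (`T` is
carried along with an equation only to avoid casts.) -/
structure Node {Γ : C} (A : 𝒞.Ty Γ) (B : 𝒞.Ty (𝒞.ext A)) (Y : 𝒞.Ty Γ) {Δ : C} (σ : Δ ⟶ Γ) where
  label : 𝒞.Tm Δ
  tp_label : 𝒞.tp label = 𝒞.tySub σ A
  T : 𝒞.Ty Δ
  T_eq : T = 𝒞.tySub (𝒞.pair σ A label tp_label) B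
  branch : 𝒞.Tm (𝒞.ext T)
  tp_branch : 𝒞.tp branch = 𝒞.tySub (𝒞.disp T ≫ σ) Y

variable {𝒞}

/-- Restriction of a node along a change of stage. -/
abbrev Node.restrict {Γ : C} {A : 𝒞.Ty Γ} {B : 𝒞.Ty (𝒞.ext A)} {Y : 𝒞.Ty Γ} {Δ : C} {σ : Δ ⟶ Γ}
    (n : 𝒞.Node A B Y σ) {Θ : C} (τ : Θ ⟶ Δ) : 𝒞.Node A B Y (τ ≫ σ) where
  label := 𝒞.tmSub τ n.label
  tp_label := by rw [𝒞.tp_sub, n.tp_label, 𝒞.tySub_comp]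
  T := 𝒞.tySub τ n.T
  T_eq := by
    rw [n.T_eq, ← 𝒞.tySub_comp]
    congr 1
    exact comp_pair _ _ _ _ _ _ rfl _ rfl _
  branch := 𝒞.tmSub (𝒞.wk τ n.T) n.branch
  tp_branch := by
    rw [𝒞.tp_sub, n.tp_branch, ← 𝒞.tySub_comp, ← Category.assoc, wk_disp, Category.assoc]

/-- A node of the re-indexed data `Aσ`, `B(σ.A)`, `Yσ` at stage `τ` is a node of `A`, `B`, `Y` at
stage `τ ≫ σ` (with the same underlying data). -/
abbrev Node.push {Γ : C} {A : 𝒞.Ty Γ} {B : 𝒞.Ty (𝒞.ext A)} {Y : 𝒞.Ty Γ} {Δ : C} (σ : Δ ⟶ Γ)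
    {Θ : C} {τ : Θ ⟶ Δ}
    (n : 𝒞.Node (𝒞.tySub σ A) (𝒞.tySub (𝒞.wk σ A) B) (𝒞.tySub σ Y) τ) :
    𝒞.Node A B Y (τ ≫ σ) where
  label := n.label
  tp_label := by rw [n.tp_label, 𝒞.tySub_comp]
  T := n.T
  T_eq := by rw [n.T_eq, ← 𝒞.tySub_comp, pair_wk]
  branch := n.branch
  tp_branch := by rw [n.tp_branch, ← 𝒞.tySub_comp, Category.assoc]

variable (𝒞) in
/-- Formation and introduction for `W`-types, stable under re-indexing. `Y` with `Y = W A B`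
is the `W`-type itself (the equation avoids casts along `W_sub`). -/
structure WIntro where
  W {Γ : C} (A : 𝒞.Ty Γ) (B : 𝒞.Ty (𝒞.ext A)) : 𝒞.Ty Γ
  W_sub {Δ Γ : C} (σ : Δ ⟶ Γ) (A : 𝒞.Ty Γ) (B : 𝒞.Ty (𝒞.ext A)) :
    𝒞.tySub σ (W A B) = W (𝒞.tySub σ A) (𝒞.tySub (𝒞.wk σ A) B)
  sup {Γ : C} {A : 𝒞.Ty Γ} {B : 𝒞.Ty (𝒞.ext A)} {Y : 𝒞.Ty Γ} (hY : Y = W A B)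
    {Δ : C} (σ : Δ ⟶ Γ) (n : 𝒞.Node A B Y σ) : 𝒞.Tm Δ
  tp_sup {Γ : C} {A : 𝒞.Ty Γ} {B : 𝒞.Ty (𝒞.ext A)} {Y : 𝒞.Ty Γ} (hY : Y = W A B)
    {Δ : C} (σ : Δ ⟶ Γ) (n : 𝒞.Node A B Y σ) : 𝒞.tp (sup hY σ n) = 𝒞.tySub σ Y
  /-- `sup` is natural in the stage -/
  sup_restrict {Γ : C} {A : 𝒞.Ty Γ} {B : 𝒞.Ty (𝒞.ext A)} {Y : 𝒞.Ty Γ} (hY : Y = W A B)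
    {Δ : C} (σ : Δ ⟶ Γ) (n : 𝒞.Node A B Y σ) {Θ : C} (τ : Θ ⟶ Δ) :
    𝒞.tmSub τ (sup hY σ n) = sup hY (τ ≫ σ) (n.restrict τ)
  /-- `sup` is stable under re-indexing of `A`, `B` -/
  sup_push {Γ : C} {A : 𝒞.Ty Γ} {B : 𝒞.Ty (𝒞.ext A)} {Y : 𝒞.Ty Γ} (hY : Y = W A B)
    {Δ : C} (σ : Δ ⟶ Γ) {Θ : C} (τ : Θ ⟶ Δ)
    (n : 𝒞.Node (𝒞.tySub σ A) (𝒞.tySub (𝒞.wk σ A) B) (𝒞.tySub σ Y) τ) :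
    sup ((congrArg (𝒞.tySub σ) hY).trans (W_sub σ A B)) τ n = sup hY (τ ≫ σ) (n.push σ)

/-- The premise of `W`-elimination into a family `D` over `Γ.W A B`, i.e. an element of
`D (x, sup (a, f))` depending on `x : Γ`, `a : A x`, `f : B (x, a) → W A B x` and
`u : ∏ b : B (x, a), D (x, f b)`, given at every stage naturally. -/
structure Step (I : 𝒞.WIntro) {Γ : C} {A : 𝒞.Ty Γ} {B : 𝒞.Ty (𝒞.ext A)} {Y : 𝒞.Ty Γ}
    (hY : Y = I.W A B) (D : 𝒞.Ty (𝒞.ext Y)) where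
  run {Δ : C} (σ : Δ ⟶ Γ) (n : 𝒞.Node A B Y σ) (u : 𝒞.Tm (𝒞.ext n.T))
    (hu : 𝒞.tp u = 𝒞.tySub (𝒞.pair (𝒞.disp n.T ≫ σ) Y n.branch n.tp_branch) D) : 𝒞.Tm Δ
  tp_run {Δ : C} (σ : Δ ⟶ Γ) (n : 𝒞.Node A B Y σ) (u : 𝒞.Tm (𝒞.ext n.T))
    (hu : 𝒞.tp u = 𝒞.tySub (𝒞.pair (𝒞.disp n.T ≫ σ) Y n.branch n.tp_branch) D) :
    𝒞.tp (run σ n u hu) = 𝒞.tySub (𝒞.pair σ Y (I.sup hY σ n) (I.tp_sup hY σ n)) D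
  run_restrict {Δ : C} (σ : Δ ⟶ Γ) (n : 𝒞.Node A B Y σ) (u : 𝒞.Tm (𝒞.ext n.T))
    (hu : 𝒞.tp u = 𝒞.tySub (𝒞.pair (𝒞.disp n.T ≫ σ) Y n.branch n.tp_branch) D)
    {Θ : C} (τ : Θ ⟶ Δ) :
    𝒞.tmSub τ (run σ n u hu) = run (τ ≫ σ) (n.restrict τ) (𝒞.tmSub (𝒞.wk τ n.T) u)
      ((𝒞.tp_sub _ _).trans ((congrArg _ hu).trans ((𝒞.tySub_comp _ _ _).symm.trans
        (congrArg (𝒞.tySub · D) (comp_pair _ _ _ _ _ _ rfl _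
          ((Category.assoc _ _ _).symm.trans ((congrArg (· ≫ σ) (wk_disp 𝒞 τ n.T)).symm.trans
            (Category.assoc _ _ _))) _)))))

/-- Re-indexing of the premise of `W`-elimination. -/
def Step.reindex {I : 𝒞.WIntro} {Γ : C} {A : 𝒞.Ty Γ} {B : 𝒞.Ty (𝒞.ext A)} {Y : 𝒞.Ty Γ}
    {hY : Y = I.W A B} {D : 𝒞.Ty (𝒞.ext Y)} (d : Step I hY D) {Δ : C} (σ : Δ ⟶ Γ) :
    Step I ((congrArg (𝒞.tySub σ) hY).trans (I.W_sub σ A B)) (𝒞.tySub (𝒞.wk σ Y) D) where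
  run τ n u hu := d.run (τ ≫ σ) (n.push σ) u
    (hu.trans ((𝒞.tySub_comp _ _ _).symm.trans (congrArg (𝒞.tySub · D)
      ((pair_wk 𝒞 _ σ Y _ _).trans (pair_congr (Category.assoc _ _ _) rfl _ _)))))
  tp_run τ n u hu := by
    refine (d.tp_run (τ ≫ σ) (n.push σ) u _).trans
      ((congrArg (𝒞.tySub · D) ?_).trans (𝒞.tySub_comp _ _ _))
    exact (pair_congr rfl (I.sup_push hY σ τ n).symm _ _).trans (pair_wk 𝒞 _ σ Y _ _).symm
  run_restrict {_} τ n u hu {Θ} θ := by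
    refine (d.run_restrict (τ ≫ σ) (n.push σ) u _ θ).trans ?_
    have key : ∀ {Θ : C} {ρ ρ' : Θ ⟶ Γ} (h : ρ = ρ') (m : 𝒞.Node A B Y ρ) (m' : 𝒞.Node A B Y ρ')
        (hl : m.label = m'.label) (hT : m.T = m'.T) (hb : HEq m.branch m'.branch)
        (x : 𝒞.Tm (𝒞.ext m.T)) (x' : 𝒞.Tm (𝒞.ext m'.T)) (hx : HEq x x') (e) (e'),
        d.run ρ m x e = d.run ρ' m' x' e' := by
      rintro Θ ρ _ rfl ⟨l, _, T, _, b, _⟩ ⟨l', _, T', _, b', _⟩ hl hT hb x x' hx e e'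
      dsimp only at hl hT hb x x' hx
      subst hl hT
      obtain rfl := eq_of_heq hb
      obtain rfl := eq_of_heq hx
      rfl
    exact key (Category.assoc _ _ _).symm _ _ rfl rfl HEq.rfl _ _ HEq.rfl _ _

variable (𝒞) in
/-- The structure for a CwF to support `W`-types: formation, introduction, dependent elimination
and the computation rule, all stable under re-indexing. -/
structure WTypes extends 𝒞.WIntro where
  elim {Γ : C} {A : 𝒞.Ty Γ} {B : 𝒞.Ty (𝒞.ext A)} {Y : 𝒞.Ty Γ} (hY : Y = W A B)
    (D : 𝒞.Ty (𝒞.ext Y)) (d : Step toWIntro hY D) : 𝒞.Tm (𝒞.ext Y)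
  tp_elim {Γ : C} {A : 𝒞.Ty Γ} {B : 𝒞.Ty (𝒞.ext A)} {Y : 𝒞.Ty Γ} (hY : Y = W A B)
    (D : 𝒞.Ty (𝒞.ext Y)) (d : Step toWIntro hY D) : 𝒞.tp (elim hY D d) = D
  elim_sup {Γ : C} {A : 𝒞.Ty Γ} {B : 𝒞.Ty (𝒞.ext A)} {Y : 𝒞.Ty Γ} (hY : Y = W A B)
    (D : 𝒞.Ty (𝒞.ext Y)) (d : Step toWIntro hY D) {Δ : C} (σ : Δ ⟶ Γ) (n : 𝒞.Node A B Y σ) :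
    𝒞.tmSub (𝒞.pair σ Y (sup hY σ n) (tp_sup hY σ n)) (elim hY D d) =
      d.run σ n
        (𝒞.tmSub (𝒞.pair (𝒞.disp n.T ≫ σ) Y n.branch n.tp_branch) (elim hY D d))
        (by rw [𝒞.tp_sub, tp_elim])
  elim_sub {Γ : C} {A : 𝒞.Ty Γ} {B : 𝒞.Ty (𝒞.ext A)} {Y : 𝒞.Ty Γ} (hY : Y = W A B)
    (D : 𝒞.Ty (𝒞.ext Y)) (d : Step toWIntro hY D) {Δ : C} (σ : Δ ⟶ Γ) :
    𝒞.tmSub (𝒞.wk σ Y) (elim hY D d) =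
      elim ((congrArg (𝒞.tySub σ) hY).trans (W_sub σ A B)) (𝒞.tySub (𝒞.wk σ Y) D) (d.reindex σ)

end General

section LocalUniverses

variable {E : Type u} [Category.{v} E]

/-- A family over `Γ` in the local universes model: a morphism `proj : tot ⟶ base` (the local
universe) together with a classifying morphism `cls : Γ ⟶ base`. It stands for the pullback of
`proj` along `cls`. -/
structure LFam (Γ : E) where
  {base tot : E}
  proj : tot ⟶ base
  cls : Γ ⟶ base

/-- An element of a family: a lift of `cls` along `proj`, i.e. a section of the pullback. -/
structure LElt (Γ : E) where
  fam : LFam Γ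
  el : Γ ⟶ fam.tot
  el_proj : el ≫ fam.proj = fam.cls

/-- The underlying morphism of an element of the family `F`. -/
def LElt.elAs {Γ : E} (t : LElt Γ) (F : LFam Γ) (h : t.fam = F) : Γ ⟶ F.tot :=
  t.el ≫ eqToHom (congrArg (fun F : LFam _ => F.tot) h)

theorem LElt.elAs_proj {Γ : E} (t : LElt Γ) (F : LFam Γ) (h : t.fam = F) :
    t.elAs F h ≫ F.proj = F.cls := by
  subst h
  simp [LElt.elAs, t.el_proj]

theorem LElt.heq_elAs {Γ : E} (t : LElt Γ) (F : LFam Γ) (h : t.fam = F) :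
    HEq (t.elAs F h) t.el := by
  subst h
  simp [LElt.elAs]

/-- Re-indexing of families is composition with the classifying morphism. -/
def LFam.sub {Δ Γ : E} (σ : Δ ⟶ Γ) (A : LFam Γ) : LFam Δ where
  proj := A.proj
  cls := σ ≫ A.cls

def LElt.sub {Δ Γ : E} (σ : Δ ⟶ Γ) (t : LElt Γ) : LElt Δ where
  fam := t.fam.sub σ
  el := σ ≫ t.el
  el_proj := by simp [LFam.sub, t.el_proj]

theorem LElt.ext_of {Δ : E} {s t : LElt Δ} (h : s.fam = t.fam) (h' : HEq s.el t.el) : s = t := by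
  obtain ⟨f, e, _⟩ := s
  obtain ⟨f', e', _⟩ := t
  dsimp only at h h'
  subst h
  obtain rfl := eq_of_heq h'
  rfl

/-- The category with families associated with a category with finite limits, by the local
universes construction. Its families over `Γ` are, up to isomorphism, the objects of `Over Γ`. -/
noncomputable def ofTopos (E : Type u) [Category.{v} E] [HasFiniteLimits E] :
    CwF.{max u v} E where
  hasTerminal := inferInstance
  Ty Γ := LFam Γ
  Tm Γ := LElt Γ
  tp t := t.fam
  tySub σ A := A.sub σ
  tmSub σ t := t.sub σ
  tySub_id A := by simp [LFam.sub]
  tySub_comp τ σ A := by simp [LFam.sub]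
  tmSub_id t := LElt.ext_of (by simp [LElt.sub, LFam.sub]) (heq_of_eq (Category.id_comp _))
  tmSub_comp τ σ t :=
    LElt.ext_of (by simp [LElt.sub, LFam.sub]) (heq_of_eq (Category.assoc _ _ _))
  tp_sub σ t := rfl
  ext A := pullback A.cls A.proj
  disp A := pullback.fst A.cls A.proj
  var A :=
    { fam := A.sub (pullback.fst A.cls A.proj)
      el := pullback.snd A.cls A.proj
      el_proj := pullback.condition.symm }
  tp_var A := rfl
  pair σ A t h := pullback.lift σ (t.elAs (A.sub σ) h) (t.elAs_proj (A.sub σ) h).symm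
  pair_disp σ A t h := pullback.lift_fst _ _ _
  pair_var σ A t h := LElt.ext_of
    (by
      refine Eq.trans (congrArg (LFam.mk A.proj) ?_) h.symm
      exact (Category.assoc _ _ _).symm.trans (congrArg (· ≫ A.cls) (pullback.lift_fst _ _ _)))
    ((heq_of_eq (pullback.lift_snd _ _ _)).trans (t.heq_elAs (A.sub σ) h))
  ext_hom {Δ Γ A} f g h h' := by
    have h2 : f ≫ pullback.snd A.cls A.proj = g ≫ pullback.snd A.cls A.proj := by
      have : ∀ s t : LElt Δ, s = t → HEq s.el t.el := by rintro s _ rfl; rfl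
      exact eq_of_heq (this _ _ h')
    exact pullback.hom_ext h h2

end LocalUniverses

end CwF

section OrderRinged

open scoped CommRingObj

/-- An ordered commutative ring object: a commutative ring object with a total order (given as a
subobject `le` of `R ⊗ R`) compatible with addition and such that nonnegative elements are closed
under multiplication. The axioms are stated for generalized elements. Totality says that the join
of `le` and its opposite, in the poset of subobjects of `R ⊗ R`, is the whole of `R ⊗ R`. -/
structure OrderedCommRingObj (E : Type u) [Category.{v} E] [CartesianMonoidalCategory E]
    [BraidedCategory E] [HasPullbacks E] where
  R : E
  [commRing : CommRingObj R]
  le : Subobject (R ⊗ R)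
  le_refl {X : E} (i : X ⟶ R) : le.Factors (lift i i)
  le_trans {X : E} (i j k : X ⟶ R) :
    le.Factors (lift i j) → le.Factors (lift j k) → le.Factors (lift i k)
  le_antisymm {X : E} (i j : X ⟶ R) :
    le.Factors (lift i j) → le.Factors (lift j i) → i = j
  le_total : IsLUB {le, (Subobject.pullback (lift (snd R R) (fst R R))).obj le} ⊤
  add_le_add {X : E} (i j k : X ⟶ R) : le.Factors (lift i j) → le.Factors (lift (k + i) (k + j))
  mul_nonneg {X : E} (i j : X ⟶ R) :
    le.Factors (lift 0 i) → le.Factors (lift 0 j) → le.Factors (lift 0 (i * j))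

attribute [instance] OrderedCommRingObj.commRing

variable {E : Type u} [Category.{v} E] [CartesianMonoidalCategory E] [BraidedCategory E]
  [HasPullbacks E]

namespace OrderedCommRingObj

variable (R : OrderedCommRingObj E)

/-- The positive cone `{i : R | 0 ≤ i}`, as a subobject of `R`. -/
noncomputable def posSub : Subobject R.R :=
  (Subobject.pullback (lift (0 : R.R ⟶ R.R) (𝟙 R.R))).obj R.le

/-- The positive cone as an object. -/
noncomputable def Pos : E := (R.posSub : E)

/-- The inclusion of the positive cone in the ring. -/
noncomputable def incl : R.Pos ⟶ R.R := R.posSub.arrow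

/-- The order on generalized elements of the positive cone. -/
def PLe {X : E} (i j : X ⟶ R.Pos) : Prop := R.le.Factors (lift (i ≫ R.incl) (j ≫ R.incl))

theorem comp_zero' {X Y : E} (f : X ⟶ Y) : f ≫ (0 : Y ⟶ R.R) = 0 := AddMonObj.comp_zero f

theorem posSub_factors_zero (X : E) : R.posSub.Factors (0 : X ⟶ R.R) := by
  rw [posSub, pullback_factors_iff]
  have : (0 : X ⟶ R.R) ≫ lift (0 : R.R ⟶ R.R) (𝟙 R.R) = lift (0 : X ⟶ R.R) 0 := by
    rw [comp_lift, comp_zero', Category.comp_id]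
  rw [this]
  exact R.le_refl 0

/-- The zero of the positive cone, at stage `X`. -/
noncomputable def pzero (X : E) : X ⟶ R.Pos := R.posSub.factorThru 0 (R.posSub_factors_zero X)

theorem pzero_incl (X : E) : R.pzero X ≫ R.incl = 0 := Subobject.factorThru_arrow _ _ _

theorem incl_cancel {X : E} {i j : X ⟶ R.Pos} (h : i ≫ R.incl = j ≫ R.incl) : i = j :=
  (cancel_mono R.posSub.arrow).1 h

theorem comp_pzero {X Y : E} (f : X ⟶ Y) : f ≫ R.pzero Y = R.pzero X :=
  R.incl_cancel (by rw [Category.assoc, pzero_incl, pzero_incl, comp_zero'])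

end OrderedCommRingObj

/-- A Moore path in `Γ` at stage `X`, i.e. a generalized element of `∑ x y : Γ, (x ∼ y)`:
a function `Pos → Γ` and a shape `i : Pos` such that the function is constant on `{j | i ≤ j}`.
The end points are `src` and `tgt` below. -/
@[ext]
structure MPath (R : OrderedCommRingObj E) (Γ X : E) where
  fn : X ⊗ R.Pos ⟶ Γ
  shape : X ⟶ R.Pos
  const {Y : E} (u : Y ⟶ X) (j : Y ⟶ R.Pos) :
    R.PLe (u ≫ shape) j → lift u j ≫ fn = lift u (u ≫ shape) ≫ fn

namespace MPath

variable {R : OrderedCommRingObj E} {Γ X : E}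

/-- `p.app u j` is the value at `j` of the restriction of `p` along `u`. -/
noncomputable def app (p : MPath R Γ X) {Y : E} (u : Y ⟶ X) (j : Y ⟶ R.Pos) : Y ⟶ Γ := lift u j ≫ p.fn

/-- The start point of a path. -/
noncomputable def src (p : MPath R Γ X) : X ⟶ Γ := p.app (𝟙 X) (R.pzero X)

/-- The end point of a path. -/
noncomputable def tgt (p : MPath R Γ X) : X ⟶ Γ := p.app (𝟙 X) p.shape

/-- Restriction of a path along a change of stage. -/
noncomputable def restrict (p : MPath R Γ X) {Y : E} (u : Y ⟶ X) : MPath R Γ Y where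
  fn := u ▷ R.Pos ≫ p.fn
  shape := u ≫ p.shape
  const {Z} v j h := by
    have := p.const (v ≫ u) j (by simpa using h)
    simpa using this

/-- The congruence operation: a morphism `γ : Γ ⟶ Γ'` maps paths in `Γ` to paths in `Γ'`. -/
noncomputable def map (p : MPath R Γ X) {Γ' : E} (γ : Γ ⟶ Γ') : MPath R Γ' X where
  fn := p.fn ≫ γ
  shape := p.shape
  const u j h := by
    rw [← Category.assoc, p.const u j h, Category.assoc]

/-- The degenerate path at `x`. -/
noncomputable def idp (R : OrderedCommRingObj E) {Γ X : E} (x : X ⟶ Γ) : MPath R Γ X where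
  fn := fst X R.Pos ≫ x
  shape := R.pzero X
  const u j _ := by simp

theorem src_idp (x : X ⟶ Γ) : (idp R x).src = x := by simp [src, app, idp]

theorem tgt_idp (x : X ⟶ Γ) : (idp R x).tgt = x := by simp [tgt, app, idp]

theorem src_map (p : MPath R Γ X) {Γ' : E} (γ : Γ ⟶ Γ') : (p.map γ).src = p.src ≫ γ := by
  simp [src, app, map]

theorem tgt_map (p : MPath R Γ X) {Γ' : E} (γ : Γ ⟶ Γ') : (p.map γ).tgt = p.tgt ≫ γ := by
  simp [tgt, app, map]

theorem src_restrict (p : MPath R Γ X) {Y : E} (u : Y ⟶ X) : (p.restrict u).src = u ≫ p.src := by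
  simp only [src, app, restrict, lift_whiskerRight_assoc, comp_lift_assoc, Category.id_comp,
    Category.comp_id, R.comp_pzero]

theorem tgt_restrict (p : MPath R Γ X) {Y : E} (u : Y ⟶ X) : (p.restrict u).tgt = u ≫ p.tgt := by
  simp only [tgt, app, restrict, lift_whiskerRight_assoc, comp_lift_assoc, Category.id_comp,
    Category.comp_id]

theorem map_id (p : MPath R Γ X) : p.map (𝟙 Γ) = p := by
  ext1 <;> simp [map]

theorem map_comp (p : MPath R Γ X) {Γ' Γ'' : E} (γ : Γ ⟶ Γ') (γ' : Γ' ⟶ Γ'') :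
    p.map (γ ≫ γ') = (p.map γ).map γ' := by
  ext1 <;> simp [map]

theorem map_restrict (p : MPath R Γ X) {Γ' : E} (γ : Γ ⟶ Γ') {Y : E} (u : Y ⟶ X) :
    (p.restrict u).map γ = (p.map γ).restrict u := by
  ext1 <;> simp [map, restrict]

theorem map_idp (x : X ⟶ Γ) {Γ' : E} (γ : Γ ⟶ Γ') : (idp R x).map γ = idp R (x ≫ γ) := by
  ext1 <;> simp [map, idp]

/-- `m` is the minimum of `i` and `j` in the positive cone. -/
def IsMin {X : E} (m i j : X ⟶ R.Pos) : Prop :=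
  ∀ ⦃Y : E⦄ (u : Y ⟶ X),
    (R.PLe (u ≫ i) (u ≫ j) → u ≫ m = u ≫ i) ∧ (R.PLe (u ≫ j) (u ≫ i) → u ≫ m = u ≫ j)

/-- `q` is the contraction of `p` up to `i`: its shape is `min |p| i`, and it agrees with `p` up
to its shape (after which every path is constant). -/
def IsUpto (p : MPath R Γ X) (i : X ⟶ R.Pos) (q : MPath R Γ X) : Prop :=
  IsMin q.shape p.shape i ∧
  ∀ ⦃Y : E⦄ (u : Y ⟶ X) (k : Y ⟶ R.Pos), R.PLe k (u ≫ q.shape) → q.app u k = p.app u k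

/-- `r` is the reverse of `p`: it has the same shape and `r i = p (|p| ∸ i)`, where the truncated
subtraction `|p| ∸ i` is `0` if `|p| ≤ i` and is `|p| - i` if this lies in the positive cone. -/
def IsRev (p r : MPath R Γ X) : Prop :=
  r.shape = p.shape ∧
  ∀ ⦃Y : E⦄ (u : Y ⟶ X) (i : Y ⟶ R.Pos),
    (R.PLe (u ≫ p.shape) i → r.app u i = p.app u (R.pzero Y)) ∧
    ∀ m : Y ⟶ R.Pos, m ≫ R.incl = u ≫ p.shape ≫ R.incl - i ≫ R.incl → r.app u i = p.app u m

end MPath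

/-- A transport-along-paths structure on a family `A` over `Γ`: a family of functions
`x ∼ y → (A x → A y)` indexed by `x y : Γ`, given on generalized elements naturally in the stage,
for which transport along a degenerate path is the identity. -/
structure Tap (𝒞 : CwF.{w} E) (R : OrderedCommRingObj E) {Γ : E} (A : 𝒞.Ty Γ) where
  tr {X : E} (p : MPath R Γ X) (a : 𝒞.Tm X) (ha : 𝒞.tp a = 𝒞.tySub p.src A) : 𝒞.Tm X
  tp_tr {X : E} (p : MPath R Γ X) (a : 𝒞.Tm X) (ha : 𝒞.tp a = 𝒞.tySub p.src A) :
    𝒞.tp (tr p a ha) = 𝒞.tySub p.tgt A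
  tr_restrict {X : E} (p : MPath R Γ X) (a : 𝒞.Tm X) (ha : 𝒞.tp a = 𝒞.tySub p.src A)
    {Y : E} (u : Y ⟶ X) :
    𝒞.tmSub u (tr p a ha) = tr (p.restrict u) (𝒞.tmSub u a)
      (by rw [𝒞.tp_sub, ha, p.src_restrict, 𝒞.tySub_comp])
  tr_idp {X : E} (x : X ⟶ Γ) (a : 𝒞.Tm X) (ha : 𝒞.tp a = 𝒞.tySub x A) :
    tr (MPath.idp R x) a (by rw [ha, MPath.src_idp]) = a

/-- The fibrations over `Γ`: families equipped with a transport-along-paths structure. -/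
structure Fib (𝒞 : CwF.{w} E) (R : OrderedCommRingObj E) (Γ : E) where
  ty : 𝒞.Ty Γ
  tap : Tap 𝒞 R ty

namespace Fib

variable {𝒞 : CwF.{w} E} {R : OrderedCommRingObj E}

theorem ext_of {Γ : E} {A A' : Fib 𝒞 R Γ} (h : A.ty = A'.ty)
    (h' : ∀ {X : E} (p : MPath R Γ X) (a : 𝒞.Tm X) (ha) (ha'),
      A.tap.tr p a ha = A'.tap.tr p a ha') : A = A' := by
  obtain ⟨t, ⟨tr, _, _, _⟩⟩ := A
  obtain ⟨t', ⟨tr', _, _, _⟩⟩ := A'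
  dsimp only at h
  subst h
  have : @tr = @tr' := by
    funext X p a ha
    exact h' p a ha ha
  subst this
  rfl

theorem tr_congr {Γ : E} {A : 𝒞.Ty Γ} (t : Tap 𝒞 R A) {X : E} {p p' : MPath R Γ X} (hp : p = p')
    {a a' : 𝒞.Tm X} (h : a = a') (ha) (ha') : t.tr p a ha = t.tr p' a' ha' := by
  subst hp h
  rfl

/-- Re-indexing of fibrations: transport in `Aγ` along `p` is transport in `A` along the image of
`p` under `γ`. -/
noncomputable def sub {Δ Γ : E} (γ : Δ ⟶ Γ) (A : Fib 𝒞 R Γ) : Fib 𝒞 R Δ where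
  ty := 𝒞.tySub γ A.ty
  tap :=
    { tr := fun p a ha => A.tap.tr (p.map γ) a (by rw [ha, p.src_map, 𝒞.tySub_comp])
      tp_tr := fun p a ha => by rw [A.tap.tp_tr, p.tgt_map, 𝒞.tySub_comp]
      tr_restrict := fun p a ha Y u => by
        rw [A.tap.tr_restrict]
        exact tr_congr _ (p.map_restrict γ u).symm rfl _ _
      tr_idp := fun x a ha =>
        (tr_congr _ (MPath.map_idp x γ) rfl _ _).trans
          (A.tap.tr_idp (x ≫ γ) a (by rw [ha, 𝒞.tySub_comp])) }

/-- An element of a fibration is an element of the underlying family. -/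
structure Elt (𝒞 : CwF.{w} E) (R : OrderedCommRingObj E) (Γ : E) where
  fib : Fib 𝒞 R Γ
  tm : 𝒞.Tm Γ
  tp_tm : 𝒞.tp tm = fib.ty

theorem Elt.ext_of {Γ : E} {s t : Elt 𝒞 R Γ} (h : s.fib = t.fib) (h' : s.tm = t.tm) : s = t := by
  obtain ⟨f, e, _⟩ := s
  obtain ⟨f', e', _⟩ := t
  dsimp only at h h'
  subst h h'
  rfl

theorem sub_id {Γ : E} (A : Fib 𝒞 R Γ) : A.sub (𝟙 Γ) = A :=
  ext_of (𝒞.tySub_id _) fun p _ _ _ => tr_congr A.tap p.map_id rfl _ _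

theorem sub_comp {Θ Δ Γ : E} (τ : Θ ⟶ Δ) (σ : Δ ⟶ Γ) (A : Fib 𝒞 R Γ) :
    A.sub (τ ≫ σ) = (A.sub σ).sub τ :=
  ext_of (𝒞.tySub_comp _ _ _) fun p _ _ _ => tr_congr A.tap (p.map_comp τ σ) rfl _ _

variable (𝒞 R) in
/-- The category with families of fibrations. -/
noncomputable def cwf : CwF.{max u v w} E where
  hasTerminal := 𝒞.hasTerminal
  Ty Γ := Fib 𝒞 R Γ
  Tm Γ := Elt 𝒞 R Γ
  tp t := t.fib
  tySub σ A := A.sub σ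
  tmSub σ t :=
    { fib := t.fib.sub σ
      tm := 𝒞.tmSub σ t.tm
      tp_tm := by rw [𝒞.tp_sub, t.tp_tm]; rfl }
  tySub_id A := A.sub_id
  tySub_comp τ σ A := A.sub_comp τ σ
  tmSub_id t := Elt.ext_of t.fib.sub_id (𝒞.tmSub_id _)
  tmSub_comp τ σ t := Elt.ext_of (t.fib.sub_comp τ σ) (𝒞.tmSub_comp _ _ _)
  tp_sub σ t := rfl
  ext A := 𝒞.ext A.ty
  disp A := 𝒞.disp A.ty
  var A :=
    { fib := A.sub (𝒞.disp A.ty)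
      tm := 𝒞.var A.ty
      tp_tm := 𝒞.tp_var A.ty }
  tp_var A := rfl
  pair σ A t h := 𝒞.pair σ A.ty t.tm (by rw [t.tp_tm, h]; rfl)
  pair_disp σ A t h := 𝒞.pair_disp _ _ _ _
  pair_var σ A t h := Elt.ext_of
    (by
      have := A.sub_comp (𝒞.pair σ A.ty t.tm (by rw [t.tp_tm, h]; rfl)) (𝒞.disp A.ty)
      rw [𝒞.pair_disp] at this
      exact this.symm.trans h.symm)
    (𝒞.pair_var _ _ _ _)
  ext_hom f g h h' := 𝒞.ext_hom f g h (congrArg Elt.tm h')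

/-- The node of underlying families and elements given by a node of fibrations. -/
noncomputable def forgetNode {Γ : E} {A : Fib 𝒞 R Γ} {B : Fib 𝒞 R (𝒞.ext A.ty)} {Y : Fib 𝒞 R Γ}
    {Δ : E} {σ : Δ ⟶ Γ} (n : (cwf 𝒞 R).Node A B Y σ) : 𝒞.Node A.ty B.ty Y.ty σ where
  label := n.label.tm
  tp_label := n.label.tp_tm.trans (congrArg Fib.ty n.tp_label)
  T := n.T.ty
  T_eq := congrArg Fib.ty n.T_eq
  branch := n.branch.tm
  tp_branch := n.branch.tp_tm.trans (congrArg Fib.ty n.tp_branch)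

/-- `l` is the lifting of the path `p : x ∼ y` in `Γ` and `a : A x` to a path in `Γ.A` from
`(x, a)`: its shape is that of `p`, and for `k ≤ |p|` its value at `k` is the pair of `p k` and the
transport of `a` along the contraction of `p` up to `k` (after `|p|` every path of this shape is
constant). -/
def IsLift {Γ : E} (A : Fib 𝒞 R Γ) {X : E} (p : MPath R Γ X) (a : 𝒞.Tm X)
    (l : MPath R (𝒞.ext A.ty) X) : Prop :=
  l.shape = p.shape ∧
  ∀ ⦃Y : E⦄ (u : Y ⟶ X) (k : Y ⟶ R.Pos), R.PLe k (u ≫ p.shape) →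
    l.app u k ≫ 𝒞.disp A.ty = p.app u k ∧
    ∃ (q : MPath R Γ Y) (h : 𝒞.tp (𝒞.tmSub u a) = 𝒞.tySub q.src A.ty),
      (p.restrict u).IsUpto k q ∧
      𝒞.tmSub (l.app u k) (𝒞.var A.ty) = A.tap.tr q (𝒞.tmSub u a) h

/-- The recursion equation
`p∗ sup (a, f) = sup (p∗ a, λ b, p∗ (f ((rev (lift (p, a)))∗ b)))`
for a transport-along-paths structure `t` on the `W`-type `W A B`. Here `l` is the lifted path, `r`
its reverse, `n'` is the node on the right hand side, and `g : X.B(y, p∗ a) ⟶ X.B(x, a)` is the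
morphism over `X` given by transport along `r`. -/
def WTransportEq (I : 𝒞.WIntro) {Γ : E} (A : Fib 𝒞 R Γ) (B : Fib 𝒞 R (𝒞.ext A.ty))
    (t : Tap 𝒞 R (I.W A.ty B.ty)) : Prop :=
  ∀ ⦃X : E⦄ (p : MPath R Γ X) (n : 𝒞.Node A.ty B.ty (I.W A.ty B.ty) p.src),
    ∃ (l r : MPath R (𝒞.ext A.ty) X) (n' : 𝒞.Node A.ty B.ty (I.W A.ty B.ty) p.tgt)
      (g : 𝒞.ext n'.T ⟶ 𝒞.ext n.T),
      IsLift A p n.label l ∧ l.IsRev r ∧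
      n'.label = A.tap.tr p n.label n.tp_label ∧
      g ≫ 𝒞.disp n.T = 𝒞.disp n'.T ∧
      (∃ h, 𝒞.tmSub g (𝒞.var n.T) = B.tap.tr (r.restrict (𝒞.disp n'.T)) (𝒞.var n'.T) h) ∧
      (∃ h, n'.branch = t.tr (p.restrict (𝒞.disp n'.T)) (𝒞.tmSub g n.branch) h) ∧
      t.tr p (I.sup rfl p.src n) (I.tp_sup rfl p.src n) = I.sup rfl p.tgt n'

end Fib

end OrderRinged

/-- `E` has a natural numbers object. -/
def HasNNO (E : Type u) [Category.{v} E] [CartesianMonoidalCategory E] : Prop :=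
  ∃ (N : E) (z : 𝟙_ E ⟶ N) (s : N ⟶ N), ∀ ⦃X : E⦄ (x : 𝟙_ E ⟶ X) (f : X ⟶ X),
    ∃! h : N ⟶ X, z ≫ h = x ∧ s ≫ h = h ≫ f

/-! A predicate on generalized elements that is represented by a subobject (`IsRep`) behaves like a
formula of the internal language, and such predicates are closed under conjunction, implication,
universal quantification and unique existence. The last (`isRep_existsUnique`) takes the place of
choice: what is shown to exist uniquely, by induction or by a case distinction, exists as a
morphism.

W-types of the topos. The natural numbers object gives objects of streams, and coding a tree by a
set of streams gives an object with a stable and injective operation `sup` (`exists_supObject`).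
Given a set of admissible pairs of a label and an arity, the trees are the elements of the smallest
subset closed under `sup`. That it is an intersection of closed subsets is induction; induction and
injectivity of `sup` give recursion (`exists_section`). For strict stability, the local universe of
`W A B` consists of the trees over all sets of admissible pairs. It depends only on the total object
of `A` and the local universe of `B`, which re-indexing does not touch; only the classifying
morphism changes, and it does so by composition (`LFam.code_sub`). Eliminators are unique by
induction, hence stable.

Transport. Any structure of W-types on the topos has induction, by elimination into a subobject
(`WTypes.hasInduction`). For a path `p` at stage `X`, the required equation is a definition by
recursion of a map from the W-type pulled back along the source of `p` to the one pulled back along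
its target; stability of W-types makes the former a W-type over `X`, so that the map exists
(`PathTransport.nonempty`). By induction it is the only solution of the equation (`tr_unique`). The
rest is uniqueness: the restriction of a solution is a solution, which is naturality; the identity
is a solution along a degenerate path, because its lift and the reverse of that are degenerate and
transport in `A` and `B` along degenerate paths is trivial (`trNode_idp`); a solution along the
image of a path gives one for the re-indexed data, because lifting and reversal commute with
morphisms.

The total order serves to make case distinctions (`ple_cases`), by which minimum and truncated
subtraction, and so contractions, lifts and reverses, are defined. Finally, elements of a fibration
are elements of its underlying family, so elimination for fibrations is elimination for the families
(`Fib.wTypes`). -/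

namespace KripkeJoyal

/-! ### Representable predicates and the logic of the topos. -/

open MonoidalClosed

variable {E : Type u} [Category.{v} E]

/-- A predicate on the generalized elements of `Γ`. -/
abbrev Pred (Γ : E) := ∀ Δ : E, (Δ ⟶ Γ) → Prop

/-- The predicate `φ` is membership in a subobject of `Γ`. -/
def IsRep {Γ : E} (φ : Pred Γ) : Prop :=
  ∃ (S : E) (m : S ⟶ Γ), Mono m ∧ ∀ (Δ : E) (σ : Δ ⟶ Γ), φ Δ σ ↔ ∃ s, s ≫ m = σ

theorem IsRep.res {Γ : E} {φ : Pred Γ} (h : IsRep φ) {Δ : E} {σ : Δ ⟶ Γ} (hσ : φ Δ σ) {Θ : E}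
    (θ : Θ ⟶ Δ) : φ Θ (θ ≫ σ) := by
  obtain ⟨S, m, -, hm⟩ := h
  obtain ⟨s, rfl⟩ := (hm _ _).1 hσ
  exact (hm _ _).2 ⟨θ ≫ s, Category.assoc _ _ _⟩

theorem IsRep.congr {Γ : E} {φ ψ : Pred Γ} (h : IsRep φ) (e : ∀ Δ σ, φ Δ σ ↔ ψ Δ σ) : IsRep ψ := by
  obtain ⟨S, m, hm, hφ⟩ := h
  exact ⟨S, m, hm, fun Δ σ => (e Δ σ).symm.trans (hφ Δ σ)⟩

theorem isRep_factors {Γ : E} (S : Subobject Γ) : IsRep (fun _ (σ : _ ⟶ Γ) => S.Factors σ) :=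
  ⟨_, S.arrow, inferInstance, fun _ σ =>
    ⟨fun h => ⟨S.factorThru σ h, S.factorThru_arrow σ h⟩,
      by rintro ⟨s, rfl⟩; exact Subobject.factors_comp_arrow s⟩⟩

theorem isRep_exists {Γ S : E} (m : S ⟶ Γ) [Mono m] :
    IsRep (fun Δ (σ : Δ ⟶ Γ) => ∃ s, s ≫ m = σ) :=
  ⟨S, m, inferInstance, fun _ _ => Iff.rfl⟩

theorem IsRep.subobject {Γ : E} {φ : Pred Γ} (h : IsRep φ) :
    ∃ S : Subobject Γ, ∀ Δ (σ : Δ ⟶ Γ), φ Δ σ ↔ S.Factors σ := by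
  obtain ⟨S, m, hm, hφ⟩ := h
  exact ⟨Subobject.mk m, fun Δ σ => (hφ Δ σ).trans
    ⟨fun ⟨s, hs⟩ => (Subobject.mk_factors_iff m σ).2 ⟨s, hs⟩,
      fun h => by
        obtain ⟨s, hs⟩ := (Subobject.mk_factors_iff m σ).1 h
        exact ⟨s, hs⟩⟩⟩

section TruthValues

variable [HasSubobjectClassifier E]

variable (E) in
/-- The object of truth values. -/
noncomputable abbrev Om : E := HasSubobjectClassifier.Ω E

/-- The true truth value at stage `Γ`. -/
noncomputable def tru (Γ : E) : Γ ⟶ Om E :=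
  Subobject.Classifier.χ₀ _ Γ ≫ HasSubobjectClassifier.truth E

theorem comp_tru {Δ Γ : E} (σ : Δ ⟶ Γ) : σ ≫ tru Γ = tru Δ := by
  rw [tru, tru, ← Category.assoc]
  congr 1
  exact Subsingleton.elim _ _

end TruthValues

section FiniteLimits

variable [HasFiniteLimits E]

theorem isRep_eq {Γ X : E} (f g : Γ ⟶ X) : IsRep (fun Δ (σ : Δ ⟶ Γ) => σ ≫ f = σ ≫ g) :=
  ⟨_, equalizer.ι f g, inferInstance, fun _ σ =>
    ⟨fun h => ⟨equalizer.lift σ h, equalizer.lift_ι _ _⟩,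
      by rintro ⟨s, rfl⟩; rw [Category.assoc, Category.assoc, equalizer.condition]⟩⟩

theorem IsRep.comp {Γ Γ' : E} {φ : Pred Γ} (h : IsRep φ) (f : Γ' ⟶ Γ) :
    IsRep (fun Δ (σ : Δ ⟶ Γ') => φ Δ (σ ≫ f)) := by
  obtain ⟨S, m, hm, hφ⟩ := h
  refine ⟨_, pullback.fst f m, inferInstance, fun Δ σ => (hφ _ _).trans ⟨?_, ?_⟩⟩
  · rintro ⟨s, hs⟩
    exact ⟨pullback.lift σ s hs.symm, pullback.lift_fst _ _ _⟩
  · rintro ⟨s, rfl⟩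
    exact ⟨s ≫ pullback.snd f m, by simp [pullback.condition]⟩

theorem IsRep.and {Γ : E} {φ ψ : Pred Γ} (h : IsRep φ) (h' : IsRep ψ) :
    IsRep (fun Δ (σ : Δ ⟶ Γ) => φ Δ σ ∧ ψ Δ σ) := by
  obtain ⟨S, m, hm, hφ⟩ := h
  obtain ⟨T, k, hk, hψ⟩ := h'.comp m
  refine ⟨T, k ≫ m, mono_comp _ _, fun Δ σ => ⟨?_, ?_⟩⟩
  · rintro ⟨h1, h2⟩
    obtain ⟨s, rfl⟩ := (hφ _ _).1 h1
    obtain ⟨t, rfl⟩ := (hψ _ _).1 h2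
    exact ⟨t, (Category.assoc _ _ _).symm⟩
  · rintro ⟨t, rfl⟩
    exact ⟨(hφ _ _).2 ⟨t ≫ k, Category.assoc _ _ _⟩, by
      simpa using (hψ _ (t ≫ k)).2 ⟨t, rfl⟩⟩

variable [HasSubobjectClassifier E]

omit [HasFiniteLimits E] in
theorem comp_chi_eq_tru_iff {Γ S : E} (m : S ⟶ Γ) [Mono m] {Δ : E} (σ : Δ ⟶ Γ) :
    σ ≫ HasSubobjectClassifier.χ m = tru Δ ↔ ∃ s, s ≫ m = σ := by
  constructor
  · intro h
    exact ⟨(HasSubobjectClassifier.isPullback_χ m).lift σ _ h, IsPullback.lift_fst _ _ _ _⟩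
  · rintro ⟨s, rfl⟩
    rw [Category.assoc, HasSubobjectClassifier.comm, ← comp_tru s]
    rfl

omit [HasFiniteLimits E] in
theorem IsRep.chi {Γ : E} {φ : Pred Γ} (h : IsRep φ) :
    ∃ c : Γ ⟶ Om E, ∀ Δ σ, φ Δ σ ↔ σ ≫ c = tru Δ := by
  obtain ⟨S, m, hm, hφ⟩ := h
  exact ⟨HasSubobjectClassifier.χ m, fun Δ σ => (hφ Δ σ).trans (comp_chi_eq_tru_iff m σ).symm⟩

theorem isRep_tru {Γ : E} (c : Γ ⟶ Om E) : IsRep (fun Δ (σ : Δ ⟶ Γ) => σ ≫ c = tru Δ) :=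
  (isRep_eq c (tru Γ)).congr fun _ _ => by rw [comp_tru]

/-- Both morphisms classify the same subobject, and classifying morphisms are unique. -/
theorem chi_ext {Γ : E} {c c' : Γ ⟶ Om E}
    (h : ∀ Δ (σ : Δ ⟶ Γ), σ ≫ c = tru Δ ↔ σ ≫ c' = tru Δ) : c = c' := by
  obtain ⟨S, m, hm, hφ⟩ := isRep_tru c
  have key : ∀ c'' : Γ ⟶ Om E, (∀ Δ (σ : Δ ⟶ Γ), σ ≫ c'' = tru Δ ↔ ∃ s, s ≫ m = σ) →
      c'' = HasSubobjectClassifier.χ m := by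
    intro c'' h''
    apply HasSubobjectClassifier.unique
    have w : m ≫ c'' = Subobject.Classifier.χ₀ _ S ≫ HasSubobjectClassifier.truth E :=
      (h'' _ m).2 ⟨𝟙 _, Category.id_comp _⟩
    refine ⟨⟨w⟩, ⟨PullbackCone.IsLimit.mk _ (fun s => ((h'' _ s.fst).1 ?_).choose) ?_ ?_ ?_⟩⟩
    · rw [s.condition, tru]
      congr 1
      exact Subsingleton.elim _ _
    · intro s
      exact Exists.choose_spec (p := fun t => t ≫ m = s.fst) _
    · intro s
      exact Subsingleton.elim _ _
    · intro s t h1 _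
      rw [← cancel_mono m, h1]
      exact (Exists.choose_spec (p := fun t => t ≫ m = s.fst) _).symm
  rw [key c hφ, key c' fun Δ σ => (h Δ σ).symm.trans (hφ Δ σ)]

/-- An implication amounts to the equality of `φ` and `φ ∧ ψ`, so the equalizer of their classifying
morphisms represents it. -/
theorem IsRep.imp {Γ : E} {φ ψ : Pred Γ} (h : IsRep φ) (h' : IsRep ψ) :
    IsRep (fun Δ (σ : Δ ⟶ Γ) => ∀ (Θ : E) (θ : Θ ⟶ Δ), φ Θ (θ ≫ σ) → ψ Θ (θ ≫ σ)) := by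
  obtain ⟨c, hc⟩ := h.chi
  obtain ⟨d, hd⟩ := (h.and h').chi
  refine (isRep_eq c d).congr fun Δ σ => ⟨fun e Θ θ hφ => ?_, fun H => ?_⟩
  · refine ((hd Θ (θ ≫ σ)).2 ?_).2
    rw [Category.assoc, ← e, ← Category.assoc, ← hc]
    exact hφ
  · refine chi_ext fun Θ θ => ?_
    rw [← Category.assoc, ← Category.assoc, ← hc, ← hd]
    exact ⟨fun h => ⟨h, H _ _ h⟩, fun h => h.1⟩

-- Ex falso: at a stage where all truth values are true, falsity is forced.
omit [HasFiniteLimits E] in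
theorem IsRep.of_false {Γ : E} {φ : Pred Γ} (h : IsRep φ) {Δ : E} (σ : Δ ⟶ Γ)
    (hΔ : ∀ (k : Δ ⟶ Om E), k = tru Δ) : φ Δ σ := by
  obtain ⟨c, hc⟩ := h.chi
  exact (hc _ _).2 (hΔ _)

/-- The conclusion of an implication has to be representable only where the premise holds. -/
theorem IsRep.dimp {Γ : E} {φ ψ : Pred Γ} (h : IsRep φ)
    (h' : ∀ {S : E} (m : S ⟶ Γ), φ S m → IsRep (fun Δ (s : Δ ⟶ S) => ψ Δ (s ≫ m))) :
    IsRep (fun Δ (σ : Δ ⟶ Γ) => ∀ (Θ : E) (θ : Θ ⟶ Δ), φ Θ (θ ≫ σ) → ψ Θ (θ ≫ σ)) := by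
  have h2 : IsRep (fun Δ (σ : Δ ⟶ Γ) => φ Δ σ ∧ ψ Δ σ) := by
    obtain ⟨S, m, hm, hφ⟩ := id h
    obtain ⟨T, k, hk, hψ⟩ := h' m ((hφ _ _).2 ⟨𝟙 _, Category.id_comp _⟩)
    refine ⟨T, k ≫ m, mono_comp _ _, fun Δ σ => ⟨?_, ?_⟩⟩
    · rintro ⟨h1, h2⟩
      obtain ⟨s, rfl⟩ := (hφ _ _).1 h1
      obtain ⟨t, rfl⟩ := (hψ _ _).1 h2
      exact ⟨t, (Category.assoc _ _ _).symm⟩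
    · rintro ⟨t, rfl⟩
      exact ⟨(hφ _ _).2 ⟨t ≫ k, Category.assoc _ _ _⟩, by
        simpa using (hψ _ (t ≫ k)).2 ⟨t, rfl⟩⟩
  exact (h.imp h2).congr fun Δ σ =>
    ⟨fun H Θ θ hφ => (H Θ θ hφ).2, fun H Θ θ hφ => ⟨hφ, H Θ θ hφ⟩⟩

end FiniteLimits

section Topos

variable [CartesianMonoidalCategory E] [HasFiniteLimits E] [MonoidalClosed E]
  [HasSubobjectClassifier E]

/-- The power object of `K`. -/
noncomputable abbrev Pow (K : E) : E := (ihom K).obj (Om E)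

/-- Membership of generalized elements. -/
def Mem {K Δ : E} (k : Δ ⟶ K) (s : Δ ⟶ Pow K) : Prop :=
  lift k s ≫ (ihom.ev K).app (Om E) = tru Δ

theorem isRep_mem {K Γ : E} (k : Γ ⟶ K) (s : Γ ⟶ Pow K) :
    IsRep (fun _ (σ : _ ⟶ Γ) => Mem (σ ≫ k) (σ ≫ s)) :=
  (isRep_tru (lift k s ≫ (ihom.ev K).app (Om E))).congr fun Δ σ => by
    rw [Mem, ← comp_lift, Category.assoc]

omit [HasFiniteLimits E] in
theorem Mem.res {K Δ Θ : E} {k : Δ ⟶ K} {s : Δ ⟶ Pow K} (h : Mem k s) (θ : Θ ⟶ Δ) :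
    Mem (θ ≫ k) (θ ≫ s) := by
  rw [Mem, ← comp_lift, Category.assoc, h, comp_tru]

/-- Extensionality of subsets, reduced to that of truth values by uncurrying. -/
theorem pow_ext {K Δ : E} {s t : Δ ⟶ Pow K}
    (h : ∀ Θ (θ : Θ ⟶ Δ) (k : Θ ⟶ K), Mem k (θ ≫ s) ↔ Mem k (θ ≫ t)) : s = t := by
  apply uncurry_injective
  apply chi_ext
  intro Θ σ
  have := h Θ (σ ≫ snd _ _) (σ ≫ fst _ _)
  rw [Mem, Mem] at this
  have e : ∀ r : Δ ⟶ Pow K, lift (σ ≫ fst _ _) ((σ ≫ snd _ _) ≫ r) ≫ (ihom.ev K).app (Om E)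
      = σ ≫ uncurry r := by
    intro r
    rw [uncurry_eq, ← Category.assoc]
    congr 1
    ext <;> simp
  rwa [e, e] at this

omit [HasFiniteLimits E] in
/-- Comprehension: the name in the power object of a representable predicate. -/
theorem exists_name {K Γ : E} {Φ : ∀ Δ : E, (Δ ⟶ Γ) → (Δ ⟶ K) → Prop}
    (h : IsRep (Γ := Γ ⊗ K) (fun Δ σ => Φ Δ (σ ≫ fst _ _) (σ ≫ snd _ _))) :
    ∃ s : Γ ⟶ Pow K, ∀ (Δ : E) (σ : Δ ⟶ Γ) (k : Δ ⟶ K), Mem k (σ ≫ s) ↔ Φ Δ σ k := by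
  obtain ⟨c, hc⟩ := h.chi
  refine ⟨curry (lift (snd K Γ) (fst K Γ) ≫ c), fun Δ σ k => ?_⟩
  have := hc Δ (lift σ k)
  simp only [lift_fst, lift_snd] at this
  rw [this, Mem]
  have e : lift k (σ ≫ curry (lift (snd K Γ) (fst K Γ) ≫ c)) ≫ (ihom.ev K).app (Om E) =
      lift σ k ≫ c := by
    have : lift k (σ ≫ curry (lift (snd K Γ) (fst K Γ) ≫ c)) =
      lift k σ ≫ (K ◁ curry (lift (snd K Γ) (fst K Γ) ≫ c)) := by ext <;> simp
    rw [this, Category.assoc, ← uncurry_eq, uncurry_curry, ← Category.assoc]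
    congr 1
    ext <;> simp
  rw [e]

/-- Universal quantification says that the subset of `K` named by `Φ` is all of `K`; this is an
equalizer of two morphisms to the power object. -/
theorem isRep_all {K Γ : E} {Φ : ∀ Δ : E, (Δ ⟶ Γ) → (Δ ⟶ K) → Prop}
    (h : IsRep (Γ := Γ ⊗ K) (fun Δ σ => Φ Δ (σ ≫ fst _ _) (σ ≫ snd _ _))) :
    IsRep (fun Δ (σ : Δ ⟶ Γ) => ∀ (Θ : E) (θ : Θ ⟶ Δ) (k : Θ ⟶ K), Φ Θ (θ ≫ σ) k) := by
  obtain ⟨s, hs⟩ := exists_name h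
  have htop : IsRep (Γ := Γ ⊗ K) (fun _ _ => True) :=
    ⟨_, 𝟙 _, inferInstance, fun _ σ => ⟨fun _ => ⟨σ, Category.comp_id _⟩, fun _ => trivial⟩⟩
  obtain ⟨t, ht⟩ := exists_name (Φ := fun _ _ _ => True) htop
  refine (isRep_eq s t).congr fun Δ σ => ⟨fun e Θ θ k => ?_, fun H => ?_⟩
  · rw [← hs, Category.assoc, e, ← Category.assoc, ht]
    trivial
  · refine pow_ext fun Θ θ k => ?_
    rw [← Category.assoc, ← Category.assoc, hs, ht]
    exact ⟨fun _ => trivial, fun _ => H _ _ _⟩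

theorem isRep_all_imp {K Γ : E} {Φ Ψ : ∀ Δ : E, (Δ ⟶ Γ) → (Δ ⟶ K) → Prop}
    (h : IsRep (Γ := Γ ⊗ K) (fun Δ σ => Φ Δ (σ ≫ fst _ _) (σ ≫ snd _ _)))
    (h' : IsRep (Γ := Γ ⊗ K) (fun Δ σ => Ψ Δ (σ ≫ fst _ _) (σ ≫ snd _ _))) :
    IsRep (fun Δ (σ : Δ ⟶ Γ) =>
      ∀ (Θ : E) (θ : Θ ⟶ Δ) (k : Θ ⟶ K), Φ Θ (θ ≫ σ) k → Ψ Θ (θ ≫ σ) k) := by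
  refine (isRep_all (Φ := fun Δ σ k => ∀ (Θ : E) (θ : Θ ⟶ Δ), Φ Θ (θ ≫ σ) (θ ≫ k) →
    Ψ Θ (θ ≫ σ) (θ ≫ k)) ?_).congr fun Δ σ => ⟨fun H Θ θ k => ?_, fun H Θ θ k Θ' θ' => ?_⟩
  · refine (h.imp h').congr fun Δ σ => ?_
    simp only [Category.assoc]
  · simpa using H Θ θ k Θ (𝟙 _)
  · rw [← Category.assoc]
    exact H _ _ _

variable (E) in
/-- A truth value is false if it implies all others. -/
theorem isRep_false {Γ : E} :
    IsRep (fun Δ (_ : Δ ⟶ Γ) => ∀ (Θ : E) (_ : Θ ⟶ Δ) (k : Θ ⟶ Om E), k = tru Θ) :=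
  isRep_all (Φ := fun Δ _ k => k = tru Δ) (isRep_tru (snd Γ (Om E)))

theorem exists_singleton (K : E) :
    ∃ s : K ⟶ Pow K, ∀ (Δ : E) (σ k : Δ ⟶ K), Mem k (σ ≫ s) ↔ k = σ :=
  exists_name (Φ := fun _ σ k => k = σ) (isRep_eq _ _)

/-- The singleton map. -/
noncomputable def sing (K : E) : K ⟶ Pow K := (exists_singleton K).choose

theorem mem_sing {K Δ : E} (σ k : Δ ⟶ K) : Mem k (σ ≫ sing K) ↔ k = σ :=
  (exists_singleton K).choose_spec Δ σ k

theorem sing_injective {K Δ : E} {k k' : Δ ⟶ K} (h : k ≫ sing K = k' ≫ sing K) : k = k' := by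
  rw [← mem_sing, ← h, mem_sing]

instance (K : E) : Mono (sing K) := ⟨fun _ _ h => sing_injective h⟩

/-- Unique existence, as forced at a stage. -/
theorem isRep_existsUnique {K Γ : E} {Φ : ∀ Δ : E, (Δ ⟶ Γ) → (Δ ⟶ K) → Prop}
    (h : IsRep (Γ := Γ ⊗ K) (fun Δ σ => Φ Δ (σ ≫ fst _ _) (σ ≫ snd _ _))) :
    IsRep (fun Δ (σ : Δ ⟶ Γ) => ∃ k : Δ ⟶ K, ∀ (Θ : E) (θ : Θ ⟶ Δ) (k' : Θ ⟶ K),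
      Φ Θ (θ ≫ σ) k' ↔ k' = θ ≫ k) := by
  obtain ⟨s, hs⟩ := exists_name h
  -- Unique existence says that the named subset is a singleton. Because `sing K` is a monomorphism,
  -- this pulls back to a subobject, and the witness is a morphism at the given stage, with no
  -- passage to a cover.
  refine ((isRep_exists (sing K)).comp s).congr fun Δ σ => exists_congr fun k => ?_
  constructor
  · intro e Θ θ k'
    rw [← hs, Category.assoc, ← e, ← Category.assoc, mem_sing]
  · intro H
    refine pow_ext fun Θ θ k' => ?_
    rw [← Category.assoc, ← Category.assoc, mem_sing, hs, H]

end Topos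

end KripkeJoyal

/-! ### Streams, families over fibres, and an injective `sup`. -/

namespace KripkeJoyal

open MonoidalClosed

variable {E : Type u} [Category.{v} E] [CartesianMonoidalCategory E]

attribute [local simp] pullback.lift_fst pullback.lift_snd pullback.lift_fst_assoc
  pullback.lift_snd_assoc

/-- In the presence of a natural numbers object, every `D` has an object of sequences. -/
theorem exists_stream [MonoidalClosed E] (hN : HasNNO E) (D : E) :
    ∃ (Q : E) (cons : D ⊗ Q ⟶ Q) (hd : Q ⟶ D) (tl : Q ⟶ Q),
      cons ≫ hd = fst _ _ ∧ cons ≫ tl = snd _ _ ∧ ∀ {Δ : E}, (Δ ⟶ D) → Nonempty (Δ ⟶ Q) := by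
  obtain ⟨N, z, s, hN⟩ := hN
  obtain ⟨Q, ev, hev, hev'⟩ : ∃ (Q : E) (ev : N ⊗ Q ⟶ D),
      (∀ {P : E} (k : N ⊗ P ⟶ D), ∃ c : P ⟶ Q, N ◁ c ≫ ev = k) ∧
      (∀ {P : E} (c c' : P ⟶ Q), N ◁ c ≫ ev = N ◁ c' ≫ ev → c = c') := by
    refine ⟨(ihom N).obj D, (ihom.ev N).app D,
      fun k => ⟨curry k, by rw [← uncurry_eq, uncurry_curry]⟩, fun c c' h => ?_⟩
    rw [← uncurry_eq, ← uncurry_eq] at h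
    exact uncurry_injective h
  -- `P` is a copy of `D ⊗ Q`, kept opaque so that simplification does not take it apart.
  obtain ⟨P, p, q, hPl, hP⟩ : ∃ (P : E) (p : P ⟶ D) (q : P ⟶ Q),
      P = D ⊗ Q ∧ HEq p (fst D Q) ∧ HEq q (snd D Q) := ⟨_, _, _, rfl, HEq.rfl, HEq.rfl⟩
  let x : 𝟙_ E ⟶ N ⊗ (ihom P).obj D := lift z (curry (fst P (𝟙_ E) ≫ p))
  let φ : N ⟶ (ihom P).obj D := curry (lift (snd P N) (fst P N ≫ q) ≫ ev)
  -- The stream `cons d q` is defined by cases on its index. The recursion carries the index along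
  -- and forgets the previous value, so the value at `s n` is `φ n`, the `n`-th entry of `q`.
  obtain ⟨h, ⟨h0, h1⟩, -⟩ := hN x (fst _ _ ≫ lift s φ)
  have hfst : h ≫ fst _ _ = 𝟙 N := by
    refine (hN z s).unique ⟨?_, ?_⟩ ⟨Category.comp_id _, by simp⟩
    · rw [← Category.assoc, h0, lift_fst]
    · rw [← Category.assoc, h1]
      simp
  let k : P ⊗ N ⟶ D := uncurry (h ≫ snd _ _)
  have kz : P ◁ z ≫ k = fst P (𝟙_ E) ≫ p := by
    rw [← uncurry_natural_left, ← Category.assoc, h0, lift_snd, uncurry_curry]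
  have ks : P ◁ s ≫ k = lift (snd P N) (fst P N ≫ q) ≫ ev := by
    rw [← uncurry_natural_left, ← Category.assoc, h1, Category.assoc, Category.assoc, lift_snd,
      ← Category.assoc, hfst, Category.id_comp, uncurry_curry]
  obtain ⟨cons, hcons⟩ := hev (lift (snd N P) (fst N P) ≫ k)
  obtain ⟨tl, htl⟩ := hev (s ▷ Q ≫ ev)
  have h_hd : cons ≫ lift (toUnit Q ≫ z) (𝟙 Q) ≫ ev = p := by
    have e : cons ≫ lift (toUnit Q ≫ z) (𝟙 Q) = lift (toUnit P ≫ z) (𝟙 P) ≫ N ◁ cons := by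
      ext <;> simp
    rw [← Category.assoc, e, Category.assoc, hcons]
    have e' : lift (toUnit P ≫ z) (𝟙 P) ≫ lift (snd N P) (fst N P) =
        lift (𝟙 P) (toUnit P) ≫ P ◁ z := by ext <;> simp
    rw [← Category.assoc, e', Category.assoc, kz, lift_fst_assoc, Category.id_comp]
  have h_tl : cons ≫ tl = q := by
    apply hev'
    have e : N ◁ cons ≫ s ▷ Q = s ▷ P ≫ N ◁ cons := by ext <;> simp
    rw [whiskerLeft_comp, Category.assoc, htl, ← Category.assoc, e, Category.assoc, hcons]
    have e' : s ▷ P ≫ lift (snd N P) (fst N P) = lift (snd N P) (fst N P) ≫ P ◁ s := by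
      ext <;> simp
    rw [← Category.assoc, e', Category.assoc, ks, ← Category.assoc]
    congr 1
    ext <;> simp
  obtain ⟨hp, hq⟩ := hP
  subst hPl
  obtain rfl := eq_of_heq hp
  obtain rfl := eq_of_heq hq
  exact ⟨Q, cons, _, tl, h_hd, h_tl, fun {Δ} d => ⟨(hev (snd N Δ ≫ d)).choose⟩⟩

variable [HasFiniteLimits E]

omit [CartesianMonoidalCategory E] in
theorem lift_comp_pullback_lift {Θ Δ Γ T V : E} {h : Γ ⟶ V} {β : T ⟶ V} (s : Θ ⟶ Δ) (a : Δ ⟶ Γ)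
    (t : Δ ⟶ T) (w : a ≫ h = t ≫ β) (a' : Θ ⟶ Γ) (t' : Θ ⟶ T) (ha : s ≫ a = a') (ht : s ≫ t = t') :
    s ≫ pullback.lift a t w = pullback.lift a' t' (by simp [← ha, ← ht, w]) := by
  subst ha ht
  apply pullback.hom_ext <;> simp

/-- An element `h` of `V` and a family of elements of `X` indexed by the fibre of `β` over `h`, at
stage `Δ`. -/
structure Fam {T V : E} (β : T ⟶ V) (X Δ : E) where
  h : Δ ⟶ V
  f : pullback h β ⟶ X

namespace Fam

variable {T V : E} {β : T ⟶ V} {X Y Z Δ Δ' Δ'' : E}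

omit [CartesianMonoidalCategory E] in
theorem ext_of {φ φ' : Fam β X Δ} (hh : φ.h = φ'.h)
    (hf : ∀ ⦃Θ : E⦄ (s : Θ ⟶ pullback φ.h β) (s' : Θ ⟶ pullback φ'.h β),
      s ≫ pullback.fst _ _ = s' ≫ pullback.fst _ _ →
      s ≫ pullback.snd _ _ = s' ≫ pullback.snd _ _ → s ≫ φ.f = s' ≫ φ'.f) : φ = φ' := by
  obtain ⟨h, f⟩ := φ
  obtain ⟨h', f'⟩ := φ'
  dsimp only at hh hf
  subst hh
  have := hf (𝟙 _) (𝟙 _) rfl rfl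
  rw [Category.id_comp, Category.id_comp] at this
  rw [this]

/-- The value of a family. -/
noncomputable def app (φ : Fam β X Δ) {Θ : E} (θ : Θ ⟶ Δ) (t : Θ ⟶ T) (w : θ ≫ φ.h = t ≫ β) :
    Θ ⟶ X :=
  pullback.lift θ t w ≫ φ.f

omit [CartesianMonoidalCategory E] in
theorem ext_app {φ φ' : Fam β X Δ} (hh : φ.h = φ'.h)
    (hf : ∀ ⦃Θ : E⦄ (θ : Θ ⟶ Δ) (t : Θ ⟶ T) (w : θ ≫ φ.h = t ≫ β) (w' : θ ≫ φ'.h = t ≫ β),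
      φ.app θ t w = φ'.app θ t w') : φ = φ' := by
  refine ext_of hh fun Θ s s' h1 h2 => ?_
  have w : (s ≫ pullback.fst _ _) ≫ φ.h = (s ≫ pullback.snd _ _) ≫ β := by
    simp [pullback.condition]
  have := hf (s ≫ pullback.fst _ _) (s ≫ pullback.snd _ _) w (hh ▸ w)
  rw [app, app] at this
  convert this using 2
  · apply pullback.hom_ext <;> simp
  · apply pullback.hom_ext <;> simp [h1, h2]

/-- Restriction of a family along a change of stage. -/
noncomputable def res (φ : Fam β X Δ) (τ : Δ' ⟶ Δ) : Fam β X Δ' where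
  h := τ ≫ φ.h
  f := φ.app (pullback.fst _ _ ≫ τ) (pullback.snd _ _) (by simp [pullback.condition])

/-- The image of a family under a morphism. -/
noncomputable def map (φ : Fam β X Δ) (k : X ⟶ Y) : Fam β Y Δ where
  h := φ.h
  f := φ.f ≫ k

omit [CartesianMonoidalCategory E] in
theorem comp_app (φ : Fam β X Δ) {Θ Θ' : E} (s : Θ' ⟶ Θ) (θ : Θ ⟶ Δ) (t : Θ ⟶ T)
    (w : θ ≫ φ.h = t ≫ β) (θ' : Θ' ⟶ Δ) (t' : Θ' ⟶ T) (h1 : s ≫ θ = θ') (h2 : s ≫ t = t') :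
    s ≫ φ.app θ t w = φ.app θ' t' (by simp [← h1, ← h2, w]) := by
  rw [app, app, ← Category.assoc, lift_comp_pullback_lift s θ t w θ' t' h1 h2]

omit [CartesianMonoidalCategory E] in
theorem app_res (φ : Fam β X Δ) (τ : Δ' ⟶ Δ) {Θ : E} (θ : Θ ⟶ Δ') (t : Θ ⟶ T) (w) :
    (φ.res τ).app θ t w = φ.app (θ ≫ τ) t (by rw [← w]; simp [res]) := by
  rw [app]
  exact φ.comp_app _ _ _ _ _ _
    ((Category.assoc _ _ _).symm.trans (congrArg (· ≫ τ) (pullback.lift_fst _ _ _)))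
    (pullback.lift_snd _ _ _)

omit [CartesianMonoidalCategory E] in
theorem app_map (φ : Fam β X Δ) (k : X ⟶ Y) {Θ : E} (θ : Θ ⟶ Δ) (t : Θ ⟶ T) (w) :
    (φ.map k).app θ t w = φ.app θ t w ≫ k := (Category.assoc _ _ _).symm

omit [CartesianMonoidalCategory E] in
theorem app_congr (φ : Fam β X Δ) {Θ : E} {θ θ' : Θ ⟶ Δ} {t t' : Θ ⟶ T} (hθ : θ = θ')
    (ht : t = t') (w w') : φ.app θ t w = φ.app θ' t' w' := by
  subst hθ ht
  rfl

omit [CartesianMonoidalCategory E] in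
theorem res_id (φ : Fam β X Δ) : φ.res (𝟙 Δ) = φ :=
  ext_app (Category.id_comp _) fun Θ θ t w w' => by
    rw [app_res]
    exact φ.app_congr (Category.comp_id _) rfl _ _

omit [CartesianMonoidalCategory E] in
theorem res_res (φ : Fam β X Δ) (τ : Δ' ⟶ Δ) (τ' : Δ'' ⟶ Δ') :
    (φ.res τ).res τ' = φ.res (τ' ≫ τ) :=
  ext_app (Category.assoc _ _ _).symm fun Θ θ t w w' => by
    rw [app_res, app_res, app_res]
    exact φ.app_congr (Category.assoc _ _ _) rfl _ _

omit [CartesianMonoidalCategory E] in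
theorem map_res (φ : Fam β X Δ) (k : X ⟶ Y) (τ : Δ' ⟶ Δ) :
    (φ.map k).res τ = (φ.res τ).map k :=
  ext_app rfl fun Θ θ t w w' => by
    rw [app_res, app_map, app_map]
    exact congrArg (· ≫ k) (app_res ..).symm

omit [CartesianMonoidalCategory E] in
theorem map_map (φ : Fam β X Δ) (k : X ⟶ Y) (l : Y ⟶ Z) : (φ.map k).map l = φ.map (k ≫ l) := by
  simp [map]

end Fam

/-- An object `X` with an operation `sup` taking a label in `L` and a family of elements of `X`
indexed by a fibre of `β`; the operation is stable and injective. -/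
structure SupObject (L : E) {T V : E} (β : T ⟶ V) where
  X : E
  sup {Δ : E} (a : Δ ⟶ L) (φ : Fam β X Δ) : Δ ⟶ X
  comp_sup {Δ Δ' : E} (τ : Δ' ⟶ Δ) (a : Δ ⟶ L) (φ : Fam β X Δ) :
    τ ≫ sup a φ = sup (τ ≫ a) (φ.res τ)
  sup_injective {Δ : E} {a a' : Δ ⟶ L} {φ φ' : Fam β X Δ} (e : sup a φ = sup a' φ') :
    a = a' ∧ φ = φ'

variable [MonoidalClosed E] [HasSubobjectClassifier E]

/-- A tree is coded by a set of streams whose heads consist of a subset of `L ⊗ V` and a subset of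
`T`. A stream belongs to `sup (a, h, f)` if the first subset is `{(a, h)}` and, whenever the second
is `{t}` for `t` in the fibre over `h`, the tail belongs to `f t`. Streams with an empty second
subset reveal `(a, h)`, those with second subset `{t}` reveal `f t`; hence injectivity. An
implication rather than an existential quantifier keeps the condition representable by the
connectives at hand. -/
theorem exists_supObject (hN : HasNNO E) (L : E) {T V : E} (β : T ⟶ V) :
    Nonempty (SupObject L β) := by
  obtain ⟨Q, cons, hd, tl, cons_hd, cons_tl, hQ⟩ := exists_stream hN (Pow (L ⊗ V) ⊗ Pow T)
  let hL : Q ⟶ Pow (L ⊗ V) := hd ≫ fst _ _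
  let hT : Q ⟶ Pow T := hd ≫ snd _ _
  have push : ∀ {Θ : E} (l : Θ ⟶ Pow (L ⊗ V)) (t : Θ ⟶ Pow T) (q : Θ ⟶ Q), ∃ r : Θ ⟶ Q,
      r ≫ hL = l ∧ r ≫ hT = t ∧ r ≫ tl = q := by
    intro Θ l t q
    refine ⟨lift (lift l t) q ≫ cons, ?_, ?_, ?_⟩ <;> simp only [hL, hT, Category.assoc] <;>
      simp [reassoc_of% cons_hd, cons_tl]
  obtain ⟨emp, hemp⟩ := exists_name (K := T) (Γ := 𝟙_ E)
    (Φ := fun Δ _ _ => ∀ (Θ : E) (_ : Θ ⟶ Δ) (k : Θ ⟶ Om E), k = tru Θ)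
    (isRep_false E)
  have hsup : ∀ {Δ : E} (a : Δ ⟶ L) (h : Δ ⟶ V) (f : pullback h β ⟶ Pow Q),
      ∃ x : Δ ⟶ Pow Q, ∀ (Θ : E) (σ : Θ ⟶ Δ) (q : Θ ⟶ Q), Mem q (σ ≫ x) ↔
        q ≫ hL = (σ ≫ lift a h) ≫ sing _ ∧
        ∀ (Θ' : E) (θ : Θ' ⟶ Θ) (s : Θ' ⟶ pullback h β),
          (s ≫ pullback.fst _ _ = θ ≫ σ ∧ (θ ≫ q) ≫ hT = (s ≫ pullback.snd _ _) ≫ sing _) →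
            Mem ((θ ≫ q) ≫ tl) (s ≫ f) := by
    intro Δ a h f
    refine exists_name (K := Q) (Γ := Δ) ?_
    refine IsRep.and ?_ ?_
    · refine (isRep_eq (snd Δ Q ≫ hL) (fst Δ Q ≫ lift a h ≫ sing _)).congr fun Θ σ => ?_
      simp only [Category.assoc]
    · refine (isRep_all_imp (K := pullback h β) (Γ := Δ ⊗ Q)
        (Φ := fun Θ (σ : Θ ⟶ Δ ⊗ Q) s => s ≫ pullback.fst _ _ = σ ≫ fst _ _ ∧
          (σ ≫ snd _ _) ≫ hT = (s ≫ pullback.snd _ _) ≫ sing _)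
        (Ψ := fun Θ σ s => Mem ((σ ≫ snd _ _) ≫ tl) (s ≫ f)) ?_ ?_).congr fun Θ σ => ?_
      · refine IsRep.and ?_ ?_
        · refine (isRep_eq (snd (Δ ⊗ Q) (pullback h β) ≫ pullback.fst _ _)
            (fst _ _ ≫ fst _ _)).congr fun Θ σ => ?_
          simp only [Category.assoc]
        · refine (isRep_eq (fst (Δ ⊗ Q) (pullback h β) ≫ snd _ _ ≫ hT)
            (snd _ _ ≫ pullback.snd _ _ ≫ sing _)).congr fun Θ σ => ?_
          simp only [Category.assoc]
      · refine (isRep_mem (fst (Δ ⊗ Q) (pullback h β) ≫ snd _ _ ≫ tl) (snd _ _ ≫ f)).congr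
          fun Θ σ => ?_
        simp only [Category.assoc]
      · simp only [Category.assoc]
  choose sup hsup using @hsup
  refine ⟨⟨Pow Q, fun a φ => sup a φ.h φ.f, ?_, ?_⟩⟩
  · intro Δ Δ' τ a φ
    have hf : ∀ ⦃Θ : E⦄ (s' : Θ ⟶ pullback (φ.res τ).h β) (s : Θ ⟶ pullback φ.h β),
        s ≫ pullback.fst _ _ = (s' ≫ pullback.fst _ _) ≫ τ →
        s ≫ pullback.snd _ _ = s' ≫ pullback.snd _ _ → s' ≫ (φ.res τ).f = s ≫ φ.f := by
      intro Θ s' s h1 h2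
      have := φ.comp_app s' (pullback.fst (φ.res τ).h β ≫ τ) (pullback.snd _ _)
        ((Category.assoc _ _ _).trans pullback.condition) _ _ rfl rfl
      refine this.trans ?_
      rw [Fam.app]
      congr 1
      apply pullback.hom_ext <;> simp [h1, h2]
    generalize ha : τ ≫ a = a'
    have hh : (φ.res τ).h = τ ≫ φ.h := rfl
    generalize φ.res τ = φ' at *
    obtain ⟨h, f⟩ := φ
    obtain ⟨h', f'⟩ := φ'
    dsimp only at *
    replace ha := ha.symm
    refine pow_ext fun Θ σ q => ?_
    rw [← Category.assoc, hsup, hsup]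
    refine and_congr ?_ ?_
    · rw [ha, hh, ← comp_lift]
      simp only [Category.assoc]
    · constructor
      · intro H Θ' θ s ⟨hs1, hs2⟩
        have w : ((θ ≫ σ) ≫ τ) ≫ h = (s ≫ pullback.snd _ _) ≫ β := by
          rw [Category.assoc, ← hh, ← hs1, Category.assoc, Category.assoc, pullback.condition]
        have := H Θ' θ (pullback.lift _ _ w) ⟨by simp, by simp [hs2]⟩
        rwa [hf s (pullback.lift _ _ w) (by simp [← hs1]) (by simp)]
      · intro H Θ' θ s ⟨hs1, hs2⟩
        have w : (θ ≫ σ) ≫ h' = (s ≫ pullback.snd _ _) ≫ β := by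
          rw [hh, ← Category.assoc, Category.assoc θ, ← hs1, Category.assoc, Category.assoc,
            pullback.condition]
        have := H Θ' θ (pullback.lift _ _ w) ⟨by simp, by simp [hs2]⟩
        rwa [hf (pullback.lift _ _ w) s (by simp [hs1]) (by simp)] at this
  · rintro Δ a a' ⟨h, f⟩ ⟨h', f'⟩ e
    dsimp only at e
    have e' : ∀ {Θ : E} (σ : Θ ⟶ Δ) (q : Θ ⟶ Q), Mem q (σ ≫ sup a h f) ↔
        Mem q (σ ≫ sup a' h' f') := fun σ q => by rw [e]
    have hl : lift a h = lift a' h' := by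
      obtain ⟨q₀⟩ := hQ (lift (lift a h ≫ sing _) (toUnit Δ ≫ emp))
      -- With the empty subset of `T` in its head, `r` satisfies the condition on tails vacuously,
      -- so it belongs to `sup a h f` whatever `f` is.
      obtain ⟨r, h1, h2, -⟩ := push (lift a h ≫ sing _) (toUnit Δ ≫ emp) q₀
      have := ((hsup a' h' f' Δ (𝟙 Δ) r).1 ((e' (𝟙 Δ) r).1 ((hsup a h f Δ (𝟙 Δ) r).2
        ⟨by simp [h1], fun Θ θ s ⟨_, hs⟩ => ?_⟩))).1
      · rw [h1, Category.id_comp] at this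
        exact sing_injective this
      · rw [Category.assoc, h2, ← Category.assoc] at hs
        -- The empty subset equals a singleton here, so falsity is forced.
        have hk := (hemp _ _ (s ≫ pullback.snd h β)).1
          (by rw [hs]; exact (mem_sing _ _).2 rfl)
        have := (isRep_mem ((θ ≫ r) ≫ tl) (s ≫ f)).of_false (𝟙 Θ)
          fun k => hk Θ (𝟙 Θ) k
        simpa using this
    have ha : a = a' := by simpa using congrArg (· ≫ fst _ _) hl
    have hh : h = h' := by simpa using congrArg (· ≫ snd _ _) hl
    refine ⟨ha, Fam.ext_of hh ?_⟩
    subst ha hh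
    intro Θ s s' h1 h2
    obtain rfl : s = s' := pullback.hom_ext h1 h2
    have key : ∀ (f : pullback h β ⟶ Pow Q) (Θ' : E) (θ : Θ' ⟶ Θ) (q r : Θ' ⟶ Q),
        r ≫ hL = (θ ≫ s ≫ pullback.fst _ _) ≫ lift a h ≫ sing _ →
        r ≫ hT = (θ ≫ s ≫ pullback.snd _ _) ≫ sing _ → r ≫ tl = q →
        (Mem r ((θ ≫ s ≫ pullback.fst _ _) ≫ sup a h f) ↔ Mem q (θ ≫ s ≫ f)) := by
      intro f Θ' θ q r r1 r2 r3
      rw [hsup]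
      constructor
      · intro ⟨_, H⟩
        have := H Θ' (𝟙 _) (θ ≫ s) ⟨by simp, by simpa using r2⟩
        simpa [r3] using this
      · intro H
        refine ⟨r1.trans (Category.assoc _ _ _).symm, fun Θ'' θ' s' ⟨e1, e2⟩ => ?_⟩
        have e3 : s' = θ' ≫ θ ≫ s := by
          apply pullback.hom_ext
          · simpa using e1
          · apply sing_injective
            rw [← e2, Category.assoc, r2]
            simp
        subst e3
        simpa [r3] using H.res θ'
    refine pow_ext fun Θ' θ q => ?_
    -- Prefixing `q` with the singletons of `(a, h)` and of the chosen fibre element turns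
    -- membership in a branch into membership in the tree.
    obtain ⟨r, r1, r2, r3⟩ := push ((θ ≫ s ≫ pullback.fst _ _) ≫ lift a h ≫ sing _)
      ((θ ≫ s ≫ pullback.snd _ _) ≫ sing _) q
    rw [← key f Θ' θ q r r1 r2 r3, ← key f' Θ' θ q r r1 r2 r3, e]

/-- A family is replaced by its graph: `P` consists of `v : V` and a subset of `T ⊗ X` that is
single-valued and total over the fibre of `v`. This makes families range over an object, so that
they can be quantified over. -/
theorem exists_generic_fam {T V : E} (β : T ⟶ V) (X : E) :
    ∃ (P : E) (p : Fam β X P), ∀ {Δ : E} (φ : Fam β X Δ), ∃ t : Δ ⟶ P, p.res t = φ := by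
  obtain ⟨P, m, hm, hP⟩ : IsRep (Γ := V ⊗ Pow (T ⊗ X)) (fun Δ σ =>
      ∀ (Θ : E) (θ : Θ ⟶ Δ) (t : Θ ⟶ T), t ≫ β = (θ ≫ σ) ≫ fst _ _ →
        ∃ x : Θ ⟶ X, ∀ (Θ' : E) (θ' : Θ' ⟶ Θ) (x' : Θ' ⟶ X),
          Mem (lift (θ' ≫ t) x') (θ' ≫ (θ ≫ σ) ≫ snd _ _) ↔ x' = θ' ≫ x) := by
    refine isRep_all_imp (Φ := fun Δ (σ : Δ ⟶ V ⊗ Pow (T ⊗ X)) (t : Δ ⟶ T) => t ≫ β = σ ≫ fst _ _)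
      (Ψ := fun Δ σ t => ∃ x : Δ ⟶ X, ∀ (Θ' : E) (θ' : Θ' ⟶ Δ) (x' : Θ' ⟶ X),
          Mem (lift (θ' ≫ t) x') (θ' ≫ σ ≫ snd _ _) ↔ x' = θ' ≫ x) ?_ ?_
    · refine (isRep_eq (snd (V ⊗ Pow (T ⊗ X)) T ≫ β) (fst _ _ ≫ fst _ _)).congr fun Θ σ => ?_
      simp only [Category.assoc]
    · refine (isRep_existsUnique (K := X) (Γ := (V ⊗ Pow (T ⊗ X)) ⊗ T)
        (Φ := fun Δ σ x => Mem (lift (σ ≫ snd _ _) x) (σ ≫ fst _ _ ≫ snd _ _)) ?_).congr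
        fun Θ σ => ?_
      · refine (isRep_mem (lift (fst ((V ⊗ Pow (T ⊗ X)) ⊗ T) X ≫ snd _ _) (snd _ _))
          (fst _ _ ≫ fst _ _ ≫ snd _ _)).congr fun Θ σ => ?_
        simp only [comp_lift, Category.assoc]
      · simp only [Category.assoc]
  have hgen := (hP P m).2 ⟨𝟙 _, Category.id_comp _⟩
  obtain ⟨x₀, hx₀⟩ := hgen _ (pullback.fst (m ≫ fst _ _) β) (pullback.snd _ _)
    (by rw [Category.assoc, pullback.condition])
  refine ⟨P, ⟨m ≫ fst _ _, x₀⟩, fun {Δ} φ => ?_⟩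
  obtain ⟨s, hs⟩ := exists_name (K := T ⊗ X) (Γ := Δ) (Φ := fun Δ' σ k =>
      ∀ (Θ : E) (θ : Θ ⟶ Δ') (r : Θ ⟶ pullback φ.h β), (r ≫ pullback.fst _ _ = θ ≫ σ ∧
        r ≫ pullback.snd _ _ = (θ ≫ k) ≫ fst _ _) → r ≫ φ.f = (θ ≫ k) ≫ snd _ _) (by
    refine (isRep_all_imp (K := pullback φ.h β) (Γ := Δ ⊗ (T ⊗ X))
      (Φ := fun Θ (σ : Θ ⟶ Δ ⊗ (T ⊗ X)) r => r ≫ pullback.fst _ _ = σ ≫ fst _ _ ∧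
        r ≫ pullback.snd _ _ = (σ ≫ snd _ _) ≫ fst _ _)
      (Ψ := fun Θ (σ : Θ ⟶ Δ ⊗ (T ⊗ X)) r => r ≫ φ.f = (σ ≫ snd _ _) ≫ snd _ _) ?_ ?_).congr
      fun Θ σ => ?_
    · refine IsRep.and ?_ ?_
      · refine (isRep_eq (snd (Δ ⊗ (T ⊗ X)) (pullback φ.h β) ≫ pullback.fst _ _)
          (fst _ _ ≫ fst _ _)).congr fun Θ σ => ?_
        simp only [Category.assoc]
      · refine (isRep_eq (snd (Δ ⊗ (T ⊗ X)) (pullback φ.h β) ≫ pullback.snd _ _)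
          (fst _ _ ≫ snd _ _ ≫ fst _ _)).congr fun Θ σ => ?_
        simp only [Category.assoc]
    · refine (isRep_eq (snd (Δ ⊗ (T ⊗ X)) (pullback φ.h β) ≫ φ.f)
        (fst _ _ ≫ snd _ _ ≫ snd _ _)).congr fun Θ σ => ?_
      simp only [Category.assoc]
    · simp only [Category.assoc])
  have hs' : ∀ {Θ : E} (θ : Θ ⟶ Δ) (t : Θ ⟶ T) (w : θ ≫ φ.h = t ≫ β) (x : Θ ⟶ X),
      Mem (lift t x) (θ ≫ s) ↔ x = φ.app θ t w := by
    intro Θ θ t w x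
    rw [hs]
    constructor
    · intro H
      have := H Θ (𝟙 _) (pullback.lift θ t w) ⟨by simp, by simp⟩
      simpa [Fam.app] using this.symm
    · rintro rfl Θ' θ' r ⟨h1, h2⟩
      simp only [comp_lift, lift_fst, lift_snd] at h2 ⊢
      rw [φ.comp_app θ' θ t w _ _ rfl rfl, Fam.app]
      congr 1
      apply pullback.hom_ext <;> simp [h1, h2]
  obtain ⟨t, ht⟩ := (hP Δ (lift φ.h s)).1 (by
    intro Θ θ t ht
    rw [Category.assoc, lift_fst] at ht
    refine ⟨φ.app θ t ht.symm, fun Θ' θ' x' => ?_⟩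
    have := hs' (θ' ≫ θ) (θ' ≫ t) (by rw [Category.assoc, ← ht, Category.assoc]) x'
    simp only [comp_lift, lift_snd, Category.assoc] at this ⊢
    rw [this, φ.comp_app θ' θ t ht.symm _ _ rfl rfl])
  have ht1 : t ≫ m ≫ fst _ _ = φ.h := by rw [← Category.assoc, ht, lift_fst]
  have ht2 : t ≫ m ≫ snd _ _ = s := by rw [← Category.assoc, ht, lift_snd]
  refine ⟨t, Fam.ext_app ht1 fun Θ θ t' w w' => ?_⟩
  rw [Fam.app_res, ← hs', ← ht2]
  have := (hx₀ Θ (pullback.lift (θ ≫ t) t' (by rw [Category.assoc, ht1, w'])) _).2 rfl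
  simpa [Fam.app] using this

/-- Bounded universal quantification over a label and a family of elements of `X` indexed by a
fibre of `β`. The conclusion has to be representable only where the bound holds. -/
theorem isRep_all_fam_imp {L T V : E} {β : T ⟶ V} {X Γ : E}
    {Φ Ψ : ∀ Δ : E, (Δ ⟶ Γ) → (Δ ⟶ L) → Fam β X Δ → Prop}
    (hΦ : ∀ {Γ' : E} (σ : Γ' ⟶ Γ) (a : Γ' ⟶ L) (φ : Fam β X Γ'),
      IsRep (fun Δ τ => Φ Δ (τ ≫ σ) (τ ≫ a) (φ.res τ)))
    (hΨ : ∀ {Γ' : E} (σ : Γ' ⟶ Γ) (a : Γ' ⟶ L) (φ : Fam β X Γ'), Φ Γ' σ a φ →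
      IsRep (fun Δ τ => Ψ Δ (τ ≫ σ) (τ ≫ a) (φ.res τ))) :
    IsRep (fun Δ (σ : Δ ⟶ Γ) => ∀ (Θ : E) (θ : Θ ⟶ Δ) (a : Θ ⟶ L) (φ : Fam β X Θ),
      Φ Θ (θ ≫ σ) a φ → Ψ Θ (θ ≫ σ) a φ) := by
  obtain ⟨P, p, hp⟩ := exists_generic_fam β X
  have e : ∀ {Δ Δ' : E} (τ : Δ' ⟶ Δ) (σ : Δ ⟶ Γ ⊗ (L ⊗ P)),
      p.res ((τ ≫ σ) ≫ snd _ _ ≫ snd _ _) = (p.res (σ ≫ snd _ _ ≫ snd _ _)).res τ :=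
    fun τ σ => by rw [Fam.res_res, Category.assoc]
  have h1 := (IsRep.dimp (hΦ (fst Γ (L ⊗ P)) (snd Γ (L ⊗ P) ≫ fst _ _)
    (p.res (snd Γ (L ⊗ P) ≫ snd _ _)))
    (ψ := fun Δ σ => Ψ Δ (σ ≫ fst _ _) (σ ≫ snd _ _ ≫ fst _ _)
      ((p.res (snd _ _ ≫ snd _ _)).res σ)) (fun {S} m hm => by
        refine (hΨ _ _ _ hm).congr fun Δ τ => ?_
        rw [Fam.res_res, Category.assoc, Category.assoc]))
  refine (isRep_all (K := L ⊗ P) (Φ := fun Δ σ k => ∀ (Θ : E) (θ : Θ ⟶ Δ),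
      Φ Θ (θ ≫ σ) (θ ≫ k ≫ fst _ _) ((p.res (k ≫ snd _ _)).res θ) →
      Ψ Θ (θ ≫ σ) (θ ≫ k ≫ fst _ _) ((p.res (k ≫ snd _ _)).res θ)) ?_).congr fun Δ σ =>
    ⟨fun H Θ θ a φ hφ => ?_, fun H Θ θ k Θ' θ' => ?_⟩
  · refine h1.congr fun Δ σ => ?_
    simp only [Category.assoc, Fam.res_res]
  · obtain ⟨t, rfl⟩ := hp φ
    have := H Θ θ (lift a t) Θ (𝟙 _)
    simp only [Category.id_comp, lift_fst, lift_snd, Fam.res_id] at this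
    exact this hφ
  · rw [← Category.assoc]
    exact H _ _ _ _

/-- A representable predicate, required of all members of a family. -/
theorem isRep_all_mem_fam {T V : E} {β : T ⟶ V} {X Γ Γ' : E} {χ : Pred (X ⊗ Γ)} (hχ : IsRep χ)
    (φ : Fam β X Γ') (g : Γ' ⟶ Γ) :
    IsRep (fun Δ (τ : Δ ⟶ Γ') => χ _ (lift (φ.res τ).f (pullback.fst _ _ ≫ τ ≫ g))) := by
  refine (isRep_all_imp (K := pullback φ.h β) (Γ := Γ')
    (Φ := fun _ τ k => k ≫ pullback.fst _ _ = τ)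
    (Ψ := fun _ τ k => χ _ (lift (k ≫ φ.f) (τ ≫ g))) ?_ ?_).congr fun Δ τ =>
      ⟨fun H => ?_, fun H Θ θ k hk => ?_⟩
  · exact (isRep_eq (snd Γ' (pullback φ.h β) ≫ pullback.fst _ _) (fst _ _)).congr fun Θ σ => by
      rw [Category.assoc]
  · exact (hχ.comp (lift (snd Γ' (pullback φ.h β) ≫ φ.f) (fst _ _ ≫ g))).congr fun Θ σ => by
      rw [comp_lift, Category.assoc, Category.assoc]
  · have := H _ (pullback.fst (φ.res τ).h β) (pullback.lift (pullback.fst _ _ ≫ τ)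
      (pullback.snd _ _) ((Category.assoc _ _ _).trans pullback.condition)) (by simp)
    exact Eq.mp (congrArg (fun z => χ _ (lift _ z)) (Category.assoc _ _ _)) this
  · have w : θ ≫ (φ.res τ).h = (k ≫ pullback.snd _ _) ≫ β := by
      simp only [Fam.res, Category.assoc, ← pullback.condition]
      rw [← Category.assoc, ← Category.assoc k, hk]
    have := hχ.res H (pullback.lift θ (k ≫ pullback.snd _ _) w)
    have e1 : pullback.lift θ (k ≫ pullback.snd _ _) w ≫ (φ.res τ).f = k ≫ φ.f := by
      refine (φ.comp_app _ _ _ _ (θ ≫ τ) (k ≫ pullback.snd _ _) ?_ ?_).trans ?_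
      · exact (Category.assoc _ _ _).symm.trans (congrArg (· ≫ τ) (pullback.lift_fst _ _ _))
      · exact pullback.lift_snd _ _ _
      · rw [Fam.app]
        congr 1
        apply pullback.hom_ext <;> simp [hk]
    have e2 : pullback.lift θ (k ≫ pullback.snd _ _) w ≫ pullback.fst (φ.res τ).h β ≫ τ ≫ g =
        (θ ≫ τ) ≫ g := by
      rw [← Category.assoc, ← Category.assoc]
      exact congrArg (· ≫ g) (congrArg (· ≫ τ) (pullback.lift_fst _ _ _))
    rwa [comp_lift, e1, e2] at this

end KripkeJoyal

/-! ### The smallest subset closed under `sup`. -/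

namespace KripkeJoyal

attribute [local simp] pullback.lift_fst pullback.lift_snd pullback.lift_fst_assoc
  pullback.lift_snd_assoc

variable {E : Type u} [Category.{v} E] [CartesianMonoidalCategory E] [HasFiniteLimits E]
  [MonoidalClosed E] [HasSubobjectClassifier E]

/-- The restriction of a statement about the members of a family. -/
theorem mem_fam_res {T V : E} {β : T ⟶ V} {X Γ Γ' : E} {χ : Pred (X ⊗ Γ)} (hχ : IsRep χ)
    (φ : Fam β X Γ') (g : Γ' ⟶ Γ) (h : χ _ (lift φ.f (pullback.fst _ _ ≫ g))) {Δ : E}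
    (τ : Δ ⟶ Γ') : χ _ (lift (φ.res τ).f (pullback.fst _ _ ≫ τ ≫ g)) := by
  have h' : χ _ (lift (φ.res (𝟙 Γ')).f (pullback.fst _ _ ≫ 𝟙 Γ' ≫ g)) := by
    have : ∀ φ', φ' = φ → χ _ (lift φ'.f (pullback.fst φ'.h β ≫ 𝟙 Γ' ≫ g)) := by
      rintro _ rfl
      rwa [Category.id_comp]
    exact this _ φ.res_id
  have := (isRep_all_mem_fam hχ φ g).res h' τ
  rwa [Category.comp_id] at this

section Closed

variable {L T V : E} {β : T ⟶ V} (U : SupObject L β)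

/-- The subset `r` is closed under `sup` applied to a label and an arity in `R` and a family of
elements of `r`. -/
def Closed {Δ : E} (R : Δ ⟶ Pow (L ⊗ V)) (r : Δ ⟶ Pow U.X) : Prop :=
  ∀ (Θ : E) (θ : Θ ⟶ Δ) (a : Θ ⟶ L) (φ : Fam β U.X Θ),
    Mem (lift a φ.h) (θ ≫ R) ∧ Mem φ.f (pullback.fst _ _ ≫ θ ≫ r) → Mem (U.sup a φ) (θ ≫ r)

theorem isRep_mem_all {X Γ : E} {T V : E} {β : T ⟶ V} (φ : Fam β X Γ) (r : Γ ⟶ Pow X) :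
    IsRep (fun Δ (τ : Δ ⟶ Γ) => Mem (φ.res τ).f (pullback.fst _ _ ≫ τ ≫ r)) :=
  (isRep_all_mem_fam (χ := fun _ k => Mem (k ≫ fst _ _) (k ≫ snd _ _)) (isRep_mem _ _) φ r).congr
    fun Δ τ => by rw [lift_fst, lift_snd]

theorem isRep_closed {Γ : E} (R : Γ ⟶ Pow (L ⊗ V)) (r : Γ ⟶ Pow U.X) :
    IsRep (fun Δ (σ : Δ ⟶ Γ) => Closed U (σ ≫ R) (σ ≫ r)) := by
  refine (isRep_all_fam_imp (L := L) (β := β) (X := U.X)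
    (Φ := fun Δ σ a φ => Mem (lift a φ.h) (σ ≫ R) ∧ Mem φ.f (pullback.fst _ _ ≫ σ ≫ r))
    (Ψ := fun Δ σ a φ => Mem (U.sup a φ) (σ ≫ r)) (fun σ a φ => IsRep.and ?_ ?_)
    (fun σ a φ _ => ?_)).congr fun Δ σ => ?_
  · refine (isRep_mem (lift a φ.h) (σ ≫ R)).congr fun Δ τ => ?_
    rw [comp_lift, Category.assoc]
    rfl
  · refine (isRep_mem_all φ (σ ≫ r)).congr fun Δ τ => ?_
    rw [Category.assoc]
  · refine (isRep_mem (U.sup a φ) (σ ≫ r)).congr fun Δ τ => ?_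
    rw [U.comp_sup, Category.assoc]
  · simp only [Closed, Category.assoc]

/-- `x` belongs to all closed subsets. -/
def InW {Δ : E} (R : Δ ⟶ Pow (L ⊗ V)) (x : Δ ⟶ U.X) : Prop :=
  ∀ (Θ : E) (θ : Θ ⟶ Δ) (r : Θ ⟶ Pow U.X), Closed U (θ ≫ R) r → Mem (θ ≫ x) r

theorem isRep_inW {Γ : E} (R : Γ ⟶ Pow (L ⊗ V)) (x : Γ ⟶ U.X) :
    IsRep (fun Δ (σ : Δ ⟶ Γ) => InW U (σ ≫ R) (σ ≫ x)) := by
  refine (isRep_all_imp (K := Pow U.X) (Φ := fun Δ σ r => Closed U (σ ≫ R) r)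
    (Ψ := fun Δ σ r => Mem (σ ≫ x) r) ?_ ?_).congr fun Δ σ => ?_
  · exact (isRep_closed U (fst Γ (Pow U.X) ≫ R) (snd _ _)).congr fun Δ σ => by
      rw [Category.assoc]
  · exact (isRep_mem (fst Γ (Pow U.X) ≫ x) (snd _ _)).congr fun Δ σ => by
      rw [Category.assoc]
  · simp only [InW, Category.assoc]

theorem InW.res {Δ Θ : E} {R : Δ ⟶ Pow (L ⊗ V)} {x : Δ ⟶ U.X} (h : InW U R x) (θ : Θ ⟶ Δ) :
    InW U (θ ≫ R) (θ ≫ x) := by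
  intro Θ' θ' r hr
  rw [← Category.assoc] at hr ⊢
  exact h _ _ r hr

/-- An intersection of closed subsets is closed: over the stage indexing its branches, a closed
subset `r` remains closed, hence contains them. -/
theorem InW.sup {Δ : E} {R : Δ ⟶ Pow (L ⊗ V)} {a : Δ ⟶ L} {φ : Fam β U.X Δ}
    (ha : Mem (lift a φ.h) R) (hφ : InW U (pullback.fst _ _ ≫ R) φ.f) : InW U R (U.sup a φ) := by
  intro Θ θ r hr
  have := hr Θ (𝟙 Θ) (θ ≫ a) (φ.res θ) ⟨?_, ?_⟩
  · rwa [Category.id_comp, ← U.comp_sup] at this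
  · rw [Category.id_comp]
    have := ha.res θ
    rwa [comp_lift] at this
  · rw [Category.id_comp]
    have h1 := mem_fam_res (χ := fun _ k => InW U (k ≫ snd _ _) (k ≫ fst _ _)) (isRep_inW U _ _)
      φ R (by rwa [lift_fst, lift_snd]) θ
    rw [lift_fst, lift_snd] at h1
    have hcl := (isRep_closed U (θ ≫ R) r).res (σ := 𝟙 _) (by simpa using hr)
      (pullback.fst (φ.res θ).h β)
    rw [Category.comp_id] at hcl
    have h2 := h1 _ (𝟙 _) (pullback.fst (φ.res θ).h β ≫ r) (by rwa [Category.id_comp])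
    rwa [Category.id_comp] at h2

/-- By representability `ψ` names a subset of `U.X`; the inductive hypothesis makes it one of the
closed subsets being intersected. -/
theorem InW.induction {Γ : E} (R : Γ ⟶ Pow (L ⊗ V)) {ψ : Pred (Γ ⊗ U.X)} (hψ : IsRep ψ)
    (hc : ∀ (Δ : E) (σ : Δ ⟶ Γ) (a : Δ ⟶ L) (φ : Fam β U.X Δ), Mem (lift a φ.h) (σ ≫ R) →
      ψ _ (lift (pullback.fst _ _ ≫ σ) φ.f) → ψ _ (lift σ (U.sup a φ)))
    {Δ : E} (σ : Δ ⟶ Γ) (x : Δ ⟶ U.X) (h : InW U (σ ≫ R) x) : ψ _ (lift σ x) := by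
  obtain ⟨s, hs⟩ := exists_name (K := U.X) (Γ := Γ) (Φ := fun _ σ x => ψ _ (lift σ x))
    (hψ.congr fun Δ σ => by rw [← comp_lift, lift_fst_snd, Category.comp_id])
  rw [← hs]
  have := h Δ (𝟙 Δ) (σ ≫ s) ?_
  · rwa [Category.id_comp] at this
  · rintro Θ θ a φ ⟨h1, h2⟩
    rw [← Category.assoc, ← Category.assoc, hs] at h2
    rw [← Category.assoc, hs]
    simp only [Category.id_comp] at h1
    rw [← Category.assoc] at h1
    refine hc _ _ _ _ h1 ?_
    rwa [Category.assoc] at h2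

end Closed

end KripkeJoyal

/-! ### Induction and recursion on objects of well-founded trees. -/

namespace KripkeJoyal

attribute [local simp] pullback.lift_fst pullback.lift_snd pullback.lift_fst_assoc
  pullback.lift_snd_assoc

variable {E : Type u} [Category.{v} E] [CartesianMonoidalCategory E] [HasFiniteLimits E]
  [MonoidalClosed E] [HasSubobjectClassifier E]

variable {L T V : E} {β : T ⟶ V} {U : SupObject L β} {Γ : E}

/-- `M` is the object of pairs of `γ : Γ` and an element of the smallest subset closed under `sup`
with labels in `R γ`. -/
structure IsWObject (U : SupObject L β) (R : Γ ⟶ Pow (L ⊗ V)) {M : E} (p : M ⟶ Γ) (x : M ⟶ U.X) :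
    Prop where
  hom_ext : ∀ {Δ : E} {m m' : Δ ⟶ M}, m ≫ p = m' ≫ p → m ≫ x = m' ≫ x → m = m'
  inW : InW U (p ≫ R) x
  exists_lift : ∀ {Δ : E} (σ : Δ ⟶ Γ) (y : Δ ⟶ U.X), InW U (σ ≫ R) y →
    ∃ m : Δ ⟶ M, m ≫ p = σ ∧ m ≫ x = y

theorem exists_isWObject (U : SupObject L β) (R : Γ ⟶ Pow (L ⊗ V)) :
    ∃ (M : E) (p : M ⟶ Γ) (x : M ⟶ U.X), IsWObject U R p x := by
  obtain ⟨M, m, hm, hM⟩ := isRep_inW U (fst Γ U.X ≫ R) (snd Γ U.X)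
  refine ⟨M, m ≫ fst _ _, m ≫ snd _ _, fun {Δ} k k' h1 h2 => ?_, ?_, fun {Δ} σ y h => ?_⟩
  · rw [← cancel_mono m]
    apply CartesianMonoidalCategory.hom_ext <;> simpa
  · have := (hM M m).2 ⟨𝟙 _, Category.id_comp _⟩
    rwa [Category.assoc]
  · obtain ⟨k, hk⟩ := (hM Δ (lift σ y)).1 (by
      simpa using h)
    exact ⟨k, by rw [← Category.assoc, hk, lift_fst], by rw [← Category.assoc, hk, lift_snd]⟩

namespace IsWObject

variable {R : Γ ⟶ Pow (L ⊗ V)} {M : E} {p : M ⟶ Γ} {x : M ⟶ U.X}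

/-- Through this, the single object of trees over `Pow (L ⊗ V)` serves every `R`, as its pullback
along `R`. -/
theorem pullback (h : IsWObject U R p x) {Δ : E} (σ : Δ ⟶ Γ) :
    IsWObject U (σ ≫ R) (pullback.fst σ p) (pullback.snd σ p ≫ x) where
  hom_ext {Θ m m'} h1 h2 := by
    refine Limits.pullback.hom_ext h1 (h.hom_ext ?_ (by simpa using h2))
    simp only [Category.assoc, ← pullback.condition]
    rw [← Category.assoc, h1, Category.assoc]
  inW := by
    rw [← Category.assoc, pullback.condition, Category.assoc]
    exact h.inW.res U _
  exists_lift {Θ} τ y hy := by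
    obtain ⟨m, h1, h2⟩ := h.exists_lift (τ ≫ σ) y (by rwa [Category.assoc])
    exact ⟨pullback.lift τ m h1.symm, by simp, by simp [h2]⟩

theorem exists_sup (h : IsWObject U R p x) {Δ : E} (σ : Δ ⟶ Γ) (a : Δ ⟶ L) (φ : Fam β M Δ)
    (ha : Mem (lift a φ.h) (σ ≫ R)) (hφ : φ.f ≫ p = pullback.fst _ _ ≫ σ) :
    ∃ m : Δ ⟶ M, m ≫ p = σ ∧ m ≫ x = U.sup a (φ.map x) := by
  refine h.exists_lift σ _ (InW.sup U ha ?_)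
  rw [← Category.assoc]
  change InW U ((pullback.fst φ.h β ≫ σ) ≫ R) (φ.f ≫ x)
  rw [← hφ, Category.assoc]
  exact h.inW.res U _

/-- `InW.induction` speaks of `Γ ⊗ U.X`, not of `M`. Membership in the tree object is therefore
added to the predicate, so that in the inductive step the branches lift to `M`. -/
theorem induction (h : IsWObject U R p x) {χ : Pred M} (hχ : IsRep χ)
    (hc : ∀ (Δ : E) (m : Δ ⟶ M) (a : Δ ⟶ L) (φ : Fam β M Δ), Mem (lift a φ.h) (m ≫ p ≫ R) →
      φ.f ≫ p = pullback.fst _ _ ≫ m ≫ p → m ≫ x = U.sup a (φ.map x) → χ _ φ.f → χ _ m)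
    {Δ : E} (m : Δ ⟶ M) : χ _ m := by
  have hψ : IsRep (fun Δ (k : Δ ⟶ Γ ⊗ U.X) => InW U (k ≫ fst _ _ ≫ R) (k ≫ snd _ _) ∧
      ∀ (Θ : E) (θ : Θ ⟶ Δ) (m : Θ ⟶ M), (m ≫ p = (θ ≫ k) ≫ fst _ _ ∧
        m ≫ x = (θ ≫ k) ≫ snd _ _) → χ _ m) := by
    refine (isRep_inW U _ _).and (isRep_all_imp (K := M) (Γ := Γ ⊗ U.X)
      (Φ := fun Δ k m => m ≫ p = k ≫ fst _ _ ∧ m ≫ x = k ≫ snd _ _)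
      (Ψ := fun Δ k m => χ _ m) (IsRep.and ?_ ?_) (hχ.comp _))
    · exact (isRep_eq (snd (Γ ⊗ U.X) M ≫ p) (fst _ _ ≫ fst _ _)).congr fun Δ σ => by
        simp only [Category.assoc]
    · exact (isRep_eq (snd (Γ ⊗ U.X) M ≫ x) (fst _ _ ≫ snd _ _)).congr fun Δ σ => by
        simp only [Category.assoc]
  have := InW.induction U R hψ ?_ (m ≫ p) (m ≫ x) (by
    rw [Category.assoc]; exact h.inW.res U m)
  · exact this.2 Δ (𝟙 Δ) m (by simp)
  · rintro Δ σ a φ ha ⟨h1, h2⟩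
    rw [lift_fst_assoc, lift_snd, Category.assoc] at h1
    rw [lift_fst_assoc, lift_snd]
    refine ⟨InW.sup U ha h1, fun Θ θ m ⟨e1, e2⟩ => ?_⟩
    obtain ⟨f, f1, f2⟩ := h.exists_lift (pullback.fst φ.h β ≫ σ) φ.f (by rwa [Category.assoc])
    let φ₀ : Fam β M Δ := ⟨φ.h, f⟩
    have hφ : φ₀.map x = φ := by
      simp only [φ₀, Fam.map, f2]
    have hf := h2 _ (𝟙 _) f (by simp [f1, f2])
    rw [Category.assoc, lift_fst] at e1
    rw [Category.assoc, lift_snd, U.comp_sup, ← hφ, Fam.map_res] at e2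
    refine hc Θ m (θ ≫ a) (φ₀.res θ) ?_ ?_ e2 ?_
    · have := ha.res θ
      rw [comp_lift, ← Category.assoc, ← e1, Category.assoc] at this
      exact this
    · rw [e1]
      have := mem_fam_res (Γ := Γ) (χ := fun _ k => k ≫ fst _ _ ≫ p = k ≫ snd _ _) (isRep_eq _ _)
        φ₀ σ (by simpa [φ₀] using f1) θ
      simpa using this
    · have := mem_fam_res (χ := fun _ k => χ _ (k ≫ fst _ _)) (hχ.comp _) φ₀ σ
        (by simpa [φ₀] using hf) θ
      simpa using this

variable {G : E} (g : G ⟶ M)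

/-- The label and the family of elements of `G` form an input for the step of a recursion. -/
structure Input (R : Γ ⟶ Pow (L ⊗ V)) (p : M ⟶ Γ) {Δ : E} (σ : Δ ⟶ Γ) (a : Δ ⟶ L)
    (φ : Fam β G Δ) : Prop where
  mem : Mem (lift a φ.h) (σ ≫ R)
  f_comp : φ.f ≫ g ≫ p = pullback.fst _ _ ≫ σ

variable {g}

theorem isRep_input {Γ' : E} (σ : Γ' ⟶ Γ) (a : Γ' ⟶ L) (φ : Fam β G Γ') :
    IsRep (fun Δ (τ : Δ ⟶ Γ') => Input g R p (τ ≫ σ) (τ ≫ a) (φ.res τ)) := by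
  have h1 : IsRep (fun Δ (τ : Δ ⟶ Γ') => Mem (lift (τ ≫ a) (φ.res τ).h) ((τ ≫ σ) ≫ R)) :=
    (isRep_mem (lift a φ.h) (σ ≫ R)).congr fun Δ τ => by
      rw [comp_lift, Category.assoc]
      rfl
  have h2 : IsRep (fun Δ (τ : Δ ⟶ Γ') => (φ.res τ).f ≫ g ≫ p = pullback.fst _ _ ≫ τ ≫ σ) :=
    (isRep_all_mem_fam (Γ := Γ) (χ := fun _ k => k ≫ fst _ _ ≫ g ≫ p = k ≫ snd _ _)
      (isRep_eq _ _) φ σ).congr fun Δ τ => by simp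
  exact (h1.and h2).congr fun Δ τ => ⟨fun h => ⟨h.1, h.2⟩, fun h => ⟨h.1, h.2⟩⟩

theorem Input.res {Δ : E} {σ : Δ ⟶ Γ} {a : Δ ⟶ L} {φ : Fam β G Δ} (h : Input g R p σ a φ)
    {Θ : E} (θ : Θ ⟶ Δ) : Input g R p (θ ≫ σ) (θ ≫ a) (φ.res θ) := by
  have := (isRep_input σ a φ).res (σ := 𝟙 Δ) (by
    rwa [Category.id_comp, Category.id_comp, Fam.res_id]) θ
  rwa [Category.comp_id] at this

/-- The step of a definition by recursion of a section of `g : G ⟶ M`. -/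
structure RecStep (g : G ⟶ M) (R : Γ ⟶ Pow (L ⊗ V)) (p : M ⟶ Γ) (x : M ⟶ U.X) where
  run {Δ : E} (σ : Δ ⟶ Γ) (a : Δ ⟶ L) (φ : Fam β G Δ) (h : Input g R p σ a φ) : Δ ⟶ G
  run_p {Δ : E} (σ : Δ ⟶ Γ) (a : Δ ⟶ L) (φ : Fam β G Δ) (h : Input g R p σ a φ) :
    run σ a φ h ≫ g ≫ p = σ
  run_x {Δ : E} (σ : Δ ⟶ Γ) (a : Δ ⟶ L) (φ : Fam β G Δ) (h : Input g R p σ a φ) :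
    run σ a φ h ≫ g ≫ x = U.sup a (φ.map (g ≫ x))
  comp_run {Δ : E} (σ : Δ ⟶ Γ) (a : Δ ⟶ L) (φ : Fam β G Δ) (h : Input g R p σ a φ) {Θ : E}
    (θ : Θ ⟶ Δ) : θ ≫ run σ a φ h = run (θ ≫ σ) (θ ≫ a) (φ.res θ) (h.res θ)

namespace RecStep

variable (d : RecStep g R p x)

theorem run_congr {Δ : E} {σ σ' : Δ ⟶ Γ} {a a' : Δ ⟶ L} {φ φ' : Fam β G Δ} (hσ : σ = σ')
    (ha : a = a') (hφ : φ = φ') (h h') : d.run σ a φ h = d.run σ' a' φ' h' := by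
  subst hσ ha hφ
  rfl

/-- The subset `r` of `G` is closed under the step. -/
def ClosedStep {Δ : E} (σ : Δ ⟶ Γ) (r : Δ ⟶ Pow G) : Prop :=
  ∀ (Θ : E) (θ : Θ ⟶ Δ) (a : Θ ⟶ L) (φ : Fam β G Θ),
    Input g R p (θ ≫ σ) a φ ∧ Mem φ.f (pullback.fst _ _ ≫ θ ≫ r) →
      ∀ h : Input g R p (θ ≫ σ) a φ, Mem (d.run (θ ≫ σ) a φ h) (θ ≫ r)

theorem isRep_closedStep {Γ' : E} (σ : Γ' ⟶ Γ) (r : Γ' ⟶ Pow G) :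
    IsRep (fun Δ (τ : Δ ⟶ Γ') => d.ClosedStep (τ ≫ σ) (τ ≫ r)) := by
  refine (isRep_all_fam_imp (L := L) (β := β) (X := G) (Γ := Γ')
    (Φ := fun Δ τ a φ => Input g R p (τ ≫ σ) a φ ∧ Mem φ.f (pullback.fst _ _ ≫ τ ≫ r))
    (Ψ := fun Δ τ a φ => ∀ h : Input g R p (τ ≫ σ) a φ, Mem (d.run (τ ≫ σ) a φ h) (τ ≫ r))
    (fun τ a φ => IsRep.and ?_ ?_) (fun τ a φ h => ?_)).congr fun Δ τ => ?_
  · refine (isRep_input (g := g) (R := R) (p := p) (τ ≫ σ) a φ).congr fun Δ τ => ?_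
    rw [Category.assoc]
  · refine (isRep_mem_all φ (τ ≫ r)).congr fun Δ τ => ?_
    rw [Category.assoc]
  -- Here the conclusion uses the proof of its premise: `run` is defined only on inputs. So it can
  -- be represented only over the subobject where the premise holds.
  · refine (isRep_mem (d.run _ a φ h.1) (τ ≫ r)).congr fun Δ τ' => ?_
    rw [d.comp_run, Category.assoc τ' τ r]
    exact ⟨fun H h => d.run_congr (Category.assoc _ _ _).symm rfl rfl _ h ▸ H,
      fun H => d.run_congr (Category.assoc _ _ _) rfl rfl (by
        rw [Category.assoc]; exact h.1.res τ') _ ▸ H _⟩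
  · simp only [ClosedStep, Category.assoc]

/-- The element `y` of `G` belongs to all subsets closed under the step. -/
def Gen {Δ : E} (y : Δ ⟶ G) : Prop :=
  ∀ (Θ : E) (θ : Θ ⟶ Δ) (r : Θ ⟶ Pow G), d.ClosedStep (θ ≫ y ≫ g ≫ p) r → Mem (θ ≫ y) r

theorem isRep_gen : IsRep (fun _ (y : _ ⟶ G) => d.Gen y) := by
  refine (isRep_all_imp (K := Pow G) (Γ := G) (Φ := fun Δ y r => d.ClosedStep (y ≫ g ≫ p) r)
    (Ψ := fun Δ y r => Mem y r) ?_ (isRep_mem _ _)).congr fun Δ σ => ?_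
  · exact (d.isRep_closedStep (fst G (Pow G) ≫ g ≫ p) (snd _ _)).congr fun Δ σ => by
      simp only [Category.assoc]
  · simp only [Gen, Category.assoc]

theorem gen_run {Δ : E} {σ : Δ ⟶ Γ} {a : Δ ⟶ L} {φ : Fam β G Δ} (h : Input g R p σ a φ)
    (hφ : d.Gen φ.f) : d.Gen (d.run σ a φ h) := by
  intro Θ θ r hr
  rw [d.run_p] at hr
  have hin : Input g R p (𝟙 Θ ≫ θ ≫ σ) (θ ≫ a) (φ.res θ) := by
    rw [Category.id_comp]
    exact h.res θ
  have := hr Θ (𝟙 Θ) (θ ≫ a) (φ.res θ) ⟨hin, ?_⟩ hin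
  · rw [Category.id_comp r, d.run_congr (Category.id_comp _) rfl rfl hin (h.res θ)] at this
    rwa [d.comp_run]
  · rw [Category.id_comp]
    have h1 := mem_fam_res (Γ := Γ) (χ := fun _ k => d.Gen (k ≫ fst _ _)) (d.isRep_gen.comp _)
      φ σ (by rwa [lift_fst]) θ
    rw [lift_fst] at h1
    have hcl := (d.isRep_closedStep (θ ≫ σ) r).res (σ := 𝟙 _) (by simpa using hr)
      (pullback.fst (φ.res θ).h β)
    rw [Category.comp_id] at hcl
    have h2 := h1 _ (𝟙 _) (pullback.fst (φ.res θ).h β ≫ r) (by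
      rwa [Category.id_comp, (h.res θ).f_comp])
    rwa [Category.id_comp] at h2

theorem Gen.res {Δ Θ : E} {y : Δ ⟶ G} (h : d.Gen y) (θ : Θ ⟶ Δ) : d.Gen (θ ≫ y) :=
  d.isRep_gen.res h θ

theorem Gen.app {Δ Θ : E} {φ : Fam β G Δ} (h : d.Gen φ.f) (θ : Θ ⟶ Δ) (t : Θ ⟶ T) (w) :
    d.Gen (φ.app θ t w) :=
  d.isRep_gen.res h _

theorem app_input {Δ Θ : E} {σ : Δ ⟶ Γ} {a : Δ ⟶ L} {φ : Fam β G Δ} (h : Input g R p σ a φ)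
    (θ : Θ ⟶ Δ) (t : Θ ⟶ T) (w) : φ.app θ t w ≫ g ≫ p = θ ≫ σ := by
  rw [Fam.app, Category.assoc, h.f_comp]
  simp

/-- Inversion for generated elements. The elements of `Gen` that, if they lie over `m`, equal the
result of the step at `m` form a subset closed under the step; hence it contains all of `Gen`.
Closure rests on injectivity of `sup`: another input producing something over `m` has the same label
and the same underlying branches, and `hu` identifies the values on these. -/
theorem gen_unique (hM : IsWObject U R p x) {Δ : E} {m : Δ ⟶ M} {a : Δ ⟶ L} {φ : Fam β G Δ}
    (hφ : Input g R p (m ≫ p) a φ) (hm : m ≫ x = U.sup a (φ.map (g ≫ x)))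
    (hu : ∀ {Θ : E} (y : Θ ⟶ G) (θ : Θ ⟶ Limits.pullback φ.h β), d.Gen y → y ≫ g = θ ≫ φ.f ≫ g →
      y = θ ≫ φ.f) {Θ : E} (θ : Θ ⟶ Δ) (y : Θ ⟶ G) (hy : d.Gen y) (hyg : y ≫ g = θ ≫ m) :
    y = θ ≫ d.run _ a φ hφ := by
  obtain ⟨r, hr⟩ := exists_name (K := G) (Γ := Θ) (Φ := fun Δ' σ z => d.Gen z ∧
      ∀ (Θ' : E) (θ' : Θ' ⟶ Δ'), (θ' ≫ z) ≫ g = (θ' ≫ σ) ≫ θ ≫ m →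
        θ' ≫ z = (θ' ≫ σ) ≫ θ ≫ d.run _ a φ hφ) (by
    refine (d.isRep_gen.comp (snd Θ G)).and ?_
    refine (IsRep.imp (isRep_eq (snd Θ G ≫ g) (fst _ _ ≫ θ ≫ m))
      (isRep_eq (snd Θ G) (fst _ _ ≫ θ ≫ d.run _ a φ hφ))).congr fun Δ σ => ?_
    simp only [Category.assoc])
  have hcl : d.ClosedStep (𝟙 Θ ≫ y ≫ g ≫ p) r := by
    rintro Θ₁ θ₁ a₁ φ₁ ⟨hin, h1⟩ -
    have e : θ₁ ≫ 𝟙 Θ ≫ y ≫ g ≫ p = θ₁ ≫ θ ≫ m ≫ p := by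
      rw [Category.id_comp, ← Category.assoc y, hyg, Category.assoc]
    rw [← Category.assoc, hr] at h1
    rw [hr]
    refine ⟨d.gen_run hin h1.1, fun Θ' θ' e' => ?_⟩
    have ex : U.sup (θ' ≫ a₁) ((φ₁.res θ').map (g ≫ x)) =
        U.sup ((θ' ≫ θ₁ ≫ θ) ≫ a) ((φ.res (θ' ≫ θ₁ ≫ θ)).map (g ≫ x)) := by
      have := congrArg (· ≫ x) e'
      simp only [Category.assoc, d.run_x, hm, U.comp_sup, Fam.map_res, Fam.res_res] at this ⊢
      exact this
    obtain ⟨ea, eφ⟩ := U.sup_injective ex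
    have eφ' : φ₁.res θ' = φ.res (θ' ≫ θ₁ ≫ θ) := by
      have hh : (φ₁.res θ').h = (φ.res (θ' ≫ θ₁ ≫ θ)).h := (congrArg Fam.h eφ :)
      refine Fam.ext_app hh fun Θ'' ψ t w w' => ?_
      rw [Fam.app_res, Fam.app_res]
      refine hu _ _ (Gen.app d h1.1 _ _ _) (hM.hom_ext ?_ ?_)
      · rw [Category.assoc, app_input hin, e, ← Category.assoc]
        simp only [Category.assoc]
        rw [hφ.f_comp]
        simp
      · have : ∀ (φ φ' : Fam β U.X Θ'), φ = φ' → ∀ w w', φ.app ψ t w = φ'.app ψ t w' := by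
          rintro φ _ rfl _ _
          rfl
        have key := this _ _ eφ
        have := (Fam.app_map _ _ _ _ w).symm.trans ((key w w').trans (Fam.app_map _ _ _ _ w'))
        rw [Fam.app_res, Fam.app_res, Fam.app, Fam.app] at this
        simpa [Fam.app] using this
    rw [d.comp_run, ← Category.assoc (θ' ≫ θ₁) θ, d.comp_run]
    refine d.run_congr ?_ ?_ ?_ _ _
    · rw [e]
      simp only [Category.assoc]
    · rw [ea]
      simp only [Category.assoc]
    · rw [eφ']
      simp only [Category.assoc]
  have h1 := hy Θ (𝟙 Θ) r hcl
  rw [Category.id_comp, ← Category.id_comp r, hr] at h1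
  simpa using h1.2 Θ (𝟙 Θ) (by simpa using hyg)

/-- Definition by recursion on an object of well-founded trees. -/
theorem exists_section (hM : IsWObject U R p x) :
    ∃ s : M ⟶ G, s ≫ g = 𝟙 M ∧ ∀ {Δ : E} (m : Δ ⟶ M) (a : Δ ⟶ L) (φ : Fam β M Δ),
      m ≫ x = U.sup a (φ.map x) → ∀ h : Input g R p (m ≫ p) a (φ.map s),
        m ≫ s = d.run (m ≫ p) a (φ.map s) h := by
  -- `Gen` is the graph of the function to be defined. Unique existence of a value is representable,
  -- so it is subject to induction; at the generic tree `𝟙 M` it yields the section.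
  have hrep : IsRep (fun Δ (m : Δ ⟶ M) => ∃ y : Δ ⟶ G, ∀ (Θ : E) (θ : Θ ⟶ Δ) (y' : Θ ⟶ G),
      d.Gen y' ∧ y' ≫ g = θ ≫ m ↔ y' = θ ≫ y) :=
    isRep_existsUnique (K := G) (Φ := fun Δ m y => d.Gen y ∧ y ≫ g = m)
      ((d.isRep_gen.comp _).and ((isRep_eq (snd M G ≫ g) (fst _ _)).congr fun Δ σ => by
        rw [Category.assoc]))
  have hu : ∀ {Δ : E} (m : Δ ⟶ M), ∃ y : Δ ⟶ G, ∀ (Θ : E) (θ : Θ ⟶ Δ) (y' : Θ ⟶ G),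
      d.Gen y' ∧ y' ≫ g = θ ≫ m ↔ y' = θ ≫ y := by
    refine fun m => hM.induction hrep ?_ m
    rintro Δ m a φ ha hφ hm ⟨f, hf⟩
    have hf0 := (hf _ (𝟙 _) f).2 (Category.id_comp _).symm
    rw [Category.id_comp] at hf0
    have hin : Input g R p (m ≫ p) a ⟨φ.h, f⟩ := ⟨by rwa [Category.assoc], by
      rw [← Category.assoc]
      change (f ≫ g) ≫ p = _
      rw [hf0.2, hφ]⟩
    have hm' : m ≫ x = U.sup a (Fam.map ⟨φ.h, f⟩ (g ≫ x)) := by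
      rw [hm]
      congr 1
      simp only [Fam.map, ← hf0.2, Category.assoc]
    refine ⟨d.run _ a ⟨φ.h, f⟩ hin, fun Θ θ y' => ⟨fun ⟨h1, h2⟩ => ?_, ?_⟩⟩
    · exact d.gen_unique hM hin hm' (fun y θ h1 h2 => (hf _ θ y).1 ⟨h1, by rw [h2, hf0.2]⟩) θ y'
        h1 h2
    · rintro rfl
      refine ⟨Gen.res d (d.gen_run hin hf0.1) θ, ?_⟩
      rw [Category.assoc]
      congr 1
      exact hM.hom_ext (by rw [Category.assoc, d.run_p]) (by rw [Category.assoc, d.run_x, hm'])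
  obtain ⟨s, hs⟩ := hu (𝟙 M)
  have hs0 := (hs _ (𝟙 _) s).2 (Category.id_comp _).symm
  rw [Category.id_comp] at hs0
  refine ⟨s, hs0.2, fun {Δ} m a φ hm h => ?_⟩
  refine ((hs _ m _).1 ⟨d.gen_run h (Gen.res d hs0.1 φ.f), ?_⟩).symm
  rw [Category.comp_id]
  refine hM.hom_ext (by rw [Category.assoc, d.run_p]) ?_
  rw [Category.assoc, d.run_x, hm, Fam.map_map, ← Category.assoc s, hs0.2, Category.id_comp]

end RecStep

end IsWObject

end KripkeJoyal

/-! ### Uniqueness of elimination; nodes in the local universes model. -/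

namespace CwF

open KripkeJoyal

section General

variable {C : Type u} [Category.{v} C] {𝒞 : CwF.{w} C}

theorem Node.ext_of {Γ : C} {A : 𝒞.Ty Γ} {B : 𝒞.Ty (𝒞.ext A)} {Y : 𝒞.Ty Γ} {Δ : C} {σ : Δ ⟶ Γ}
    {n n' : 𝒞.Node A B Y σ} (hl : n.label = n'.label) (hT : n.T = n'.T)
    (hb : HEq n.branch n'.branch) : n = n' := by
  obtain ⟨l, _, T, _, b, _⟩ := n
  obtain ⟨l', _, T', _, b', _⟩ := n'
  dsimp only at hl hT hb
  subst hl hT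
  obtain rfl := eq_of_heq hb
  rfl

theorem Step.run_congr {I : 𝒞.WIntro} {Γ : C} {A : 𝒞.Ty Γ} {B : 𝒞.Ty (𝒞.ext A)} {Y : 𝒞.Ty Γ}
    {hY : Y = I.W A B} {D : 𝒞.Ty (𝒞.ext Y)} (d : Step I hY D) {Δ : C} {σ σ' : Δ ⟶ Γ} (hσ : σ = σ')
    {n : 𝒞.Node A B Y σ} {n' : 𝒞.Node A B Y σ'} (hl : n.label = n'.label) (hT : n.T = n'.T)
    (hb : HEq n.branch n'.branch) {u : 𝒞.Tm (𝒞.ext n.T)} {u' : 𝒞.Tm (𝒞.ext n'.T)} (hu : HEq u u')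
    (h h') : d.run σ n u h = d.run σ' n' u' h' := by
  subst hσ
  obtain rfl := Node.ext_of hl hT hb
  obtain rfl := eq_of_heq hu
  rfl

/-- Elements of `D` are sections of its comprehension, so the equalizer of two sections represents
the predicate. This makes equations between elements accessible to induction. -/
theorem isRep_tm_eq [HasFiniteLimits C] {Γ : C} {D : 𝒞.Ty Γ} {e e' : 𝒞.Tm Γ} (he : 𝒞.tp e = D)
    (he' : 𝒞.tp e' = D) : IsRep (fun Δ (σ : Δ ⟶ Γ) => 𝒞.tmSub σ e = 𝒞.tmSub σ e') := by
  have h1 : 𝒞.tp e = 𝒞.tySub (𝟙 Γ) D := by rw [𝒞.tySub_id, he]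
  have h2 : 𝒞.tp e' = 𝒞.tySub (𝟙 Γ) D := by rw [𝒞.tySub_id, he']
  refine (isRep_eq (𝒞.pair (𝟙 Γ) D e h1) (𝒞.pair (𝟙 Γ) D e' h2)).congr fun Δ σ =>
    ⟨fun h => ?_, fun h => ?_⟩
  · have := congrArg (fun k => 𝒞.tmSub k (𝒞.var D)) h
    simpa only [𝒞.tmSub_comp, 𝒞.pair_var] using this
  · apply 𝒞.ext_hom
    · simp only [Category.assoc, 𝒞.pair_disp]
    · simp only [𝒞.tmSub_comp, 𝒞.pair_var, h]

variable (𝒞) in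
/-- Induction for representable predicates on a `W`-type. -/
def HasInduction (I : 𝒞.WIntro) : Prop :=
  ∀ {Γ : C} {A : 𝒞.Ty Γ} {B : 𝒞.Ty (𝒞.ext A)} {Y : 𝒞.Ty Γ} (hY : Y = I.W A B)
    (χ : Pred (𝒞.ext Y)), IsRep χ →
    (∀ (Δ : C) (σ : Δ ⟶ Γ) (n : 𝒞.Node A B Y σ),
      χ _ (𝒞.pair (𝒞.disp n.T ≫ σ) Y n.branch n.tp_branch) →
      χ _ (𝒞.pair σ Y (I.sup hY σ n) (I.tp_sup hY σ n))) →
    ∀ (Δ : C) (m : Δ ⟶ 𝒞.ext Y), χ Δ m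

/-- Stability of eliminators will come from this: a re-indexed eliminator and the eliminator of the
re-indexed premise obey one computation rule. -/
theorem HasInduction.elim_unique [HasFiniteLimits C] {I : 𝒞.WIntro} (hI : 𝒞.HasInduction I) {Γ : C}
    {A : 𝒞.Ty Γ} {B : 𝒞.Ty (𝒞.ext A)} {Y : 𝒞.Ty Γ} {hY : Y = I.W A B} {D : 𝒞.Ty (𝒞.ext Y)}
    (d : Step I hY D) {e e' : 𝒞.Tm (𝒞.ext Y)} (he : 𝒞.tp e = D) (he' : 𝒞.tp e' = D)
    (h : ∀ {Δ : C} (σ : Δ ⟶ Γ) (n : 𝒞.Node A B Y σ) (hu),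
      𝒞.tmSub (𝒞.pair σ Y (I.sup hY σ n) (I.tp_sup hY σ n)) e =
        d.run σ n (𝒞.tmSub (𝒞.pair (𝒞.disp n.T ≫ σ) Y n.branch n.tp_branch) e) hu)
    (h' : ∀ {Δ : C} (σ : Δ ⟶ Γ) (n : 𝒞.Node A B Y σ) (hu),
      𝒞.tmSub (𝒞.pair σ Y (I.sup hY σ n) (I.tp_sup hY σ n)) e' =
        d.run σ n (𝒞.tmSub (𝒞.pair (𝒞.disp n.T ≫ σ) Y n.branch n.tp_branch) e') hu) : e = e' := by
  have := hI hY _ (isRep_tm_eq he he') (fun Δ σ n hn => by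
    rw [h σ n (by rw [𝒞.tp_sub, he]), h' σ n (by rw [𝒞.tp_sub, he'])]
    exact d.run_congr rfl rfl rfl HEq.rfl (heq_of_eq hn) _ _) _ (𝟙 _)
  rwa [𝒞.tmSub_id, 𝒞.tmSub_id] at this

end General

section Topos

attribute [local simp] pullback.lift_fst pullback.lift_snd pullback.lift_fst_assoc
  pullback.lift_snd_assoc

variable {E : Type u} [Category.{v} E]

theorem LElt.elAs_self {Γ : E} (t : LElt Γ) (h : t.fam = t.fam) : t.elAs t.fam h = t.el := by
  simp [LElt.elAs]

theorem LElt.el_heq_of_eq {Γ : E} {s t : LElt Γ} (h : s = t) : HEq s.el t.el := by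
  rw [h]

variable [HasFiniteLimits E]

theorem ofTopos_pair_eq {Δ Γ : E} (σ : Δ ⟶ Γ) (A : LFam Γ) (a : Δ ⟶ A.tot)
    (ha : a ≫ A.proj = (A.sub σ).cls) (h) :
    (ofTopos E).pair σ A (⟨A.sub σ, a, ha⟩ : LElt Δ) h = pullback.lift σ a ha.symm := by
  apply pullback.hom_ext
  · exact (pullback.lift_fst _ _ _).trans (pullback.lift_fst _ _ _).symm
  · refine (pullback.lift_snd _ _ _).trans (Eq.trans ?_ (pullback.lift_snd _ _ _).symm)
    exact LElt.elAs_self _ _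

theorem ofTopos_wk_eq {Δ Γ : E} (σ : Δ ⟶ Γ) (A : LFam Γ) :
    (ofTopos E).wk σ A = pullback.lift (pullback.fst (σ ≫ A.cls) A.proj ≫ σ) (pullback.snd _ _)
      ((Category.assoc _ _ _).trans pullback.condition) := by
  apply pullback.hom_ext
  · exact (pullback.lift_fst _ _ _).trans (pullback.lift_fst _ _ _).symm
  · refine (pullback.lift_snd _ _ _).trans (Eq.trans ?_ (pullback.lift_snd _ _ _).symm)
    exact eq_of_heq (LElt.heq_elAs _ _ _)

/-- The node given by morphisms. -/
noncomputable def LFam.node {Γ : E} {A : LFam Γ} {B : LFam (pullback A.cls A.proj)} {Y : LFam Γ}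
    {Δ : E} (σ : Δ ⟶ Γ) (a : Δ ⟶ A.tot) (ha : a ≫ A.proj = σ ≫ A.cls) (φ : Fam B.proj Y.tot Δ)
    (hh : φ.h = pullback.lift σ a ha.symm ≫ B.cls)
    (hf : φ.f ≫ Y.proj = (pullback.fst _ _ ≫ σ) ≫ Y.cls) :
    (ofTopos E).Node (Γ := Γ) A B Y σ where
  label := (⟨A.sub σ, a, ha⟩ : LElt Δ)
  tp_label := rfl
  T := (⟨B.proj, φ.h⟩ : LFam Δ)
  T_eq := (congrArg (LFam.mk B.proj) hh).trans
    (congrArg (fun k => LFam.sub k B) (ofTopos_pair_eq σ A a ha rfl).symm)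
  branch := (⟨Y.sub (pullback.fst _ _ ≫ σ), φ.f, hf⟩ : LElt (pullback φ.h B.proj))
  tp_branch := rfl

/-- The equations stored in a node fix all its families, leaving only the label and the branches as
data. -/
theorem LFam.exists_node {Γ : E} {A : LFam Γ} {B : LFam (pullback A.cls A.proj)} {Y : LFam Γ}
    {Δ : E} (σ : Δ ⟶ Γ) (n : (ofTopos E).Node (Γ := Γ) A B Y σ) :
    ∃ a ha φ hh hf, n = LFam.node σ a ha φ hh hf := by
  obtain ⟨⟨fam, a, ha⟩, tl, T, Te, ⟨fam', f, hf⟩, tb⟩ := n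
  change fam = A.sub σ at tl
  subst tl
  obtain rfl : T = LFam.mk B.proj (pullback.lift σ a ha.symm ≫ B.cls) :=
    Te.trans (congrArg (fun k => LFam.sub k B) (ofTopos_pair_eq σ A a ha rfl))
  change fam' = Y.sub (pullback.fst _ _ ≫ σ) at tb
  subst tb
  exact ⟨a, ha, ⟨_, f⟩, rfl, hf, rfl⟩

theorem LFam.node_injective {Γ : E} {A : LFam Γ} {B : LFam (pullback A.cls A.proj)} {Y : LFam Γ}
    {Δ : E} {σ : Δ ⟶ Γ} {a a' : Δ ⟶ A.tot} {ha ha'} {φ φ' : Fam B.proj Y.tot Δ} {hh hh' hf hf'}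
    (e : LFam.node (Y := Y) σ a ha φ hh hf = LFam.node σ a' ha' φ' hh' hf') : a = a' ∧ φ = φ' := by
  have h1 : (⟨A.sub σ, a, ha⟩ : LElt Δ) = ⟨A.sub σ, a', ha'⟩ := congrArg Node.label e
  have h1' := LElt.el_heq_of_eq h1
  obtain rfl : a = a' := eq_of_heq h1'
  refine ⟨rfl, ?_⟩
  obtain ⟨h, f⟩ := φ
  obtain ⟨h', f'⟩ := φ'
  dsimp only at hh hh'
  subst hh
  subst hh'
  have h2 : (⟨Y.sub (pullback.fst _ _ ≫ σ), f, hf⟩ : LElt _) =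
      ⟨Y.sub (pullback.fst _ _ ≫ σ), f', hf'⟩ := by
    have : ∀ n n' : (ofTopos E).Node (Γ := Γ) A B Y σ, n = n' → HEq n.branch n'.branch := by
      rintro n _ rfl
      rfl
    exact eq_of_heq (this _ _ e)
  have h2' := LElt.el_heq_of_eq h2
  obtain rfl : f = f' := eq_of_heq h2'
  rfl

theorem LFam.node_restrict {Γ : E} {A : LFam Γ} {B : LFam (pullback A.cls A.proj)} {Y : LFam Γ}
    {Δ Θ : E} (σ : Δ ⟶ Γ) (a : Δ ⟶ A.tot) (ha) (φ : Fam B.proj Y.tot Δ) (hh hf) (τ : Θ ⟶ Δ)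
    (ha' hh' hf') :
    (LFam.node (Y := Y) σ a ha φ hh hf).restrict τ =
      LFam.node (τ ≫ σ) (τ ≫ a) ha' (φ.res τ) hh' hf' := by
  refine Node.ext_of (LElt.ext_of ?_ HEq.rfl) rfl (heq_of_eq (LElt.ext_of ?_ (heq_of_eq ?_)))
  · exact congrArg (LFam.mk A.proj) (Category.assoc _ _ _).symm
  · refine congrArg (LFam.mk Y.proj) ?_
    change (ofTopos E).wk τ ⟨B.proj, φ.h⟩ ≫ (pullback.fst _ _ ≫ σ) ≫ Y.cls =
      (pullback.fst _ _ ≫ τ ≫ σ) ≫ Y.cls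
    rw [ofTopos_wk_eq]
    refine (congrArg _ (Category.assoc _ _ _)).trans ((pullback.lift_fst_assoc _ _ _ _).trans ?_)
    exact (Category.assoc _ _ _).trans ((congrArg (pullback.fst (τ ≫ φ.h) B.proj ≫ ·)
      (Category.assoc _ _ _).symm).trans (Category.assoc _ _ _).symm)
  · change (ofTopos E).wk τ ⟨B.proj, φ.h⟩ ≫ φ.f = _
    rw [ofTopos_wk_eq]
    rfl

theorem LFam.node_push {Δ Γ : E} {A : LFam Γ} {B : LFam (pullback A.cls A.proj)} {Y : LFam Γ}
    {Θ : E} (σ : Δ ⟶ Γ) (τ : Θ ⟶ Δ) (a : Θ ⟶ A.tot) (ha) (φ : Fam B.proj Y.tot Θ) (hh hf)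
    (ha' hh' hf') :
    Node.push (𝒞 := ofTopos E) (A := A) (B := B) (Y := Y) σ (LFam.node (A := A.sub σ)
      (B := LFam.sub ((ofTopos E).wk σ A) B) (Y := Y.sub σ) τ a ha φ hh hf) =
      LFam.node (τ ≫ σ) a ha' φ hh' hf' := by
  refine Node.ext_of (LElt.ext_of ?_ HEq.rfl) rfl (heq_of_eq (LElt.ext_of ?_ HEq.rfl))
  · exact congrArg (LFam.mk A.proj) (Category.assoc _ _ _).symm
  · refine congrArg (LFam.mk Y.proj) ?_
    change (pullback.fst _ _ ≫ τ) ≫ σ ≫ Y.cls = (pullback.fst _ _ ≫ τ ≫ σ) ≫ Y.cls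
    simp

theorem ofTopos_pair_snd {Δ Γ : E} (σ : Δ ⟶ Γ) (A : LFam Γ) (t : LElt Δ) (h : t.fam = A.sub σ) :
    HEq ((show Δ ⟶ pullback A.cls A.proj from (ofTopos E).pair σ A t h) ≫ pullback.snd A.cls A.proj)
      t.el :=
  (heq_of_eq (pullback.lift_snd _ _ _)).trans (t.heq_elAs (A.sub σ) h)

theorem LFam.branch_proj {Γ : E} {V T : E} {β : T ⟶ V} {Y : LFam Γ} {Δ : E} {σ : Δ ⟶ Γ}
    (φ : Fam β (pullback Y.cls Y.proj) Δ)
    (hφ : φ.f ≫ pullback.fst _ _ = pullback.fst _ _ ≫ σ) :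
    (φ.map (pullback.snd Y.cls Y.proj)).f ≫ Y.proj = (pullback.fst φ.h β ≫ σ) ≫ Y.cls := by
  rw [← hφ, Category.assoc, pullback.condition, ← Category.assoc]
  rfl

theorem LFam.node_restrict_eq {Γ : E} {A : LFam Γ} {B : LFam (pullback A.cls A.proj)} {Y : LFam Γ}
    {Δ Θ : E} (σ : Δ ⟶ Γ) (a : Δ ⟶ A.tot) (ha) (φ : Fam B.proj Y.tot Δ) (hh hf) (τ : Θ ⟶ Δ)
    {φ' : Fam B.proj Y.tot Θ} (hφ : φ.res τ = φ') (ha' hh' hf') :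
    (LFam.node (Y := Y) σ a ha φ hh hf).restrict τ = LFam.node (τ ≫ σ) (τ ≫ a) ha' φ' hh' hf' := by
  subst hφ
  exact LFam.node_restrict σ a ha φ hh hf τ ha' hh' hf'

theorem LFam.pair_branch {Γ : E} {A : LFam Γ} {B : LFam (pullback A.cls A.proj)} {Y : LFam Γ}
    {Δ : E} {σ : Δ ⟶ Γ} {a : Δ ⟶ A.tot} {ha} (φ : Fam B.proj (pullback Y.cls Y.proj) Δ) {hh}
    (hφ : φ.f ≫ pullback.fst _ _ = pullback.fst _ _ ≫ σ) (hf) (h) :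
    (ofTopos E).pair (pullback.fst φ.h B.proj ≫ σ) Y
      (LFam.node σ a ha (φ.map (pullback.snd Y.cls Y.proj)) hh hf).branch h = φ.f := by
  refine (ofTopos_pair_eq _ _ _ _ _).trans (pullback.hom_ext ?_ ?_)
  · exact (pullback.lift_fst _ _ _).trans hφ.symm
  · exact pullback.lift_snd _ _ _

end Topos

end CwF

/-! ### W-types of the topos: strictly stable formation and introduction. -/

namespace CwF

open KripkeJoyal

section WTypesOfTopos

attribute [local simp] pullback.lift_fst pullback.lift_snd pullback.lift_fst_assoc
  pullback.lift_snd_assoc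

variable {E : Type u} [Category.{v} E] [CartesianMonoidalCategory E] [HasFiniteLimits E]
  [MonoidalClosed E] [HasSubobjectClassifier E]

/-- The relation between `Γ` and pairs of a label and the arity assigned to it. -/
def LFam.IsCode {Γ : E} (A : LFam Γ) (B : LFam (pullback A.cls A.proj)) {Δ : E} (σ : Δ ⟶ Γ)
    (a : Δ ⟶ A.tot) (h : Δ ⟶ B.base) : Prop :=
  ∃ ha : a ≫ A.proj = σ ≫ A.cls, h = pullback.lift σ a ha.symm ≫ B.cls

theorem LFam.exists_code {Γ : E} (A : LFam Γ) (B : LFam (pullback A.cls A.proj)) :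
    ∃ c : Γ ⟶ Pow (A.tot ⊗ B.base), ∀ (Δ : E) (σ : Δ ⟶ Γ) (k : Δ ⟶ A.tot ⊗ B.base),
      Mem k (σ ≫ c) ↔ A.IsCode B σ (k ≫ fst _ _) (k ≫ snd _ _) := by
  let m : pullback A.cls A.proj ⟶ Γ ⊗ (A.tot ⊗ B.base) :=
    lift (pullback.fst _ _) (lift (pullback.snd _ _) B.cls)
  have hm : Mono m := by
    refine ⟨fun k k' e => ?_⟩
    have e1 := congrArg (· ≫ fst _ _) e
    have e2 := congrArg (· ≫ snd _ _ ≫ fst _ _) e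
    simp only [m, Category.assoc, lift_fst, lift_snd_assoc] at e1 e2
    exact pullback.hom_ext e1 e2
  refine exists_name (K := A.tot ⊗ B.base) (Γ := Γ) ((isRep_exists m).congr fun Δ σ => ?_)
  constructor
  · rintro ⟨s, rfl⟩
    refine ⟨by simp [m, pullback.condition], ?_⟩
    have : s = pullback.lift ((s ≫ m) ≫ fst _ _) (((s ≫ m) ≫ snd _ _) ≫ fst _ _)
        (by simp [m, pullback.condition]) := by
      apply pullback.hom_ext <;> simp [m]
    rw [← this]
    simp [m]
  · rintro ⟨ha, hh⟩
    refine ⟨pullback.lift _ _ ha.symm, ?_⟩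
    simp only [m, comp_lift, pullback.lift_fst, pullback.lift_snd]
    rw [← hh, ← comp_lift, lift_fst_snd, Category.comp_id, ← comp_lift, lift_fst_snd,
      Category.comp_id]

/-- The name of the relation `IsCode`. -/
noncomputable def LFam.code {Γ : E} (A : LFam Γ) (B : LFam (pullback A.cls A.proj)) :
    Γ ⟶ Pow (A.tot ⊗ B.base) :=
  (A.exists_code B).choose

theorem LFam.mem_code {Γ : E} (A : LFam Γ) (B : LFam (pullback A.cls A.proj)) {Δ : E} (σ : Δ ⟶ Γ)
    (a : Δ ⟶ A.tot) (h : Δ ⟶ B.base) : Mem (lift a h) (σ ≫ A.code B) ↔ A.IsCode B σ a h := by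
  rw [LFam.code, (A.exists_code B).choose_spec, lift_fst, lift_snd]

/-- The heart of strictness: re-indexing keeps `A.tot` and `B.proj`, hence the local universe of
trees, and a pair is admissible at `θ` for the re-indexed data exactly when it is admissible at `θ ≫
σ`. -/
theorem LFam.code_sub {Δ Γ : E} (σ : Δ ⟶ Γ) (A : LFam Γ) (B : LFam (pullback A.cls A.proj)) :
    (A.sub σ).code (LFam.sub ((ofTopos E).wk σ A) B) = σ ≫ A.code B := by
  refine pow_ext (K := A.tot ⊗ B.base) fun Θ θ k => ?_
  obtain ⟨a, h, rfl⟩ : ∃ (a : Θ ⟶ A.tot) (h : Θ ⟶ B.base), k = lift a h :=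
    ⟨k ≫ fst A.tot B.base, k ≫ snd A.tot B.base, by
      rw [← comp_lift, lift_fst_snd, Category.comp_id]⟩
  refine (LFam.mem_code (A.sub σ) (LFam.sub ((ofTopos E).wk σ A) B) θ a h).trans ?_
  refine Iff.trans ?_ ((LFam.mem_code A B (θ ≫ σ) a h).symm.trans
    (iff_of_eq (congrArg (Mem (lift a h)) (Category.assoc _ _ _))))
  have e : ∀ (w : a ≫ A.proj = θ ≫ σ ≫ A.cls) (w' : a ≫ A.proj = (θ ≫ σ) ≫ A.cls),
      pullback.lift θ a w.symm ≫ (ofTopos E).wk σ A ≫ B.cls =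
        pullback.lift (θ ≫ σ) a w'.symm ≫ B.cls := by
    intro w w'
    refine (Category.assoc _ _ _).symm.trans (congrArg (· ≫ B.cls) ?_)
    rw [ofTopos_wk_eq]
    apply pullback.hom_ext
    · refine (Category.assoc _ _ _).trans ((congrArg _ (pullback.lift_fst _ _ _)).trans ?_)
      refine (Category.assoc _ _ _).symm.trans ?_
      exact (congrArg (· ≫ σ) (pullback.lift_fst _ _ _)).trans (pullback.lift_fst _ _ _).symm
    · refine (Category.assoc _ _ _).trans ((congrArg _ (pullback.lift_snd _ _ _)).trans ?_)
      exact (pullback.lift_snd _ _ _).trans (pullback.lift_snd _ _ _).symm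
  constructor
  · rintro ⟨w, rfl⟩
    have w' : a ≫ A.proj = (θ ≫ σ) ≫ A.cls :=
      (show a ≫ A.proj = _ from w).trans (Category.assoc _ _ _).symm
    exact ⟨w', e w w'⟩
  · rintro ⟨w, rfl⟩
    exact ⟨w.trans (Category.assoc _ _ _), (e (w.trans (Category.assoc _ _ _)) w).symm⟩

/-- A choice of the universe of well-founded trees for all local universes. -/
structure Trees (E : Type u) [Category.{v} E] [CartesianMonoidalCategory E] [HasFiniteLimits E]
    [MonoidalClosed E] [HasSubobjectClassifier E] where
  U (L : E) {T V : E} (β : T ⟶ V) : SupObject L β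
  tot (L : E) {T V : E} (β : T ⟶ V) : E
  proj (L : E) {T V : E} (β : T ⟶ V) : tot L β ⟶ Pow (L ⊗ V)
  val (L : E) {T V : E} (β : T ⟶ V) : tot L β ⟶ (U L β).X
  spec (L : E) {T V : E} (β : T ⟶ V) : IsWObject (U L β) (𝟙 _) (proj L β) (val L β)

theorem exists_trees (hN : HasNNO E) : Nonempty (Trees E) := by
  have U : ∀ (L T V : E) (β : T ⟶ V), SupObject L β :=
    fun L _ _ β => (exists_supObject hN L β).some
  have h := fun (L T V : E) (β : T ⟶ V) => exists_isWObject (U L T V β) (𝟙 (Pow (L ⊗ V)))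
  choose M p x h using h
  exact ⟨⟨fun L T V => U L T V, fun L T V => M L T V, fun L T V => p L T V, fun L T V => x L T V,
    fun L T V => h L T V⟩⟩

namespace Trees

variable (𝒯 : Trees E)

/-- The `W`-type. -/
noncomputable def W {Γ : E} (A : LFam Γ) (B : LFam (pullback A.cls A.proj)) : LFam Γ where
  proj := 𝒯.proj A.tot B.proj
  cls := A.code B

theorem isWObject {Γ : E} (A : LFam Γ) (B : LFam (pullback A.cls A.proj)) :
    IsWObject (𝒯.U A.tot B.proj) (A.code B) (pullback.fst (𝒯.W A B).cls (𝒯.W A B).proj)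
      (pullback.snd _ _ ≫ 𝒯.val A.tot B.proj) := by
  have := (𝒯.spec A.tot B.proj).pullback (A.code B)
  rwa [Category.comp_id] at this

/-- `m` is the underlying morphism of `sup` of the node `n`. -/
def IsSup {Γ : E} {A : LFam Γ} {B : LFam (pullback A.cls A.proj)}
    (c : Γ ⟶ Pow (A.tot ⊗ B.base)) {Δ : E} {σ : Δ ⟶ Γ}
    (n : (ofTopos E).Node (Γ := Γ) A B (⟨𝒯.proj A.tot B.proj, c⟩ : LFam Γ) σ)
    (m : Δ ⟶ 𝒯.tot A.tot B.proj) : Prop :=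
  m ≫ 𝒯.proj A.tot B.proj = σ ≫ c ∧ ∀ a ha φ hh hf, n = LFam.node σ a ha φ hh hf →
    m ≫ 𝒯.val A.tot B.proj = (𝒯.U A.tot B.proj).sup a (φ.map (𝒯.val A.tot B.proj))

-- A tree is determined by the set of admissible pairs it lies over and by its underlying value. The
-- stability laws of `sup` follow by checking that both sides satisfy `IsSup`.
variable {𝒯} in
theorem IsSup.unique {Γ : E} {A : LFam Γ} {B : LFam (pullback A.cls A.proj)}
    {c : Γ ⟶ Pow (A.tot ⊗ B.base)} {Δ : E} {σ : Δ ⟶ Γ}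
    {n : (ofTopos E).Node (Γ := Γ) A B (⟨𝒯.proj A.tot B.proj, c⟩ : LFam Γ) σ}
    {m m' : Δ ⟶ 𝒯.tot A.tot B.proj} (h : 𝒯.IsSup c n m) (h' : 𝒯.IsSup c n m') : m = m' := by
  obtain ⟨a, ha, φ, hh, hf, hn⟩ := LFam.exists_node σ n
  exact (𝒯.spec _ _).hom_ext (h.1.trans h'.1.symm)
    ((h.2 a ha φ hh hf hn).trans (h'.2 a ha φ hh hf hn).symm)

theorem exists_isSup {Γ : E} {A : LFam Γ} {B : LFam (pullback A.cls A.proj)} {Δ : E} {σ : Δ ⟶ Γ}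
    (n : (ofTopos E).Node (Γ := Γ) A B (𝒯.W A B) σ) : ∃ m, 𝒯.IsSup (A.code B) n m := by
  obtain ⟨a, ha, φ, hh, hf, rfl⟩ := LFam.exists_node σ n
  obtain ⟨m, h1, h2⟩ := (𝒯.spec A.tot B.proj).exists_sup (σ ≫ A.code B) a φ
    (by rw [Category.comp_id, LFam.mem_code]; exact ⟨ha, hh⟩)
    (hf.trans (Category.assoc _ _ _))
  refine ⟨m, h1, fun a' ha' φ' hh' hf' e => ?_⟩
  obtain ⟨rfl, rfl⟩ := LFam.node_injective e
  exact h2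

/-- The underlying morphism of `sup`. -/
noncomputable def supHom {Γ : E} {A : LFam Γ} {B : LFam (pullback A.cls A.proj)}
    {c : Γ ⟶ Pow (A.tot ⊗ B.base)} (hc : c = A.code B) {Δ : E} {σ : Δ ⟶ Γ}
    (n : (ofTopos E).Node (Γ := Γ) A B (⟨𝒯.proj A.tot B.proj, c⟩ : LFam Γ) σ) :
    Δ ⟶ 𝒯.tot A.tot B.proj :=
  (show ∃ m, 𝒯.IsSup c n m by subst hc; exact 𝒯.exists_isSup n).choose

theorem isSup_supHom {Γ : E} {A : LFam Γ} {B : LFam (pullback A.cls A.proj)}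
    {c : Γ ⟶ Pow (A.tot ⊗ B.base)} (hc : c = A.code B) {Δ : E} {σ : Δ ⟶ Γ}
    (n : (ofTopos E).Node (Γ := Γ) A B (⟨𝒯.proj A.tot B.proj, c⟩ : LFam Γ) σ) :
    𝒯.IsSup c n (𝒯.supHom hc n) :=
  (show ∃ m, 𝒯.IsSup c n m by subst hc; exact 𝒯.exists_isSup n).choose_spec

/-- The `sup` of a node. -/
noncomputable def sup {Γ : E} {A : LFam Γ} {B : LFam (pullback A.cls A.proj)} {Y : LFam Γ}
    (hY : Y = 𝒯.W A B) {Δ : E} {σ : Δ ⟶ Γ} (n : (ofTopos E).Node (Γ := Γ) A B Y σ) : LElt Δ :=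
  ⟨(𝒯.W A B).sub σ, 𝒯.supHom rfl (hY ▸ n : (ofTopos E).Node (Γ := Γ) A B (𝒯.W A B) σ),
    (𝒯.isSup_supHom rfl _).1⟩

/-- The classifying morphism `c` is left variable because after re-indexing it is `σ ≫ A.code B`,
which is only propositionally the code of the re-indexed data. -/
theorem sup_eq {Γ : E} {A : LFam Γ} {B : LFam (pullback A.cls A.proj)}
    {c : Γ ⟶ Pow (A.tot ⊗ B.base)} (hc : c = A.code B)
    (hY : (⟨𝒯.proj A.tot B.proj, c⟩ : LFam Γ) = 𝒯.W A B) {Δ : E} {σ : Δ ⟶ Γ}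
    (n : (ofTopos E).Node (Γ := Γ) A B (⟨𝒯.proj A.tot B.proj, c⟩ : LFam Γ) σ) :
    𝒯.sup hY n = ⟨⟨𝒯.proj A.tot B.proj, σ ≫ c⟩, 𝒯.supHom hc n, (𝒯.isSup_supHom hc n).1⟩ := by
  subst hc
  rfl

theorem sup_restrict {Γ : E} {A : LFam Γ} {B : LFam (pullback A.cls A.proj)} {Y : LFam Γ}
    (hY : Y = 𝒯.W A B) {Δ : E} {σ : Δ ⟶ Γ} (n : (ofTopos E).Node (Γ := Γ) A B Y σ)
    {Θ : E} (τ : Θ ⟶ Δ) : (𝒯.sup hY n).sub τ = 𝒯.sup hY (n.restrict τ) := by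
  subst hY
  refine LElt.ext_of (congrArg (LFam.mk _) (Category.assoc _ _ _).symm) (heq_of_eq ?_)
  refine IsSup.unique (n := n.restrict τ) ?_ (𝒯.isSup_supHom rfl _)
  have h := 𝒯.isSup_supHom rfl n
  refine ⟨?_, fun a ha φ hh hf e => ?_⟩
  · refine (Category.assoc _ _ _).trans ((congrArg (τ ≫ ·) h.1).trans (Category.assoc _ _ _).symm)
  · obtain ⟨a', ha', φ', hh', hf', rfl⟩ := LFam.exists_node σ n
    rw [LFam.node_restrict (Y := 𝒯.W A B) σ a' ha' φ' hh' hf' τ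
      (by rw [Category.assoc, ha', Category.assoc])
      (by
        change τ ≫ φ'.h = _
        rw [hh', ← Category.assoc]
        congr 1
        apply pullback.hom_ext <;> simp)
      (by
        have := mem_fam_res (X := 𝒯.tot A.tot B.proj) (Γ := Γ)
          (χ := fun _ k => k ≫ fst _ _ ≫ (𝒯.W A B).proj = k ≫ snd _ _ ≫ (𝒯.W A B).cls)
          (isRep_eq _ _) φ' σ (((lift_fst_assoc _ _ _).trans hf').trans
            ((Category.assoc _ _ _).trans
              ((lift_snd_assoc _ _ _).trans (Category.assoc _ _ _)).symm)) τ
        exact (lift_fst_assoc _ _ _).symm.trans (this.trans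
          (lift_snd_assoc _ _ _)))] at e
    obtain ⟨rfl, rfl⟩ := LFam.node_injective e
    refine (Category.assoc _ _ _).trans ?_
    refine (congrArg (τ ≫ ·) (h.2 a' ha' φ' hh' hf' rfl)).trans ?_
    dsimp only
    rw [SupObject.comp_sup]
    exact congrArg _ (Fam.map_res _ _ _)

theorem sup_push {Δ Γ : E} {A : LFam Γ} {B : LFam (pullback A.cls A.proj)} {Y : LFam Γ}
    (hY : Y = 𝒯.W A B) (σ : Δ ⟶ Γ) {Θ : E} (τ : Θ ⟶ Δ)
    (hY' : Y.sub σ = 𝒯.W (A.sub σ) (LFam.sub ((ofTopos E).wk σ A) B))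
    (n : (ofTopos E).Node (Γ := Δ) (A.sub σ) (LFam.sub ((ofTopos E).wk σ A) B) (Y.sub σ) τ) :
    𝒯.sup hY' n = 𝒯.sup hY (Node.push (𝒞 := ofTopos E) (A := A) (B := B) (Y := Y) σ n) := by
  subst hY
  refine (𝒯.sup_eq (A := A.sub σ) (B := LFam.sub ((ofTopos E).wk σ A) B) (c := σ ≫ A.code B)
    (LFam.code_sub σ A B).symm hY' n).trans ?_
  refine LElt.ext_of (congrArg (LFam.mk _) (Category.assoc _ _ _).symm) (heq_of_eq ?_)
  have h := 𝒯.isSup_supHom (A := A.sub σ) (B := LFam.sub ((ofTopos E).wk σ A) B)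
    (LFam.code_sub σ A B).symm n
  refine IsSup.unique (A := A) (B := B) (n := Node.push (𝒞 := ofTopos E) (A := A) (B := B)
    (Y := 𝒯.W A B) σ n) ?_ (𝒯.isSup_supHom rfl _)
  refine ⟨h.1.trans (Category.assoc _ _ _).symm, fun a ha φ hh hf e => ?_⟩
  obtain ⟨a', ha', φ', hh', hf', rfl⟩ := LFam.exists_node (A := A.sub σ)
    (B := LFam.sub ((ofTopos E).wk σ A) B) (Y := (𝒯.W A B).sub σ) τ n
  have ha'' : a' ≫ A.proj = (τ ≫ σ) ≫ A.cls := ha'.trans (Category.assoc _ _ _).symm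
  rw [LFam.node_push (Y := 𝒯.W A B) σ τ a' ha' φ' hh' hf' ha''
    ((LFam.mem_code A B (τ ≫ σ) a' φ'.h).1 (by
      rw [Category.assoc, ← LFam.code_sub]
      exact (LFam.mem_code (A.sub σ) (LFam.sub ((ofTopos E).wk σ A) B) τ a' φ'.h).2 ⟨ha', hh'⟩)).2
    (hf'.trans (by
      change (pullback.fst _ _ ≫ τ) ≫ σ ≫ (𝒯.W A B).cls = _
      simp only [Category.assoc]
      rfl))] at e
  obtain ⟨rfl, rfl⟩ := LFam.node_injective e
  exact h.2 a' ha' φ' hh' hf' rfl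

end Trees

end WTypesOfTopos

end CwF

/-! ### W-types of the topos: elimination. -/

namespace CwF

open KripkeJoyal KripkeJoyal.IsWObject

section General

variable {C : Type u} [Category.{v} C] {𝒞 : CwF.{w} C}

/-- The elimination rule is stable under re-indexing. -/
theorem Step.reindex_elim {I : 𝒞.WIntro} {Γ : C} {A : 𝒞.Ty Γ} {B : 𝒞.Ty (𝒞.ext A)} {Y : 𝒞.Ty Γ}
    {hY : Y = I.W A B} {D : 𝒞.Ty (𝒞.ext Y)} (d : Step I hY D) {e : 𝒞.Tm (𝒞.ext Y)}
    (he : 𝒞.tp e = D)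
    (h : ∀ {Δ : C} (σ : Δ ⟶ Γ) (n : 𝒞.Node A B Y σ),
      𝒞.tmSub (𝒞.pair σ Y (I.sup hY σ n) (I.tp_sup hY σ n)) e =
        d.run σ n (𝒞.tmSub (𝒞.pair (𝒞.disp n.T ≫ σ) Y n.branch n.tp_branch) e)
          (by rw [𝒞.tp_sub, he]))
    {Δ : C} (σ : Δ ⟶ Γ) {Θ : C} (τ : Θ ⟶ Δ)
    (n : 𝒞.Node (𝒞.tySub σ A) (𝒞.tySub (𝒞.wk σ A) B) (𝒞.tySub σ Y) τ) (hs) (hu) :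
    𝒞.tmSub (𝒞.pair τ (𝒞.tySub σ Y)
        (I.sup ((congrArg (𝒞.tySub σ) hY).trans (I.W_sub σ A B)) τ n) hs) (𝒞.tmSub (𝒞.wk σ Y) e) =
      (d.reindex σ).run τ n (𝒞.tmSub (𝒞.pair (𝒞.disp n.T ≫ τ) (𝒞.tySub σ Y) n.branch n.tp_branch)
        (𝒞.tmSub (𝒞.wk σ Y) e)) hu := by
  rw [← 𝒞.tmSub_comp, pair_wk, pair_congr rfl (I.sup_push hY σ τ n) _ (I.tp_sup _ _ _), h]
  refine d.run_congr rfl rfl rfl HEq.rfl (heq_of_eq ?_) _ _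
  rw [← 𝒞.tmSub_comp, pair_wk]
  exact congrArg (𝒞.tmSub · e) (pair_congr (Category.assoc _ _ _).symm rfl _ _)

end General

section WTypesOfTopos

attribute [local simp] pullback.lift_fst pullback.lift_snd pullback.lift_fst_assoc
  pullback.lift_snd_assoc

variable {E : Type u} [Category.{v} E] [CartesianMonoidalCategory E] [HasFiniteLimits E]
  [MonoidalClosed E] [HasSubobjectClassifier E]

namespace Trees

variable (𝒯 : Trees E)

/-- Formation and introduction of `W`-types. -/
noncomputable def wIntro : (ofTopos E).WIntro where
  W A B := 𝒯.W A B
  W_sub σ A B := congrArg (LFam.mk (𝒯.proj A.tot B.proj)) (LFam.code_sub σ A B).symm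
  sup hY _ _ n := 𝒯.sup hY n
  tp_sup hY _ _ _ := by
    subst hY
    rfl
  sup_restrict hY _ _ n _ τ := 𝒯.sup_restrict hY n τ
  sup_push hY _ σ _ τ n := 𝒯.sup_push hY σ τ _ n

theorem pair_sup_val {Γ : E} {A : LFam Γ} {B : LFam (pullback A.cls A.proj)} {Δ : E} {σ : Δ ⟶ Γ}
    {a : Δ ⟶ A.tot} (ha) (φ : Fam B.proj (𝒯.W A B).tot Δ) (hh) (hf) (h) :
    (show Δ ⟶ pullback (𝒯.W A B).cls (𝒯.W A B).proj from
      (ofTopos E).pair σ (𝒯.W A B) (𝒯.sup rfl (LFam.node σ a ha φ hh hf)) h) ≫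
        pullback.snd _ _ ≫ 𝒯.val A.tot B.proj =
      (𝒯.U A.tot B.proj).sup a (φ.map (𝒯.val A.tot B.proj)) := by
  refine (Category.assoc _ _ _).symm.trans (Eq.trans (congrArg (· ≫ 𝒯.val A.tot B.proj)
    (eq_of_heq (ofTopos_pair_snd σ (𝒯.W A B) _ h))) ?_)
  exact (𝒯.isSup_supHom rfl _).2 a ha φ hh hf rfl

theorem pair_sup_eq {Γ : E} {A : LFam Γ} {B : LFam (pullback A.cls A.proj)} {Δ : E} {σ : Δ ⟶ Γ}
    {a : Δ ⟶ A.tot} (ha) (φ : Fam B.proj (𝒯.W A B).tot Δ) (hh) (hf) (h)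
    (m : Δ ⟶ pullback (𝒯.W A B).cls (𝒯.W A B).proj) (hσ : m ≫ pullback.fst _ _ = σ)
    (hm : m ≫ pullback.snd _ _ ≫ 𝒯.val A.tot B.proj =
      (𝒯.U A.tot B.proj).sup a (φ.map (𝒯.val A.tot B.proj))) :
    (ofTopos E).pair σ (𝒯.W A B) (𝒯.sup rfl (LFam.node σ a ha φ hh hf)) h = m :=
  (𝒯.isWObject A B).hom_ext (((ofTopos E).pair_disp _ _ _ _).trans hσ.symm)
    ((𝒯.pair_sup_val ha φ hh hf h).trans hm.symm)

theorem hasInduction : (ofTopos E).HasInduction 𝒯.wIntro := by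
  intro Γ A B Y hY χ hχ hc Δ m
  subst hY
  refine (𝒯.isWObject A B).induction hχ (fun Δ m a φ hmem hφ hm ih => ?_) m
  obtain ⟨ha, hh⟩ := (LFam.mem_code A B (m ≫ pullback.fst (𝒯.W A B).cls (𝒯.W A B).proj) a φ.h).1
    (by rwa [Category.assoc])
  have hf := LFam.branch_proj (Y := 𝒯.W A B) φ hφ
  have h1 := hc Δ _ (LFam.node (A := A) (B := B) (Y := 𝒯.W A B) _ a ha
    (φ.map (pullback.snd (𝒯.W A B).cls (𝒯.W A B).proj)) hh hf)
  have e1 := LFam.pair_branch (Y := 𝒯.W A B) φ (ha := ha) (hh := hh) hφ hf rfl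
  have e2 := 𝒯.pair_sup_eq (A := A) (B := B) ha
    (φ.map (pullback.snd (𝒯.W A B).cls (𝒯.W A B).proj)) hh hf rfl m rfl
    (hm.trans (congrArg _ (φ.map_map _ _).symm))
  exact e2 ▸ h1 (e1.symm ▸ ih)

section Elim

variable {Γ : E} {A : LFam Γ} {B : LFam (pullback A.cls A.proj)}
  {D : LFam (pullback (𝒯.W A B).cls (𝒯.W A B).proj)}
  (d : Step (𝒞 := ofTopos E) 𝒯.wIntro (Γ := Γ) (A := A) (B := B) (Y := 𝒯.W A B) rfl D)

/-- Inputs of the recursion. -/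
abbrev ElimInput (D : LFam (pullback (𝒯.W A B).cls (𝒯.W A B).proj)) {Δ : E} (σ : Δ ⟶ Γ)
    (a : Δ ⟶ A.tot) (φ : Fam B.proj (pullback D.cls D.proj) Δ) : Prop :=
  Input (pullback.fst D.cls D.proj) (A.code B) (pullback.fst (𝒯.W A B).cls (𝒯.W A B).proj) σ a φ

theorem ElimInput.branch_proj {Δ : E} {σ : Δ ⟶ Γ} {a : Δ ⟶ A.tot}
    {φ : Fam B.proj (pullback D.cls D.proj) Δ} (h : ElimInput 𝒯 D σ a φ) :
    ((φ.map (pullback.fst D.cls D.proj)).map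
      (pullback.snd (𝒯.W A B).cls (𝒯.W A B).proj)).f ≫ (𝒯.W A B).proj =
      (pullback.fst φ.h B.proj ≫ σ) ≫ (𝒯.W A B).cls :=
  LFam.branch_proj (Y := 𝒯.W A B) _ ((Category.assoc _ _ _).trans h.f_comp)

/-- The node underlying an input of the recursion. -/
noncomputable def ElimInput.node {Δ : E} {σ : Δ ⟶ Γ} {a : Δ ⟶ A.tot}
    {φ : Fam B.proj (pullback D.cls D.proj) Δ} (h : ElimInput 𝒯 D σ a φ) :
    (ofTopos E).Node (Γ := Γ) A B (𝒯.W A B) σ :=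
  LFam.node σ a ((LFam.mem_code A B σ a φ.h).1 h.mem).1
    ((φ.map (pullback.fst D.cls D.proj)).map (pullback.snd (𝒯.W A B).cls (𝒯.W A B).proj))
    ((LFam.mem_code A B σ a φ.h).1 h.mem).2 (ElimInput.branch_proj 𝒯 h)

/-- The inductive data underlying an input of the recursion. -/
noncomputable def ElimInput.ih {Δ : E} {σ : Δ ⟶ Γ} {a : Δ ⟶ A.tot}
    {φ : Fam B.proj (pullback D.cls D.proj) Δ} (_ : ElimInput 𝒯 D σ a φ) :
    LElt (pullback φ.h B.proj) where
  fam := D.sub (φ.f ≫ pullback.fst _ _)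
  el := φ.f ≫ pullback.snd _ _
  el_proj := (Category.assoc _ _ _).trans ((congrArg (φ.f ≫ ·) pullback.condition.symm).trans
    (Category.assoc _ _ _).symm)

theorem ElimInput.tp_ih {Δ : E} {σ : Δ ⟶ Γ} {a : Δ ⟶ A.tot}
    {φ : Fam B.proj (pullback D.cls D.proj) Δ} (h : ElimInput 𝒯 D σ a φ) :
    (ElimInput.ih 𝒯 h).fam = D.sub
      ((ofTopos E).pair ((ofTopos E).disp (ElimInput.node 𝒯 h).T ≫ σ) (𝒯.W A B) (ElimInput.node 𝒯 h).branch
      (ElimInput.node 𝒯 h).tp_branch) :=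
  congrArg (fun k => LFam.sub k D) (LFam.pair_branch (Y := 𝒯.W A B)
    (φ.map (pullback.fst D.cls D.proj)) ((Category.assoc _ _ _).trans h.f_comp)
      (ElimInput.branch_proj 𝒯 h) rfl).symm

theorem ElimInput.node_res {Δ : E} {σ : Δ ⟶ Γ} {a : Δ ⟶ A.tot}
    {φ : Fam B.proj (pullback D.cls D.proj) Δ} (h : ElimInput 𝒯 D σ a φ) {Θ : E} (θ : Θ ⟶ Δ) :
    (ElimInput.node 𝒯 h).restrict θ =
      ElimInput.node 𝒯 (Input.res h θ : ElimInput 𝒯 D (θ ≫ σ) (θ ≫ a) (φ.res θ)) :=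
  LFam.node_restrict_eq _ _ _ _ _ _ _ ((Fam.map_res _ _ _).trans
    (congrArg (Fam.map · _) (Fam.map_res _ _ _))) _ _ _

theorem ElimInput.ih_res {Δ : E} {σ : Δ ⟶ Γ} {a : Δ ⟶ A.tot}
    {φ : Fam B.proj (pullback D.cls D.proj) Δ} (h : ElimInput 𝒯 D σ a φ) {Θ : E} (θ : Θ ⟶ Δ) :
    (ElimInput.ih 𝒯 h).sub ((ofTopos E).wk θ (ElimInput.node 𝒯 h).T) =
      ElimInput.ih 𝒯 (Input.res h θ : ElimInput 𝒯 D (θ ≫ σ) (θ ≫ a) (φ.res θ)) := by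
  have e : (ofTopos E).wk θ (ElimInput.node 𝒯 h).T ≫ φ.f = (φ.res θ).f :=
    congrArg (· ≫ φ.f) (ofTopos_wk_eq _ _)
  refine LElt.ext_of (congrArg (LFam.mk D.proj) ?_) (heq_of_eq ?_)
  · refine (Category.assoc _ _ _).symm.trans (congrArg (· ≫ D.cls) ?_)
    exact (Category.assoc _ _ _).symm.trans (congrArg (· ≫ pullback.fst _ _) e)
  · exact (Category.assoc _ _ _).symm.trans (congrArg (· ≫ pullback.snd _ _) e)

/-- The recursion step given by the premise of `W`-elimination. -/
noncomputable def recStep : RecStep (U := 𝒯.U A.tot B.proj) (pullback.fst D.cls D.proj) (A.code B)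
    (pullback.fst (𝒯.W A B).cls (𝒯.W A B).proj)
    (pullback.snd (𝒯.W A B).cls (𝒯.W A B).proj ≫ 𝒯.val A.tot B.proj) where
  run σ a φ h := (ofTopos E).pair _ D
    (d.run σ (ElimInput.node 𝒯 h) (ElimInput.ih 𝒯 h) (ElimInput.tp_ih 𝒯 h)) (d.tp_run _ _ _ _)
  run_p σ a φ h := (Category.assoc _ _ _).symm.trans
    ((congrArg (· ≫ pullback.fst _ _) ((ofTopos E).pair_disp _ D _ _)).trans
      ((ofTopos E).pair_disp _ _ _ _))
  run_x σ a φ h := (Category.assoc _ _ _).symm.trans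
    ((congrArg (· ≫ pullback.snd _ _ ≫ _) ((ofTopos E).pair_disp _ D _ _)).trans
      ((𝒯.pair_sup_val _ _ _ _ _).trans (congrArg _
        ((Fam.map_map _ _ _).trans (Fam.map_map _ _ _)))))
  comp_run σ a φ h Θ θ := by
    refine comp_pair _ _ _ _ _ _ ?_ _ ?_ _
    · refine Eq.trans ?_ (d.run_restrict σ (ElimInput.node 𝒯 h) (ElimInput.ih 𝒯 h)
        (ElimInput.tp_ih 𝒯 h) θ).symm
      have e := ElimInput.node_res 𝒯 h θ
      exact d.run_congr rfl (congrArg Node.label e.symm) (congrArg Node.T e.symm)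
        (by rw [e]) (heq_of_eq (ElimInput.ih_res 𝒯 h θ).symm) _ _
    · refine (comp_pair _ _ _ _ _ _ ?_ _ rfl _).symm
      refine Eq.trans ?_ (𝒯.sup_restrict rfl (ElimInput.node 𝒯 h) θ).symm
      exact congrArg (𝒯.sup rfl) (ElimInput.node_res 𝒯 h θ).symm

/-- Recursion gives a section of the comprehension of `D` over that of the W-type; the eliminator is
the generic element of `D` re-indexed along the section. -/
theorem exists_elim : ∃ e : LElt (pullback (𝒯.W A B).cls (𝒯.W A B).proj), ∃ he : e.fam = D,
    ∀ {Δ : E} (σ : Δ ⟶ Γ) (n : (ofTopos E).Node (Γ := Γ) A B (𝒯.W A B) σ),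
      e.sub ((ofTopos E).pair σ (𝒯.W A B) (𝒯.sup rfl n) rfl) =
        d.run σ n
          (e.sub ((ofTopos E).pair ((ofTopos E).disp n.T ≫ σ) (𝒯.W A B) n.branch n.tp_branch))
          (congrArg (fun D => LFam.sub _ D) he) := by
  obtain ⟨s, hs, h⟩ := (recStep 𝒯 d).exists_section (𝒯.isWObject A B)
  have he : (ofTopos E).tp ((ofTopos E).tmSub s ((ofTopos E).var D)) = D :=
    ((ofTopos E).tySub_comp s _ D).symm.trans
      ((congrArg (fun k => LFam.sub k D) hs).trans ((ofTopos E).tySub_id D))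
  refine ⟨_, he, fun {Δ} σ n => ?_⟩
  obtain ⟨a, ha, φ, hh, hf, rfl⟩ := LFam.exists_node σ n
  let b : pullback φ.h B.proj ⟶ pullback (𝒯.W A B).cls (𝒯.W A B).proj :=
    pullback.lift (pullback.fst _ _ ≫ σ) φ.f hf.symm
  let m : Δ ⟶ pullback (𝒯.W A B).cls (𝒯.W A B).proj :=
    (ofTopos E).pair σ (𝒯.W A B) (𝒯.sup rfl (LFam.node σ a ha φ hh hf)) rfl
  have hm : m ≫ pullback.fst _ _ = σ := (ofTopos E).pair_disp _ _ _ _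
  -- Recursion runs on the comprehension of the W-type over `Γ`, whereas the branches of a node lie
  -- in its local universe; `b` adds the component in `Γ`.
  let ψ : Fam B.proj (pullback (𝒯.W A B).cls (𝒯.W A B).proj) Δ := ⟨φ.h, b⟩
  have hψ : ψ.map (pullback.snd _ _) = φ := by
    simp only [ψ, Fam.map, b, pullback.lift_snd]
  have hψs : (ψ.map s).f ≫ pullback.fst D.cls D.proj = b := by
    change (b ≫ s) ≫ pullback.fst _ _ = b
    rw [Category.assoc, hs, Category.comp_id]
  have hin : ElimInput 𝒯 D (m ≫ pullback.fst _ _) a (ψ.map s) := by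
    rw [hm]
    refine ⟨(LFam.mem_code A B σ a φ.h).2 ⟨ha, hh⟩, ?_⟩
    rw [← Category.assoc, hψs]
    exact pullback.lift_fst _ _ _
  have key := h m a ψ ((𝒯.pair_sup_val ha φ hh hf rfl).trans (congrArg _
    ((congrArg (Fam.map · _) hψ.symm).trans (Fam.map_map _ _ _)))) hin
  refine ((ofTopos E).tmSub_comp m s _).symm.trans
    ((congrArg ((ofTopos E).tmSub · ((ofTopos E).var D)) key).trans
      (((ofTopos E).pair_var _ D _ _).trans ?_))
  have hb : (ofTopos E).pair (pullback.fst φ.h B.proj ≫ σ) (𝒯.W A B)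
      (LFam.node (Y := 𝒯.W A B) σ a ha φ hh hf).branch rfl = b :=
    ofTopos_pair_eq _ _ _ _ _
  have hih : ElimInput.ih 𝒯 hin = LElt.sub b ((ofTopos E).tmSub s ((ofTopos E).var D)) := by
    refine LElt.ext_of ?_ (heq_of_eq (Category.assoc _ _ _))
    exact (congrArg (fun k => LFam.sub k D) hψs).trans (congrArg (LFam.sub b) he.symm)
  have hbr : (ElimInput.node 𝒯 hin).branch =
      (⟨(𝒯.W A B).sub (pullback.fst φ.h B.proj ≫ σ), φ.f, hf⟩ : LElt (pullback φ.h B.proj)) := by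
    refine LElt.ext_of (congrArg (LFam.mk (𝒯.W A B).proj) ?_) (heq_of_eq ?_)
    · exact congrArg (fun k => (pullback.fst φ.h B.proj ≫ k) ≫ (𝒯.W A B).cls) hm
    · exact (congrArg (· ≫ pullback.snd _ _) hψs).trans (pullback.lift_snd _ _ _)
  exact d.run_congr hm (LElt.ext_of (congrArg (LFam.mk A.proj) (congrArg (· ≫ A.cls) hm)) HEq.rfl)
    rfl (heq_of_eq hbr) (heq_of_eq (hih.trans (congrArg (fun k => LElt.sub k _) hb.symm))) _ _

end Elim

theorem nonempty_wTypes (𝒯 : Trees E) : Nonempty (ofTopos E).WTypes := by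
  have h : ∀ {Γ : E} {A : LFam Γ} {B : LFam (pullback A.cls A.proj)} {Y : LFam Γ}
      (hY : Y = 𝒯.W A B) (D : (ofTopos E).Ty ((ofTopos E).ext Y))
      (d : Step (𝒞 := ofTopos E) 𝒯.wIntro (Γ := Γ) (A := A) (B := B) (Y := Y) hY D),
      ∃ e : (ofTopos E).Tm ((ofTopos E).ext Y), ∃ he : (ofTopos E).tp e = D,
        ∀ {Δ : E} (σ : Δ ⟶ Γ) (n : (ofTopos E).Node (Γ := Γ) A B Y σ),
          (ofTopos E).tmSub ((ofTopos E).pair σ Y (𝒯.wIntro.sup hY σ n) (𝒯.wIntro.tp_sup hY σ n))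
            e = d.run σ n ((ofTopos E).tmSub
              ((ofTopos E).pair ((ofTopos E).disp n.T ≫ σ) Y n.branch n.tp_branch) e)
              (((ofTopos E).tp_sub _ _).trans (congrArg _ he)) := by
    intro Γ A B Y hY D d
    subst hY
    exact 𝒯.exists_elim d
  choose elim tp_elim elim_sup using @h
  refine ⟨{ 𝒯.wIntro with
    elim := elim
    tp_elim := tp_elim
    elim_sup := elim_sup
    elim_sub := fun {Γ A B Y} hY D d {Δ} σ => ?_ }⟩
  -- The eliminators were chosen arbitrarily, so stability cannot be read off from their
  -- construction.
  refine HasInduction.elim_unique 𝒯.hasInduction (d.reindex σ) ?_ (tp_elim _ _ _) ?_ fun σ n _ =>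
    elim_sup _ _ _ σ n
  · rw [(ofTopos E).tp_sub, tp_elim hY D d]
  · intro Θ τ n hu
    exact d.reindex_elim (tp_elim hY D d) (elim_sup hY D d) σ τ n _ hu


end Trees

end WTypesOfTopos

end CwF

/-! ### Case distinction, minimum and truncated subtraction on the positive cone. -/

namespace OrderedCommRingObj

open KripkeJoyal
open scoped CommRingObj

section Order

variable {E : Type u} [Category.{v} E] [CartesianMonoidalCategory E] [BraidedCategory E]
  [HasPullbacks E] {R : OrderedCommRingObj E}

theorem comp_sub {X Y : E} (f : X ⟶ Y) (i j : Y ⟶ R.R) : f ≫ (i - j) = f ≫ i - f ≫ j := by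
  rw [sub_eq_add_neg, sub_eq_add_neg, AddMonObj.comp_add, AddGrpObj.comp_neg]

theorem PLe.comp {X Y : E} {i j : X ⟶ R.Pos} (h : R.PLe i j) (u : Y ⟶ X) :
    R.PLe (u ≫ i) (u ≫ j) := by
  have := Subobject.factors_of_factors_right u h
  rwa [comp_lift, ← Category.assoc, ← Category.assoc] at this

theorem PLe.refl {X : E} (i : X ⟶ R.Pos) : R.PLe i i := R.le_refl _

theorem PLe.antisymm {X : E} {i j : X ⟶ R.Pos} (h : R.PLe i j) (h' : R.PLe j i) : i = j :=
  R.incl_cancel (R.le_antisymm _ _ h h')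

theorem le_lift_zero_incl {X : E} (i : X ⟶ R.Pos) : R.le.Factors (lift 0 (i ≫ R.incl)) := by
  have h : R.posSub.Factors (i ≫ R.incl) := Subobject.factors_comp_arrow i
  rwa [posSub, pullback_factors_iff, comp_lift, comp_zero', Category.comp_id] at h

theorem pzero_ple {X : E} (i : X ⟶ R.Pos) : R.PLe (R.pzero X) i := by
  rw [PLe, pzero_incl]
  exact le_lift_zero_incl i

theorem exists_pos {X : E} {i : X ⟶ R.R} (h : R.le.Factors (lift 0 i)) :
    ∃ m : X ⟶ R.Pos, m ≫ R.incl = i := by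
  have h' : R.posSub.Factors i := by
    rwa [posSub, pullback_factors_iff, comp_lift, comp_zero', Category.comp_id]
  exact ⟨R.posSub.factorThru i h', Subobject.factorThru_arrow _ _ _⟩

theorem le_lift_zero_sub {X : E} {i j : X ⟶ R.R} :
    R.le.Factors (lift 0 (i - j)) ↔ R.le.Factors (lift j i) := by
  refine ⟨fun h => ?_, fun h => ?_⟩
  · have := R.add_le_add _ _ j h
    rwa [add_zero, add_sub_cancel] at this
  · have := R.add_le_add _ _ (-j) h
    rwa [neg_add_cancel, neg_add_eq_sub] at this

end Order

section Cases

variable {E : Type u} [Category.{v} E] [CartesianMonoidalCategory E] [BraidedCategory E]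
  [HasFiniteLimits E] {R : OrderedCommRingObj E}

theorem isRep_ple {X : E} (i j : X ⟶ R.Pos) :
    IsRep (fun Δ (u : Δ ⟶ X) => R.PLe (u ≫ i) (u ≫ j)) :=
  ((isRep_factors R.le).comp (lift (i ≫ R.incl) (j ≫ R.incl))).congr fun Δ u => by
    rw [comp_lift, PLe, Category.assoc, Category.assoc]

variable [MonoidalClosed E] [HasSubobjectClassifier E]

/-- Case distinction: a representable predicate holds if it holds where `i ≤ j` and where
`j ≤ i`. -/
theorem ple_cases {X : E} {φ : Pred X} (hφ : IsRep φ) (i j : X ⟶ R.Pos)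
    (h1 : ∀ (Y : E) (u : Y ⟶ X), R.PLe (u ≫ i) (u ≫ j) → φ Y u)
    (h2 : ∀ (Y : E) (u : Y ⟶ X), R.PLe (u ≫ j) (u ≫ i) → φ Y u) : φ X (𝟙 X) := by
  let c : X ⟶ R.R ⊗ R.R := lift (i ≫ R.incl) (j ≫ R.incl)
  -- Totality concerns subobjects of `R ⊗ R` only. So `φ` is moved there by universal quantification
  -- along `c`, right adjoint to pullback: the result contains the order and its opposite, hence
  -- everything.
  have hψ : IsRep (Γ := R.R ⊗ R.R) (fun Δ k => ∀ (Θ : E) (θ : Θ ⟶ Δ) (y : Θ ⟶ X),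
      y ≫ c = θ ≫ k → φ Θ y) :=
    isRep_all_imp (K := X) (Φ := fun _ k y => y ≫ c = k) (Ψ := fun Δ _ y => φ Δ y)
      ((isRep_eq (snd _ X ≫ c) (fst _ _)).congr fun _ _ => by rw [Category.assoc])
      (hφ.comp (snd _ _))
  obtain ⟨S, hS⟩ := hψ.subobject
  have hle : ∀ P : Subobject (R.R ⊗ R.R), (∀ (Y : E) (y : Y ⟶ X), P.Factors (y ≫ c) → φ Y y) →
      P ≤ S := by
    intro P hP
    refine Subobject.le_of_comm (S.factorThru P.arrow ((hS _ _).1 fun Θ θ y hy => hP _ _ ?_))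
      (S.factorThru_arrow _ _)
    rw [hy]
    exact Subobject.factors_comp_arrow θ
  have htop : (⊤ : Subobject (R.R ⊗ R.R)) ≤ S := by
    refine R.le_total.2 ?_
    rintro P (rfl | rfl)
    · refine hle _ fun Y y hy => h1 Y y ?_
      rwa [comp_lift, ← Category.assoc, ← Category.assoc] at hy
    · refine hle _ fun Y y hy => h2 Y y ?_
      rw [pullback_factors_iff, comp_lift, comp_lift] at hy
      simpa [PLe] using hy
  have := (hS _ c).2 (Subobject.factors_of_le _ htop (Subobject.top_factors c))
  exact this _ (𝟙 X) (𝟙 X) rfl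

theorem hom_ext_cases {X K : E} {f g : X ⟶ K} (i j : X ⟶ R.Pos)
    (h1 : ∀ (Y : E) (u : Y ⟶ X), R.PLe (u ≫ i) (u ≫ j) → u ≫ f = u ≫ g)
    (h2 : ∀ (Y : E) (u : Y ⟶ X), R.PLe (u ≫ j) (u ≫ i) → u ≫ f = u ≫ g) : f = g := by
  have := ple_cases (isRep_eq f g) i j h1 h2
  rwa [Category.id_comp, Category.id_comp] at this

/-- Definition by cases: `m` is `f` where `i ≤ j` and is `g` where `j ≤ i`. -/
def IsCases {X K L : E} (ι : K ⟶ L) (i j : X ⟶ R.Pos) (f g : X ⟶ L) (m : X ⟶ K) : Prop :=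
  ∀ ⦃Y : E⦄ (u : Y ⟶ X), (R.PLe (u ≫ i) (u ≫ j) → u ≫ m ≫ ι = u ≫ f) ∧
    (R.PLe (u ≫ j) (u ≫ i) → u ≫ m ≫ ι = u ≫ g)

omit [MonoidalClosed E] [HasSubobjectClassifier E] in
theorem IsCases.comp {X K L : E} {ι : K ⟶ L} {i j : X ⟶ R.Pos} {f g : X ⟶ L} {m : X ⟶ K}
    (h : IsCases ι i j f g m) {Y : E} (u : Y ⟶ X) :
    IsCases ι (u ≫ i) (u ≫ j) (u ≫ f) (u ≫ g) (u ≫ m) := fun Z v => by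
  have := h (v ≫ u)
  simpa only [Category.assoc] using this

theorem IsCases.unique {X K L : E} {ι : K ⟶ L} [Mono ι] {i j : X ⟶ R.Pos} {f g : X ⟶ L}
    {m m' : X ⟶ K} (h : IsCases ι i j f g m) (h' : IsCases ι i j f g m') : m = m' := by
  refine (cancel_mono ι).1 (hom_ext_cases i j (fun Y u hu => ?_) fun Y u hu => ?_)
  · rw [(h u).1 hu, (h' u).1 hu]
  · rw [(h u).2 hu, (h' u).2 hu]

/-- The value is unique by case distinction, and its unique existence is representable, so it too
may be proved by cases. The monomorphism `ι` allows formulas that land in `K` only where their case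
applies. -/
theorem exists_isCases {X K L : E} (ι : K ⟶ L) [Mono ι] (i j : X ⟶ R.Pos) (f g : X ⟶ L)
    (hf : ∀ ⦃Y : E⦄ (u : Y ⟶ X), R.PLe (u ≫ i) (u ≫ j) → ∃ m : Y ⟶ K, m ≫ ι = u ≫ f)
    (hg : ∀ ⦃Y : E⦄ (u : Y ⟶ X), R.PLe (u ≫ j) (u ≫ i) → ∃ m : Y ⟶ K, m ≫ ι = u ≫ g)
    (hfg : ∀ ⦃Y : E⦄ (u : Y ⟶ X), u ≫ i = u ≫ j → u ≫ f = u ≫ g) :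
    ∃ m : X ⟶ K, IsCases ι i j f g m := by
  let Φ : ∀ Δ : E, (Δ ⟶ X) → (Δ ⟶ K) → Prop := fun Δ u m =>
    IsCases ι (u ≫ i) (u ≫ j) (u ≫ f) (u ≫ g) m
  have hΦ : IsRep (Γ := X ⊗ K) (fun Δ σ => Φ Δ (σ ≫ fst _ _) (σ ≫ snd _ _)) := by
    refine ((IsRep.imp (isRep_ple (fst X K ≫ i) (fst _ _ ≫ j)) (isRep_eq (snd X K ≫ ι)
      (fst X K ≫ f))).and (IsRep.imp (isRep_ple (fst X K ≫ j) (fst _ _ ≫ i))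
      (isRep_eq (snd X K ≫ ι) (fst X K ≫ g)))).congr fun Δ σ => ?_
    simp only [Φ, IsCases, Category.assoc]
    exact ⟨fun H Y u => ⟨H.1 Y u, H.2 Y u⟩, fun H => ⟨fun Y u => (H u).1, fun Y u => (H u).2⟩⟩
  have key : ∀ {Y : E} (u : Y ⟶ X) (m : Y ⟶ K), Φ Y u m →
      ∃ k : Y ⟶ K, ∀ (Θ : E) (θ : Θ ⟶ Y) (k' : Θ ⟶ K), Φ Θ (θ ≫ u) k' ↔ k' = θ ≫ k := by
    refine fun u m hm => ⟨m, fun Θ θ k' => ⟨fun h => ?_, ?_⟩⟩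
    · exact IsCases.unique h (by simpa only [Category.assoc] using hm.comp θ)
    · rintro rfl
      simpa only [Φ, Category.assoc] using hm.comp θ
  have := ple_cases (isRep_existsUnique hΦ) i j (fun Y u hu => ?_) fun Y u hu => ?_
  · obtain ⟨k, hk⟩ := this
    have := (hk _ (𝟙 X) (𝟙 X ≫ k)).2 rfl
    simp only [Φ, Category.id_comp] at this
    exact ⟨k, this⟩
  · obtain ⟨m, hm⟩ := hf u hu
    refine key u m fun Z v => ⟨fun _ => by rw [hm], fun h => ?_⟩
    rw [hm]
    have := hfg (v ≫ u) (by simpa only [Category.assoc] using (hu.comp v).antisymm h)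
    simpa only [Category.assoc] using this
  · obtain ⟨m, hm⟩ := hg u hu
    refine key u m fun Z v => ⟨fun h => ?_, fun _ => by rw [hm]⟩
    rw [hm]
    have := hfg (v ≫ u) (by simpa only [Category.assoc] using h.antisymm (hu.comp v))
    simpa only [Category.assoc] using this.symm

theorem exists_pmin {X : E} (i j : X ⟶ R.Pos) :
    ∃ m : X ⟶ R.Pos, IsCases (𝟙 R.Pos) i j i j m :=
  exists_isCases _ i j i j (fun _ u _ => ⟨u ≫ i, Category.comp_id _⟩)
    (fun _ u _ => ⟨u ≫ j, Category.comp_id _⟩) fun _ _ h => h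

/-- The minimum. -/
noncomputable def pmin {X : E} (i j : X ⟶ R.Pos) : X ⟶ R.Pos := (exists_pmin i j).choose

theorem comp_pmin {X Y : E} (u : Y ⟶ X) (i j : X ⟶ R.Pos) :
    u ≫ pmin i j = pmin (u ≫ i) (u ≫ j) :=
  ((exists_pmin i j).choose_spec.comp u).unique (exists_pmin _ _).choose_spec

theorem pmin_eq_left {X : E} {i j : X ⟶ R.Pos} (h : R.PLe i j) : pmin i j = i := by
  have := ((exists_pmin i j).choose_spec (𝟙 X)).1 (by simpa only [Category.id_comp] using h)
  simpa only [Category.id_comp, Category.comp_id, pmin] using this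

theorem pmin_eq_right {X : E} {i j : X ⟶ R.Pos} (h : R.PLe j i) : pmin i j = j := by
  have := ((exists_pmin i j).choose_spec (𝟙 X)).2 (by simpa only [Category.id_comp] using h)
  simpa only [Category.id_comp, Category.comp_id, pmin] using this

theorem pmin_self {X : E} (i : X ⟶ R.Pos) : pmin i i = i := pmin_eq_left (PLe.refl i)

instance : Mono R.incl := inferInstanceAs (Mono R.posSub.arrow)

/-- The difference is formed in the ring, since it lies in the positive cone only where `j ≤ i`. -/
theorem exists_psub {X : E} (i j : X ⟶ R.Pos) :
    ∃ m : X ⟶ R.Pos, IsCases R.incl i j 0 (i ≫ R.incl - j ≫ R.incl) m := by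
  refine exists_isCases _ i j _ _ (fun Y u _ => ⟨R.pzero Y, ?_⟩) (fun Y u h => ?_) fun _ u h => ?_
  · rw [pzero_incl, comp_zero']
  · refine exists_pos ?_
    rw [comp_sub, le_lift_zero_sub, ← Category.assoc, ← Category.assoc]
    exact h
  · rw [comp_sub, ← Category.assoc, ← Category.assoc, h, sub_self, comp_zero']

/-- Truncated subtraction. -/
noncomputable def psub {X : E} (i j : X ⟶ R.Pos) : X ⟶ R.Pos := (exists_psub i j).choose

theorem comp_psub {X Y : E} (u : Y ⟶ X) (i j : X ⟶ R.Pos) :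
    u ≫ psub i j = psub (u ≫ i) (u ≫ j) := by
  refine IsCases.unique ?_ (exists_psub _ _).choose_spec
  have := (exists_psub i j).choose_spec.comp u
  rwa [comp_sub, comp_zero', ← Category.assoc, ← Category.assoc] at this

theorem psub_eq_pzero {X : E} {i j : X ⟶ R.Pos} (h : R.PLe i j) : psub i j = R.pzero X := by
  have := ((exists_psub i j).choose_spec (𝟙 X)).1 (by simpa only [Category.id_comp] using h)
  rw [Category.id_comp, Category.id_comp] at this
  exact R.incl_cancel (this.trans (R.pzero_incl X).symm)

theorem psub_eq {X : E} {i j m : X ⟶ R.Pos} (h : m ≫ R.incl = i ≫ R.incl - j ≫ R.incl) :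
    psub i j = m := by
  have hji : R.PLe j i := by
    rw [PLe, ← le_lift_zero_sub, ← h]
    exact le_lift_zero_incl m
  have := ((exists_psub i j).choose_spec (𝟙 X)).2 (by simpa only [Category.id_comp] using hji)
  rw [Category.id_comp, Category.id_comp] at this
  exact R.incl_cancel (this.trans h.symm)

theorem psub_self {X : E} (i : X ⟶ R.Pos) : psub i i = R.pzero X := psub_eq_pzero (PLe.refl i)

theorem psub_pzero {X : E} (i : X ⟶ R.Pos) : psub i (R.pzero X) = i :=
  psub_eq (by rw [pzero_incl, sub_zero])

end Cases

end OrderedCommRingObj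

/-! ### Contraction and reversal of Moore paths. -/

namespace MPath

open KripkeJoyal OrderedCommRingObj

section Paths

variable {E : Type u} [Category.{v} E] [CartesianMonoidalCategory E] [BraidedCategory E]
  [HasPullbacks E] {R : OrderedCommRingObj E} {Γ X : E}

theorem comp_app (p : MPath R Γ X) {Y Z : E} (v : Z ⟶ Y) (u : Y ⟶ X) (j : Y ⟶ R.Pos) :
    v ≫ p.app u j = p.app (v ≫ u) (v ≫ j) := by
  rw [app, app, ← comp_lift, Category.assoc]

theorem app_fst_snd (p : MPath R Γ X) : p.app (fst X R.Pos) (snd X R.Pos) = p.fn := by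
  rw [app, lift_fst_snd, Category.id_comp]

theorem ext_of_app {p q : MPath R Γ X} (h : p.shape = q.shape)
    (h' : ∀ {Y : E} (u : Y ⟶ X) (j : Y ⟶ R.Pos), p.app u j = q.app u j) : p = q :=
  MPath.ext (by rw [← app_fst_snd, h', app_fst_snd]) h

theorem app_restrict (p : MPath R Γ X) {Y Z : E} (u : Y ⟶ X) (v : Z ⟶ Y) (j : Z ⟶ R.Pos) :
    (p.restrict u).app v j = p.app (v ≫ u) j := by
  simp only [app, restrict, lift_whiskerRight_assoc]

theorem app_map (p : MPath R Γ X) {Γ' : E} (γ : Γ ⟶ Γ') {Y : E} (u : Y ⟶ X) (j : Y ⟶ R.Pos) :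
    (p.map γ).app u j = p.app u j ≫ γ := (Category.assoc _ _ _).symm

theorem app_idp (x : X ⟶ Γ) {Y : E} (u : Y ⟶ X) (j : Y ⟶ R.Pos) :
    (idp R x).app u j = u ≫ x := by
  simp [app, idp]

theorem app_of_ple (p : MPath R Γ X) {Y : E} {u : Y ⟶ X} {j : Y ⟶ R.Pos}
    (h : R.PLe (u ≫ p.shape) j) : p.app u j = p.app u (u ≫ p.shape) := p.const u j h

theorem comp_src (p : MPath R Γ X) {Y : E} (u : Y ⟶ X) : u ≫ p.src = p.app u (R.pzero Y) := by
  rw [src, comp_app, Category.comp_id, comp_pzero]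

theorem restrict_id (p : MPath R Γ X) : p.restrict (𝟙 X) = p :=
  ext_of_app (Category.id_comp _) fun u j => by rw [app_restrict, Category.comp_id]

theorem restrict_restrict (p : MPath R Γ X) {Y Z : E} (u : Y ⟶ X) (v : Z ⟶ Y) :
    (p.restrict u).restrict v = p.restrict (v ≫ u) :=
  ext_of_app (Category.assoc _ _ _).symm fun w j => by
    rw [app_restrict, app_restrict, app_restrict, Category.assoc]

theorem restrict_idp (x : X ⟶ Γ) {Y : E} (u : Y ⟶ X) :
    (idp R x).restrict u = idp R (u ≫ x) :=
  ext_of_app (R.comp_pzero u) fun w j => by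
    rw [app_restrict, app_idp, app_idp, Category.assoc]

/-- Every index lies beyond a shape equal to zero, and there paths are constant. This recognizes
degenerate paths below. -/
theorem eq_idp {p : MPath R Γ X} (h : p.shape = R.pzero X) : p = idp R p.src :=
  ext_of_app h fun u j => by
    rw [app_idp, comp_src, p.app_of_ple (by rw [h, comp_pzero]; exact pzero_ple j), h, comp_pzero]

end Paths

section Operations

variable {E : Type u} [Category.{v} E] [CartesianMonoidalCategory E] [BraidedCategory E]
  [HasFiniteLimits E] [MonoidalClosed E] [HasSubobjectClassifier E]
  {R : OrderedCommRingObj E} {Γ X : E}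

theorem app_pmin (p : MPath R Γ X) {Y : E} (u : Y ⟶ X) (j : Y ⟶ R.Pos) :
    p.app u (pmin j (u ≫ p.shape)) = p.app u j := by
  refine hom_ext_cases j (u ≫ p.shape) (fun Z v h => ?_) fun Z v h => ?_
  · rw [comp_app, comp_app, comp_pmin, pmin_eq_left h]
  · rw [comp_app, comp_app, comp_pmin, pmin_eq_right h, ← Category.assoc]
    exact (p.app_of_ple (by rwa [Category.assoc])).symm

/-- The contraction of a path up to `i`. -/
noncomputable def upto (p : MPath R Γ X) (i : X ⟶ R.Pos) : MPath R Γ X where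
  fn := p.app (fst X R.Pos) (pmin (snd _ _) (fst _ _ ≫ pmin p.shape i))
  shape := pmin p.shape i
  const u j h := by
    simp only [comp_app, comp_pmin (lift _ _), lift_fst, lift_snd, lift_fst_assoc]
    rw [pmin_self, pmin_eq_right h]

theorem app_upto (p : MPath R Γ X) (i : X ⟶ R.Pos) {Y : E} (u : Y ⟶ X) (k : Y ⟶ R.Pos) :
    (p.upto i).app u k = p.app u (pmin k (u ≫ pmin p.shape i)) := by
  rw [app, upto, comp_app, comp_pmin, lift_fst, lift_snd, lift_fst_assoc]

/-- Contraction depends on its bound only through the minimum with the shape; this makes lifted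
paths constant beyond `|p|`. -/
theorem upto_congr (p : MPath R Γ X) {i j : X ⟶ R.Pos} (h : pmin p.shape i = pmin p.shape j) :
    p.upto i = p.upto j :=
  ext_of_app h fun u k => by rw [app_upto, app_upto, h]

theorem isUpto_upto (p : MPath R Γ X) (i : X ⟶ R.Pos) : p.IsUpto i (p.upto i) := by
  refine ⟨fun Y u => ⟨fun h => ?_, fun h => ?_⟩, fun Y u k h => ?_⟩
  · exact (comp_pmin _ _ _).trans (pmin_eq_left h)
  · exact (comp_pmin _ _ _).trans (pmin_eq_right h)
  · rw [app_upto, pmin_eq_left (by exact h)]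

theorem upto_restrict (p : MPath R Γ X) (i : X ⟶ R.Pos) {Y : E} (u : Y ⟶ X) :
    (p.upto i).restrict u = (p.restrict u).upto (u ≫ i) :=
  ext_of_app (comp_pmin _ _ _) fun v k => by
    rw [app_restrict, app_upto, app_upto, app_restrict, Category.assoc, comp_pmin u]
    rfl

theorem upto_map (p : MPath R Γ X) (i : X ⟶ R.Pos) {Γ' : E} (γ : Γ ⟶ Γ') :
    (p.upto i).map γ = (p.map γ).upto i :=
  ext_of_app rfl fun v k => by
    rw [app_map, app_upto, app_upto, app_map]
    rfl

theorem src_upto (p : MPath R Γ X) (i : X ⟶ R.Pos) : (p.upto i).src = p.src := by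
  rw [src, app_upto, pmin_eq_left (pzero_ple _), src]

theorem tgt_upto (p : MPath R Γ X) (i : X ⟶ R.Pos) : (p.upto i).tgt = p.app (𝟙 X) i := by
  have h := p.app_pmin (𝟙 X) i
  rw [tgt, app_upto]
  have e : pmin (p.upto i).shape (𝟙 X ≫ pmin p.shape i) = pmin p.shape i := by
    rw [Category.id_comp]
    exact pmin_self _
  rw [e]
  refine hom_ext_cases p.shape i (fun Y u hu => ?_) fun Y u hu => ?_
  · rw [comp_app, comp_app, comp_pmin, pmin_eq_left hu, Category.comp_id, p.app_of_ple hu]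
  · rw [comp_app, comp_app, comp_pmin, pmin_eq_right hu]

theorem upto_pzero (p : MPath R Γ X) : p.upto (R.pzero X) = idp R p.src := by
  rw [← p.src_upto (R.pzero X)]
  exact eq_idp (pmin_eq_right (pzero_ple _))

theorem upto_shape (p : MPath R Γ X) : p.upto p.shape = p :=
  ext_of_app (pmin_self _) fun u k => by rw [app_upto, pmin_self, app_pmin]

/-- The reverse of a path. -/
noncomputable def rev (p : MPath R Γ X) : MPath R Γ X where
  fn := p.app (fst X R.Pos) (psub (fst _ _ ≫ p.shape) (snd _ _))
  shape := p.shape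
  const u j h := by
    simp only [comp_app, comp_psub (lift _ _), lift_fst, lift_snd, lift_fst_assoc]
    rw [psub_self, psub_eq_pzero h]

theorem app_rev (p : MPath R Γ X) {Y : E} (u : Y ⟶ X) (k : Y ⟶ R.Pos) :
    p.rev.app u k = p.app u (psub (u ≫ p.shape) k) := by
  rw [app, rev, comp_app, comp_psub, lift_fst, lift_snd, lift_fst_assoc]

theorem isRev_rev (p : MPath R Γ X) : p.IsRev p.rev := by
  refine ⟨rfl, fun Y u i => ⟨fun h => ?_, fun m hm => ?_⟩⟩
  · rw [app_rev, psub_eq_pzero h]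
  · rw [app_rev, psub_eq (hm.trans (by rw [Category.assoc]))]

theorem rev_restrict (p : MPath R Γ X) {Y : E} (u : Y ⟶ X) :
    p.rev.restrict u = (p.restrict u).rev :=
  ext_of_app rfl fun v k => by
    rw [app_restrict, app_rev, app_rev, app_restrict, Category.assoc]
    rfl

theorem rev_map (p : MPath R Γ X) {Γ' : E} (γ : Γ ⟶ Γ') : p.rev.map γ = (p.map γ).rev :=
  ext_of_app rfl fun v k => by
    rw [app_map, app_rev, app_rev, app_map]
    rfl

theorem src_rev (p : MPath R Γ X) : p.rev.src = p.tgt := by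
  rw [src, app_rev, psub_pzero, Category.id_comp, tgt]

theorem tgt_rev (p : MPath R Γ X) : p.rev.tgt = p.src := by
  rw [tgt, app_rev, Category.id_comp]
  exact congrArg (p.app (𝟙 X)) (psub_self _)

theorem rev_idp (x : X ⟶ Γ) : (idp R x).rev = idp R x := by
  have h := eq_idp (p := (idp R x).rev) rfl
  rwa [src_rev, tgt_idp] at h

end Operations

end MPath

/-! ### Lifting paths to comprehension objects. -/

namespace Fib

open CwF MPath OrderedCommRingObj

section Lift

variable {E : Type u} [Category.{v} E] [CartesianMonoidalCategory E] [BraidedCategory E]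
  [HasFiniteLimits E] [MonoidalClosed E] [HasSubobjectClassifier E]
  {R : OrderedCommRingObj E} {𝒞 : CwF.{w} E} {Γ : E} (A : Fib 𝒞 R Γ) {X : E}

theorem tp_upto {p : MPath R Γ X} {a : 𝒞.Tm X} (ha : 𝒞.tp a = 𝒞.tySub p.src A.ty)
    {Y : E} (u : Y ⟶ X) (k : Y ⟶ R.Pos) :
    𝒞.tp (𝒞.tmSub u a) = 𝒞.tySub ((p.restrict u).upto k).src A.ty := by
  rw [𝒞.tp_sub, ha, src_upto, src_restrict, 𝒞.tySub_comp]

/-- The value of the lifted path at `k`. -/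
noncomputable def liftApp (p : MPath R Γ X) (a : 𝒞.Tm X) (ha : 𝒞.tp a = 𝒞.tySub p.src A.ty)
    {Y : E} (u : Y ⟶ X) (k : Y ⟶ R.Pos) : Y ⟶ 𝒞.ext A.ty :=
  𝒞.pair (p.app u k) A.ty
    (A.tap.tr ((p.restrict u).upto k) (𝒞.tmSub u a) (A.tp_upto ha u k)) (by
      rw [A.tap.tp_tr, tgt_upto, app_restrict, Category.id_comp])

theorem comp_liftApp (p : MPath R Γ X) (a : 𝒞.Tm X) (ha : 𝒞.tp a = 𝒞.tySub p.src A.ty)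
    {Y Z : E} (v : Z ⟶ Y) (u : Y ⟶ X) (k : Y ⟶ R.Pos) :
    v ≫ A.liftApp p a ha u k = A.liftApp p a ha (v ≫ u) (v ≫ k) := by
  refine comp_pair _ _ _ _ _ _ ?_ _ (p.comp_app v u k).symm _
  rw [A.tap.tr_restrict]
  exact tr_congr _ (by rw [upto_restrict, restrict_restrict]) (𝒞.tmSub_comp _ _ _) _ _

theorem liftApp_of_ple (p : MPath R Γ X) (a : 𝒞.Tm X) (ha : 𝒞.tp a = 𝒞.tySub p.src A.ty)
    {Y : E} (u : Y ⟶ X) (k : Y ⟶ R.Pos) (h : R.PLe (u ≫ p.shape) k) :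
    A.liftApp p a ha u k = A.liftApp p a ha u (u ≫ p.shape) := by
  refine pair_congr (p.app_of_ple h) (tr_congr _ (upto_congr _ ?_) rfl _ _) _ _
  exact (pmin_eq_left h).trans (pmin_self _).symm

/-- The lifting of a path. -/
noncomputable def liftPath (p : MPath R Γ X) (a : 𝒞.Tm X) (ha : 𝒞.tp a = 𝒞.tySub p.src A.ty) :
    MPath R (𝒞.ext A.ty) X where
  fn := A.liftApp p a ha (fst X R.Pos) (snd _ _)
  shape := p.shape
  const u k h := by
    rw [comp_liftApp, comp_liftApp, lift_fst, lift_fst, lift_snd, lift_snd,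
      liftApp_of_ple _ _ _ _ _ _ h]

theorem app_liftPath (p : MPath R Γ X) (a : 𝒞.Tm X) (ha : 𝒞.tp a = 𝒞.tySub p.src A.ty)
    {Y : E} (u : Y ⟶ X) (k : Y ⟶ R.Pos) :
    (A.liftPath p a ha).app u k = A.liftApp p a ha u k := by
  rw [app, liftPath, comp_liftApp, lift_fst, lift_snd]

theorem isLift_liftPath (p : MPath R Γ X) (a : 𝒞.Tm X) (ha : 𝒞.tp a = 𝒞.tySub p.src A.ty) :
    A.IsLift p a (A.liftPath p a ha) := by
  refine ⟨rfl, fun Y u k _ => ?_⟩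
  rw [app_liftPath]
  exact ⟨𝒞.pair_disp _ _ _ _, _, A.tp_upto ha u k, isUpto_upto _ _, 𝒞.pair_var _ _ _ _⟩

theorem liftPath_restrict (p : MPath R Γ X) (a : 𝒞.Tm X) (ha : 𝒞.tp a = 𝒞.tySub p.src A.ty)
    {Y : E} (u : Y ⟶ X) (ha') :
    (A.liftPath p a ha).restrict u = A.liftPath (p.restrict u) (𝒞.tmSub u a) ha' :=
  ext_of_app rfl fun v k => by
    rw [app_restrict, app_liftPath, app_liftPath]
    exact pair_congr (app_restrict _ _ _ _).symm
      (tr_congr _ (by rw [restrict_restrict]) (𝒞.tmSub_comp _ _ _) _ _) _ _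

/-- The contraction of `p` up to zero is degenerate, so the axiom on degenerate paths applies. -/
theorem src_liftPath (p : MPath R Γ X) (a : 𝒞.Tm X) (ha : 𝒞.tp a = 𝒞.tySub p.src A.ty) :
    (A.liftPath p a ha).src = 𝒞.pair p.src A.ty a ha := by
  rw [src, app_liftPath]
  refine pair_congr rfl ?_ _ _
  refine (tr_congr _ (?_ : _ = idp R p.src) (𝒞.tmSub_id a) _ (by rw [ha, src_idp])).trans
    (A.tap.tr_idp _ _ ha)
  rw [restrict_id, upto_pzero]

theorem tgt_liftPath (p : MPath R Γ X) (a : 𝒞.Tm X) (ha : 𝒞.tp a = 𝒞.tySub p.src A.ty) :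
    (A.liftPath p a ha).tgt = 𝒞.pair p.tgt A.ty (A.tap.tr p a ha) (A.tap.tp_tr p a ha) := by
  rw [tgt, app_liftPath]
  refine pair_congr rfl (tr_congr _ ?_ (𝒞.tmSub_id a) _ _) _ _
  exact (congrArg (MPath.upto · p.shape) p.restrict_id).trans p.upto_shape

theorem liftPath_idp (x : X ⟶ Γ) (a : 𝒞.Tm X) (ha) (ha') :
    A.liftPath (idp R x) a ha = idp R (𝒞.pair x A.ty a ha') := by
  have h := eq_idp (p := A.liftPath (idp R x) a ha) rfl
  rw [src_liftPath] at h
  exact h.trans (congrArg (idp R) (pair_congr (src_idp x) rfl _ _))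

/-- Contraction commutes with the action of `γ`, and transport in the re-indexed fibration is
transport along the image. Stability of the transport in W-types rests on this. -/
theorem liftPath_map {Δ : E} (γ : Δ ⟶ Γ) (p : MPath R Δ X) (a : 𝒞.Tm X)
    (ha : 𝒞.tp a = 𝒞.tySub p.src (A.sub γ).ty) (ha') :
    ((A.sub γ).liftPath p a ha).map (𝒞.wk γ A.ty) = A.liftPath (p.map γ) a ha' :=
  ext_of_app rfl fun v k => by
    refine (app_map _ _ _ _).trans ?_
    rw [app_liftPath, app_liftPath]
    refine (pair_wk _ _ _ _ _ _).trans (pair_congr (app_map _ _ _ _).symm ?_ _ _)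
    exact tr_congr A.tap (by rw [upto_map, map_restrict]) rfl _ _

end Lift

end Fib

/-! ### Transport backwards along lifted paths, and the right-hand side of the recursion equation.
-/

namespace Fib

open CwF MPath OrderedCommRingObj KripkeJoyal

section BackHom

variable {E : Type u} [Category.{v} E] [CartesianMonoidalCategory E] [BraidedCategory E]
  [HasFiniteLimits E] [MonoidalClosed E] [HasSubobjectClassifier E]
  {R : OrderedCommRingObj E} {𝒞 : CwF.{w} E} {Γ : E} (B : Fib 𝒞 R Γ) {X : E}

theorem tp_var_rev (l : MPath R Γ X) {T' : 𝒞.Ty X} (hT' : T' = 𝒞.tySub l.tgt B.ty) :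
    𝒞.tp (𝒞.var T') = 𝒞.tySub (l.rev.restrict (𝒞.disp T')).src B.ty := by
  rw [𝒞.tp_var, src_restrict, src_rev, 𝒞.tySub_comp, ← hT']

/-- Transport along the reverse of a path, as a morphism between comprehension objects. -/
noncomputable def backHom (l : MPath R Γ X) {T T' : 𝒞.Ty X} (hT : T = 𝒞.tySub l.src B.ty)
    (hT' : T' = 𝒞.tySub l.tgt B.ty) : 𝒞.ext T' ⟶ 𝒞.ext T :=
  𝒞.pair (𝒞.disp T') T
    (B.tap.tr (l.rev.restrict (𝒞.disp T')) (𝒞.var T') (B.tp_var_rev l hT')) (by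
      rw [B.tap.tp_tr, tgt_restrict, tgt_rev, 𝒞.tySub_comp, ← hT])

variable (l : MPath R Γ X) {T T' : 𝒞.Ty X} (hT : T = 𝒞.tySub l.src B.ty)
  (hT' : T' = 𝒞.tySub l.tgt B.ty)

theorem backHom_disp : B.backHom l hT hT' ≫ 𝒞.disp T = 𝒞.disp T' := 𝒞.pair_disp _ _ _ _

theorem backHom_var : 𝒞.tmSub (B.backHom l hT hT') (𝒞.var T) =
    B.tap.tr (l.rev.restrict (𝒞.disp T')) (𝒞.var T') (B.tp_var_rev l hT') := 𝒞.pair_var _ _ _ _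

theorem wk_backHom {Y : E} (θ : Y ⟶ X) {l' : MPath R Γ Y} (hl : l' = l.restrict θ) (h h') :
    𝒞.wk θ T' ≫ B.backHom l hT hT' = B.backHom l' (T := 𝒞.tySub θ T) (T' := 𝒞.tySub θ T') h h' ≫
      𝒞.wk θ T := by
  subst hl
  apply 𝒞.ext_hom
  · rw [Category.assoc, backHom_disp, Category.assoc, wk_disp, wk_disp, ← Category.assoc,
      backHom_disp]
  · rw [𝒞.tmSub_comp, backHom_var, 𝒞.tmSub_comp, wk_var, backHom_var, B.tap.tr_restrict]
    refine tr_congr _ ?_ (𝒞.wk_var _ _) _ _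
    rw [restrict_restrict, wk_disp, ← restrict_restrict, rev_restrict]

theorem backHom_idp {x : X ⟶ Γ} {l : MPath R Γ X} (hl : l = idp R x) (h h') :
    B.backHom l (T := T) (T' := T) h h' = 𝟙 _ := by
  subst hl
  apply 𝒞.ext_hom
  · rw [backHom_disp, Category.id_comp]
  · rw [backHom_var, 𝒞.tmSub_id]
    refine (tr_congr _ (?_ : _ = idp R (𝒞.disp T ≫ x)) rfl _ ?_).trans (B.tap.tr_idp _ _ ?_)
    · rw [rev_idp, restrict_idp]
    · rw [src_idp, 𝒞.tp_var, h, src_idp, ← 𝒞.tySub_comp]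
    · rw [𝒞.tp_var, h, src_idp, ← 𝒞.tySub_comp]

theorem backHom_map {Δ : E} (γ : Δ ⟶ Γ) (l : MPath R Δ X) {l' : MPath R Γ X} (hl : l.map γ = l')
    (h : T = 𝒞.tySub l.src (B.sub γ).ty) (h') (k k') :
    (B.sub γ).backHom l (T := T) (T' := T') h h' = B.backHom l' k k' := by
  subst hl
  refine pair_congr rfl (tr_congr B.tap ?_ rfl _ _) _ _
  rw [map_restrict, rev_map]

end BackHom

section TrNode

variable {E : Type u} [Category.{v} E] [CartesianMonoidalCategory E] [BraidedCategory E]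
  [HasFiniteLimits E] [MonoidalClosed E] [HasSubobjectClassifier E]
  {R : OrderedCommRingObj E} {𝒞 : CwF.{w} E} {Γ : E} {A : Fib 𝒞 R Γ} {B : Fib 𝒞 R (𝒞.ext A.ty)}
  {Y : 𝒞.Ty Γ} {X : E} {σ τ : X ⟶ Γ}

omit [MonoidalClosed E] [HasSubobjectClassifier E] in
theorem tp_label_src {p : MPath R Γ X} (hσ : σ = p.src) (n : 𝒞.Node A.ty B.ty Y σ) :
    𝒞.tp n.label = 𝒞.tySub p.src A.ty := by
  rw [n.tp_label, hσ]

/-- The lifted path starting at the label of a node. -/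
noncomputable abbrev nodePath (p : MPath R Γ X) (hσ : σ = p.src) (n : 𝒞.Node A.ty B.ty Y σ) :
    MPath R (𝒞.ext A.ty) X :=
  A.liftPath p n.label (tp_label_src hσ n)

theorem node_T_eq (p : MPath R Γ X) (hσ : σ = p.src) (n : 𝒞.Node A.ty B.ty Y σ) :
    n.T = 𝒞.tySub (nodePath p hσ n).src B.ty := by
  subst hσ
  rw [n.T_eq, src_liftPath]

/-- The node obtained from `n` by transporting its label along `p` and its arity backwards; the
branches are given by `u`. -/
noncomputable def trNode (p : MPath R Γ X) (hσ : σ = p.src) (hτ : τ = p.tgt)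
    (n : 𝒞.Node A.ty B.ty Y σ) {T' : 𝒞.Ty X} (hT' : T' = 𝒞.tySub (nodePath p hσ n).tgt B.ty)
    (u : 𝒞.Tm (𝒞.ext n.T)) (hu : 𝒞.tp u = 𝒞.tySub (𝒞.disp n.T ≫ τ) Y) :
    𝒞.Node A.ty B.ty Y τ where
  label := A.tap.tr p n.label (tp_label_src hσ n)
  tp_label := by rw [A.tap.tp_tr, hτ]
  T := T'
  T_eq := by
    subst hτ
    rw [hT', tgt_liftPath]
  -- In the application, `u` is `b ↦ p∗ (f b)`; substituting the backward transport of the argument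
  -- gives the branches of the recursion equation.
  branch := 𝒞.tmSub (B.backHom (nodePath p hσ n) (node_T_eq p hσ n) hT') u
  tp_branch := by rw [𝒞.tp_sub, hu, ← 𝒞.tySub_comp, ← Category.assoc, backHom_disp]

theorem trNode_congr {p p' : MPath R Γ X} (hp : p = p') {σ' : X ⟶ Γ} (hσ : σ = p.src)
    (hσ' : σ' = p'.src) (hτ : τ = p.tgt) (hτ' : τ = p'.tgt) {n : 𝒞.Node A.ty B.ty Y σ}
    {n' : 𝒞.Node A.ty B.ty Y σ'} (hl : n.label = n'.label) (hT : n.T = n'.T)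
    (hb : HEq n.branch n'.branch) {T₁ T₂ : 𝒞.Ty X} (h₁ : T₁ = 𝒞.tySub (nodePath p hσ n).tgt B.ty)
    (h₂ : T₂ = 𝒞.tySub (nodePath p' hσ' n').tgt B.ty) {u : 𝒞.Tm (𝒞.ext n.T)}
    {u' : 𝒞.Tm (𝒞.ext n'.T)} (hu : HEq u u') (k k') :
    trNode p hσ hτ n h₁ u k = trNode p' hσ' hτ' n' h₂ u' k' := by
  subst hp hσ hσ'
  obtain rfl := Node.ext_of hl hT hb
  obtain rfl := eq_of_heq hu
  subst h₁ h₂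
  rfl

theorem sup_trNode_congr (I : 𝒞.WIntro) (hY : Y = I.W A.ty B.ty) {p p' : MPath R Γ X} (hp : p = p')
    {σ' τ' : X ⟶ Γ} (hσ : σ = p.src) (hσ' : σ' = p'.src) (hτ : τ = p.tgt) (hτ' : τ' = p'.tgt)
    {n : 𝒞.Node A.ty B.ty Y σ} {n' : 𝒞.Node A.ty B.ty Y σ'} (hl : n.label = n'.label)
    (hT : n.T = n'.T) (hb : HEq n.branch n'.branch) {T₁ T₂ : 𝒞.Ty X}
    (h₁ : T₁ = 𝒞.tySub (nodePath p hσ n).tgt B.ty)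
    (h₂ : T₂ = 𝒞.tySub (nodePath p' hσ' n').tgt B.ty) {u : 𝒞.Tm (𝒞.ext n.T)}
    {u' : 𝒞.Tm (𝒞.ext n'.T)} (hu : HEq u u') (k k') :
    I.sup hY τ (trNode p hσ hτ n h₁ u k) = I.sup hY τ' (trNode p' hσ' hτ' n' h₂ u' k') := by
  subst hp
  obtain rfl := hτ.trans hτ'.symm
  exact congrArg _ (trNode_congr rfl hσ hσ' hτ hτ' hl hT hb h₁ h₂ hu k k')

theorem trNode_restrict (p : MPath R Γ X) (hσ : σ = p.src) (hτ : τ = p.tgt)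
    (n : 𝒞.Node A.ty B.ty Y σ) {T' : 𝒞.Ty X} (hT' : T' = 𝒞.tySub (nodePath p hσ n).tgt B.ty)
    (u : 𝒞.Tm (𝒞.ext n.T)) (hu : 𝒞.tp u = 𝒞.tySub (𝒞.disp n.T ≫ τ) Y) {Δ : E} (θ : Δ ⟶ X)
    (k k' h h') :
    (trNode p hσ hτ n hT' u hu).restrict θ =
      trNode (p.restrict θ) k k' (n.restrict θ) (T' := 𝒞.tySub θ T') h (𝒞.tmSub (𝒞.wk θ n.T) u)
        h' := by
  refine Node.ext_of (A.tap.tr_restrict _ _ _ _) rfl (heq_of_eq ?_)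
  refine (𝒞.tmSub_comp _ _ _).symm.trans (Eq.trans ?_ (𝒞.tmSub_comp _ _ _))
  exact congrArg (𝒞.tmSub · u) (B.wk_backHom _ _ _ θ (A.liftPath_restrict _ _ _ _ _).symm _ _)

/-- Lifting and reversing a degenerate path gives a degenerate path, so the label is kept and
`backHom` is the identity. Hence the identity solves the recursion equation along `idp`. -/
theorem trNode_idp {p : MPath R Γ X} {x : X ⟶ Γ} (hp : p = idp R x) (hσ : σ = p.src)
    (hτ : σ = p.tgt) (n : 𝒞.Node A.ty B.ty Y σ) {T' : 𝒞.Ty X}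
    (hT' : T' = 𝒞.tySub (nodePath p hσ n).tgt B.ty) (hu) :
    trNode p hσ hτ n hT' n.branch hu = n := by
  subst hp
  have hx : x = σ := by rw [hσ, src_idp]
  subst hx
  have hl : nodePath (idp R x) hσ n = idp R (𝒞.pair x A.ty n.label n.tp_label) :=
    A.liftPath_idp _ _ _ _
  have hT : n.T = T' := by rw [hT', hl, tgt_idp, n.T_eq]
  subst hT
  refine Node.ext_of (A.tap.tr_idp _ _ n.tp_label) rfl (heq_of_eq ?_)
  refine (congrArg (𝒞.tmSub · n.branch) (B.backHom_idp hl _ _)).trans (𝒞.tmSub_id _)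

theorem sup_trNode_idp (I : 𝒞.WIntro) (hY : Y = I.W A.ty B.ty) {p : MPath R Γ X} {x : X ⟶ Γ}
    (hp : p = idp R x) (hσ : σ = p.src) (hτ : τ = p.tgt) (n : 𝒞.Node A.ty B.ty Y σ) {T' : 𝒞.Ty X}
    (hT' : T' = 𝒞.tySub (nodePath p hσ n).tgt B.ty) (hu) :
    I.sup hY τ (trNode p hσ hτ n hT' n.branch hu) = I.sup hY σ n := by
  obtain rfl : σ = τ := by rw [hσ, hτ, hp, src_idp, tgt_idp]
  rw [trNode_idp hp]

theorem trNode_push {Δ : E} (γ : Δ ⟶ Γ) {σ τ : X ⟶ Δ} (p : MPath R Δ X) (hσ : σ = p.src)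
    (hτ : τ = p.tgt)
    (n : 𝒞.Node (A.sub γ).ty (B.sub (𝒞.wk γ A.ty)).ty (𝒞.tySub γ Y) σ) {T' : 𝒞.Ty X} (hT') (u) (hu)
    (k k' h h') :
    Node.push (A := A.ty) (B := B.ty) (Y := Y) γ (trNode p hσ hτ n (T' := T') hT' u hu) =
      trNode (p.map γ) k k' (Node.push (A := A.ty) (B := B.ty) (Y := Y) γ n) (T' := T') h u h' := by
  refine Node.ext_of rfl rfl (heq_of_eq ?_)
  exact congrArg (𝒞.tmSub · u)
    (B.backHom_map (𝒞.wk γ A.ty) _ (A.liftPath_map γ p n.label _ _) _ _ _ _)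

end TrNode

end Fib

/-! ### Existence and uniqueness of transport in a W-type along a fixed path. -/

namespace Fib

open CwF MPath OrderedCommRingObj KripkeJoyal

variable {E : Type u} [Category.{v} E] [CartesianMonoidalCategory E] [BraidedCategory E]
  [HasFiniteLimits E] [MonoidalClosed E] [HasSubobjectClassifier E]
  {R : OrderedCommRingObj E} {𝒞 : CwF.{w} E}

/-- Transport in the `W`-type `Y` along the restrictions of the path `p`, satisfying the recursion
equation. -/
structure PathTransport (I : 𝒞.WIntro) {Γ : E} {A : Fib 𝒞 R Γ} {B : Fib 𝒞 R (𝒞.ext A.ty)}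
    {Y : 𝒞.Ty Γ} (hY : Y = I.W A.ty B.ty) {X : E} (p : MPath R Γ X) where
  tr {Δ : E} (θ : Δ ⟶ X) (a : 𝒞.Tm Δ) (ha : 𝒞.tp a = 𝒞.tySub (θ ≫ p.src) Y) : 𝒞.Tm Δ
  tp_tr {Δ : E} (θ : Δ ⟶ X) (a : 𝒞.Tm Δ) (ha : 𝒞.tp a = 𝒞.tySub (θ ≫ p.src) Y) :
    𝒞.tp (tr θ a ha) = 𝒞.tySub (θ ≫ p.tgt) Y
  tmSub_tr {Δ : E} (θ : Δ ⟶ X) (a : 𝒞.Tm Δ) (ha : 𝒞.tp a = 𝒞.tySub (θ ≫ p.src) Y) {Θ : E}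
    (ξ : Θ ⟶ Δ) : 𝒞.tmSub ξ (tr θ a ha) = tr (ξ ≫ θ) (𝒞.tmSub ξ a)
      (by rw [𝒞.tp_sub, ha, ← 𝒞.tySub_comp, Category.assoc])
  tr_sup {Δ : E} (θ : Δ ⟶ X) (n : 𝒞.Node A.ty B.ty Y (θ ≫ p.src)) (h) {T' : 𝒞.Ty Δ} (hT') (k) (k') :
    tr θ (I.sup hY _ n) h = I.sup hY _ (trNode (p.restrict θ) (p.src_restrict θ).symm
      (p.tgt_restrict θ).symm n (T' := T') hT' (tr (𝒞.disp n.T ≫ θ) n.branch k) k')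

namespace PathTransport

variable {I : 𝒞.WIntro} {Γ : E} {A : Fib 𝒞 R Γ} {B : Fib 𝒞 R (𝒞.ext A.ty)} {Y : 𝒞.Ty Γ}
  {hY : Y = I.W A.ty B.ty} {X : E} {p : MPath R Γ X}

theorem tr_congr (t : PathTransport I hY p) {Δ : E} {θ θ' : Δ ⟶ X} (hθ : θ = θ') {a a' : 𝒞.Tm Δ}
    (ha : a = a') (h h') : t.tr θ a h = t.tr θ' a' h' := by
  subst hθ ha
  rfl

theorem tr_sup_of (t : PathTransport I hY p) {Δ : E} {θ : Δ ⟶ X} {q : MPath R Γ Δ}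
    (hq : q = p.restrict θ) {σ τ : Δ ⟶ Γ} (hσ : σ = q.src) (hτ : τ = q.tgt)
    (n : 𝒞.Node A.ty B.ty Y σ) (h) {T' : 𝒞.Ty Δ} (hT') {u : 𝒞.Tm (𝒞.ext n.T)} (k)
    (hu : u = t.tr (𝒞.disp n.T ≫ θ) n.branch k) (k') :
    t.tr θ (I.sup hY σ n) h = I.sup hY τ (trNode q hσ hτ n (T' := T') hT' u k') := by
  subst hq hu
  obtain rfl := hσ.trans (p.src_restrict θ)
  obtain rfl := hτ.trans (p.tgt_restrict θ)
  exact t.tr_sup θ n h hT' k k'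

omit [MonoidalClosed E] [HasSubobjectClassifier E] in
theorem tp_branch_src {Δ : E} {θ : Δ ⟶ X} {σ : Δ ⟶ Γ} (hσ : σ = θ ≫ p.src)
    (n : 𝒞.Node A.ty B.ty Y σ) : 𝒞.tp n.branch = 𝒞.tySub ((𝒞.disp n.T ≫ θ) ≫ p.src) Y := by
  subst hσ
  rw [n.tp_branch, Category.assoc]

/-- By naturality, the transport of the generic element determines all others. -/
theorem tmSub_pair_tr (t : PathTransport I hY p) {Δ : E} (θ : Δ ⟶ X) (a : 𝒞.Tm Δ) (ha) (h)
    (h' : 𝒞.tp a = 𝒞.tySub (θ ≫ p.src) Y) :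
    𝒞.tmSub (𝒞.pair θ (𝒞.tySub p.src Y) a ha)
      (t.tr (𝒞.disp (𝒞.tySub p.src Y)) (𝒞.var (𝒞.tySub p.src Y)) h) = t.tr θ a h' := by
  rw [t.tmSub_tr]
  exact t.tr_congr (𝒞.pair_disp _ _ _ _) (𝒞.pair_var _ _ _ _) _ _

/-- Induction on the W-type pulled back along `p.src`, for the predicate that the two transports
agree: at `sup` the recursion equation expresses both by their values on the branches. -/
theorem tr_unique (hI : 𝒞.HasInduction I) (t t' : PathTransport I hY p) {Δ : E} (θ : Δ ⟶ X)
    (a : 𝒞.Tm Δ) (h) : t.tr θ a h = t'.tr θ a h := by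
  have hv : 𝒞.tp (𝒞.var (𝒞.tySub p.src Y)) = 𝒞.tySub (𝒞.disp (𝒞.tySub p.src Y) ≫ p.src) Y := by
    rw [𝒞.tp_var, 𝒞.tySub_comp]
  have key := hI ((congrArg (𝒞.tySub p.src) hY).trans (I.W_sub p.src A.ty B.ty)) _
    (isRep_tm_eq (t.tp_tr _ _ hv) (t'.tp_tr _ _ hv)) (fun Δ σ n ih => ?_) Δ
    (𝒞.pair θ _ a (by rw [h, 𝒞.tySub_comp]))
  · rwa [t.tmSub_pair_tr θ a _ _ h, t'.tmSub_pair_tr θ a _ _ h] at key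
  · have h1 : 𝒞.tp n.branch = 𝒞.tySub ((𝒞.disp n.T ≫ σ) ≫ p.src) Y := by
      rw [n.tp_branch, 𝒞.tySub_comp (_ ≫ σ)]
    have h2 := I.tp_sup ((congrArg (𝒞.tySub p.src) hY).trans (I.W_sub p.src A.ty B.ty)) σ n
    have h3 := h2.trans (𝒞.tySub_comp _ _ _).symm
    rw [t.tmSub_pair_tr _ _ _ _ h1, t'.tmSub_pair_tr _ _ _ _ h1] at ih
    rw [t.tmSub_pair_tr σ _ h2 _ h3, t'.tmSub_pair_tr σ _ h2 _ h3]
    -- Induction presents elements as `sup` in the W-type over `X`, while the recursion equation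
    -- uses `sup` in the one over `Γ`.
    have e := I.sup_push hY p.src σ n
    rw [t.tr_congr rfl e _ (by rw [← e, h3]), t'.tr_congr rfl e _ (by rw [← e, h3])]
    rw [t.tr_sup σ (n.push p.src) _ rfl h1 (by rw [t.tp_tr, Category.assoc]),
      t'.tr_sup σ (n.push p.src) _ rfl h1 (by rw [t'.tp_tr, Category.assoc])]
    refine congrArg (I.sup hY _) (trNode_congr rfl _ _ _ _ rfl rfl HEq.rfl _ _ (heq_of_eq ih) _ _)

/-- Restriction along a change of stage. -/
def restrict (t : PathTransport I hY p) {Z : E} (u : Z ⟶ X) :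
    PathTransport I hY (p.restrict u) where
  tr θ a ha := t.tr (θ ≫ u) a (by rw [ha, src_restrict, Category.assoc])
  tp_tr θ a ha := by rw [t.tp_tr, tgt_restrict, Category.assoc]
  tmSub_tr θ a ha Θ ξ := by
    rw [t.tmSub_tr]
    exact t.tr_congr (Category.assoc _ _ _).symm rfl _ _
  tr_sup {Δ} θ n h T' hT' k k' := by
    refine t.tr_sup_of (p.restrict_restrict u θ) _ _ n _ hT'
      (tp_branch_src (by rw [src_restrict, Category.assoc]) n) ?_ k'
    exact t.tr_congr (Category.assoc _ _ _) rfl _ _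

/-- Transport along a degenerate path. -/
def idp (x : X ⟶ Γ) : PathTransport I hY (MPath.idp R x) where
  tr _ a _ := a
  tp_tr θ a ha := by rw [ha, src_idp, tgt_idp]
  tmSub_tr _ _ _ _ _ := rfl
  tr_sup θ n _ _ hT' _ k' := (sup_trNode_idp I hY (restrict_idp x θ) _ _ n hT' k').symm

/-- Re-indexing of transport. -/
def reindex {Δ : E} (γ : Δ ⟶ Γ) {p : MPath R Δ X} (t : PathTransport I hY (p.map γ)) :
    PathTransport I (A := A.sub γ) (B := B.sub (𝒞.wk γ A.ty))
      ((congrArg (𝒞.tySub γ) hY).trans (I.W_sub γ A.ty B.ty)) p where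
  tr θ a ha := t.tr θ a (by rw [ha, src_map, ← 𝒞.tySub_comp, Category.assoc])
  tp_tr θ a ha := by rw [t.tp_tr, tgt_map, ← 𝒞.tySub_comp, Category.assoc]
  tmSub_tr θ a ha Θ ξ := t.tmSub_tr _ _ _ _
  tr_sup {Δ} θ n h T' hT' k k' := by
    have e := I.sup_push hY γ (θ ≫ p.src) n
    have hσ : (θ ≫ p.src) ≫ γ = ((p.restrict θ).map γ).src := by rw [src_map, src_restrict]
    have hτ : (θ ≫ p.tgt) ≫ γ = ((p.restrict θ).map γ).tgt := by rw [tgt_map, tgt_restrict]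
    refine (t.tr_congr rfl e _ (by rw [I.tp_sup, src_map, Category.assoc])).trans ?_
    refine Eq.trans ?_ (I.sup_push hY γ _ _).symm
    have hT : T' = 𝒞.tySub (nodePath _ hσ
        (Node.push (A := A.ty) (B := B.ty) (Y := Y) γ n)).tgt B.ty :=
      hT'.trans ((𝒞.tySub_comp _ _ _).symm.trans (congrArg (𝒞.tySub · B.ty)
        ((tgt_map _ _).symm.trans (congrArg MPath.tgt (A.liftPath_map γ _ n.label _ _)))))
    have hk := k'.trans ((𝒞.tySub_comp _ _ _).symm.trans
      (congrArg (𝒞.tySub · Y) (Category.assoc _ _ _)))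
    exact (t.tr_sup_of (p.map_restrict γ θ) hσ hτ _ _ hT _ rfl hk).trans
      (congrArg (I.sup hY _) (trNode_push γ (p.restrict θ) _ _ n hT' _ k' hσ hτ hT hk).symm)

/-- Existence of transport. -/
theorem nonempty (w : 𝒞.WTypes) (hY : Y = w.W A.ty B.ty) (p : MPath R Γ X) :
    Nonempty (PathTransport w.toWIntro hY p) := by
  have hY' := (congrArg (𝒞.tySub p.src) hY).trans (w.W_sub p.src A.ty B.ty)
  -- The target of the recursion does not depend on the tree: it is the W-type over the end point of
  -- `p`.
  let D : 𝒞.Ty (𝒞.ext (𝒞.tySub p.src Y)) := 𝒞.tySub (𝒞.disp _ ≫ p.tgt) Y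
  have hD : ∀ {Δ : E} (θ : Δ ⟶ X) (a : 𝒞.Tm Δ) (h),
      𝒞.tySub (𝒞.pair θ (𝒞.tySub p.src Y) a h) D = 𝒞.tySub (θ ≫ p.tgt) Y := by
    intro Δ θ a h
    rw [← 𝒞.tySub_comp, ← Category.assoc, 𝒞.pair_disp]
  have hu' : ∀ {Δ Θ : E} {σ : Δ ⟶ X} {T : 𝒞.Ty Δ} {b : 𝒞.Tm (𝒞.ext T)} {h} (u : 𝒞.Tm (𝒞.ext T))
      (_ : 𝒞.tp u = 𝒞.tySub (𝒞.pair (𝒞.disp T ≫ σ) (𝒞.tySub p.src Y) b h) D) (τ : Θ ⟶ Δ),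
      𝒞.tp (𝒞.tmSub (𝒞.wk τ T) u) = 𝒞.tySub (𝒞.disp (𝒞.tySub τ T) ≫ τ ≫ σ ≫ p.tgt) Y := by
    intro Δ Θ σ T b h u hu τ
    rw [𝒞.tp_sub, hu, hD, ← 𝒞.tySub_comp, Category.assoc, ← Category.assoc, wk_disp,
      Category.assoc]
  let d : Step w.toWIntro hY' D :=
    { run := fun σ n u hu => w.sup hY (σ ≫ p.tgt) (trNode (p.restrict σ) (p.src_restrict σ).symm
        (p.tgt_restrict σ).symm (n.push p.src) rfl u
        (hu.trans ((hD _ _ _).trans (congrArg (𝒞.tySub · Y) (Category.assoc _ _ _)))))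
      tp_run := fun σ n u hu => (w.tp_sup _ _ _).trans (hD _ _ _).symm
      run_restrict := fun σ n u hu Θ τ => by
        have hT : ∀ k, 𝒞.tySub τ (𝒞.tySub (nodePath (p.restrict σ) (p.src_restrict σ).symm
            (n.push p.src)).tgt B.ty) = 𝒞.tySub (nodePath ((p.restrict σ).restrict τ) k
              ((n.push p.src).restrict τ)).tgt B.ty := fun k => by
          rw [← 𝒞.tySub_comp, ← tgt_restrict]
          exact congrArg (fun l => 𝒞.tySub (MPath.tgt l) B.ty) (A.liftPath_restrict _ _ _ _ _)
        have hσ : τ ≫ σ ≫ p.src = ((p.restrict σ).restrict τ).src := by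
          rw [src_restrict, src_restrict]
        have hτ : τ ≫ σ ≫ p.tgt = ((p.restrict σ).restrict τ).tgt := by
          rw [tgt_restrict, tgt_restrict]
        refine (w.sup_restrict _ _ _ _).trans ((congrArg _ (trNode_restrict _ _ _ _ _ _ _ τ
          hσ hτ (hT _) (hu' u hu τ))).trans ?_)
        exact sup_trNode_congr _ _ (p.restrict_restrict σ τ) hσ (p.src_restrict (τ ≫ σ)).symm hτ
          (p.tgt_restrict (τ ≫ σ)).symm (n := (n.push p.src).restrict τ)
          (n' := (n.restrict τ).push p.src) rfl rfl HEq.rfl _ _ HEq.rfl (hu' u hu τ)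
          ((hu' u hu τ).trans (congrArg (𝒞.tySub · Y) (by simp only [Category.assoc]))) }
  refine ⟨⟨fun θ a ha => 𝒞.tmSub (𝒞.pair θ _ a (ha.trans (𝒞.tySub_comp _ _ _)))
    (w.elim hY' D d), fun θ a ha => ?_, fun θ a ha Θ ξ => ?_, fun {Δ} θ n h T' hT' k k' => ?_⟩⟩
  · rw [𝒞.tp_sub, w.tp_elim, hD]
  · rw [← 𝒞.tmSub_comp]
    exact congrArg (𝒞.tmSub · _) (comp_pair _ _ _ _ _ _ rfl _ rfl _)
  · let n' : 𝒞.Node (𝒞.tySub p.src A.ty) (𝒞.tySub (𝒞.wk p.src A.ty) B.ty) (𝒞.tySub p.src Y) θ :=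
      { label := n.label
        tp_label := n.tp_label.trans (𝒞.tySub_comp _ _ _)
        T := n.T
        T_eq := by rw [n.T_eq, ← 𝒞.tySub_comp, pair_wk]
        branch := n.branch
        tp_branch := n.tp_branch.trans
          ((congrArg (𝒞.tySub · Y) (Category.assoc _ _ _).symm).trans (𝒞.tySub_comp _ _ _)) }
    have e : w.sup hY' θ n' = w.sup hY (θ ≫ p.src) n := w.sup_push hY p.src θ n'
    refine (congrArg (𝒞.tmSub · (w.elim hY' D d)) (pair_congr rfl e.symm _ (w.tp_sup _ _ _))).trans
      ((w.elim_sup hY' D d θ n').trans ?_)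
    exact congrArg _ (trNode_congr rfl _ _ _ _ rfl rfl HEq.rfl _ _ HEq.rfl _ _)

end PathTransport

end Fib

/-! ### Induction for an arbitrary structure of W-types on the topos. -/

namespace CwF

open KripkeJoyal

section Induction

variable {E : Type u} [Category.{v} E] [HasFiniteLimits E]

/-- Dependent elimination implies induction for representable predicates. -/
theorem WTypes.hasInduction (w : (ofTopos E).WTypes) : (ofTopos E).HasInduction w.toWIntro := by
  intro Γ A B Y hY χ hχ hc Δ m
  obtain ⟨S, i, hi, hS⟩ := hχ
  -- The subobject itself is a family: it has an element at `k` exactly when `χ` holds at `k`, and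
  -- at most one. Hence the premise of elimination needs only existence, and its naturality is
  -- automatic.
  let D : LFam ((ofTopos E).ext Y) := ⟨i, 𝟙 _⟩
  have key : ∀ {Δ : E} (k : Δ ⟶ (ofTopos E).ext Y), χ Δ k → ∃ t : LElt Δ, t.fam = D.sub k := by
    intro Δ k hk
    obtain ⟨s, hs⟩ := (hS _ _).1 hk
    exact ⟨⟨D.sub k, s, hs.trans (Category.comp_id k).symm⟩, rfl⟩
  have conv : ∀ {Δ : E} (k : Δ ⟶ (ofTopos E).ext Y) (t : LElt Δ), t.fam = D.sub k → χ Δ k := by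
    intro Δ k t ht
    exact (hS _ _).2 ⟨t.elAs (D.sub k) ht, (t.elAs_proj _ ht).trans (Category.comp_id k)⟩
  have uniq : ∀ {Δ : E} {k k' : Δ ⟶ (ofTopos E).ext Y} (_ : k = k') {t t' : LElt Δ},
      t.fam = D.sub k → t'.fam = D.sub k' → t = t' := by
    rintro Δ k _ rfl ⟨F, f, hf⟩ ⟨F', f', hf'⟩ h h'
    change F = _ at h
    change F' = _ at h'
    subst h h'
    exact LElt.ext_of rfl (heq_of_eq ((cancel_mono i).1 (hf.trans hf'.symm)))
  have hsup : ∀ {Δ : E} (σ : Δ ⟶ Γ) (n : (ofTopos E).Node A B Y σ) (u : LElt ((ofTopos E).ext n.T)),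
      u.fam = D.sub ((ofTopos E).pair ((ofTopos E).disp n.T ≫ σ) Y n.branch n.tp_branch) →
      ∃ t : LElt Δ, t.fam = D.sub ((ofTopos E).pair σ Y (w.sup hY σ n) (w.tp_sup hY σ n)) :=
    fun σ n u hu => key _ (hc _ σ n (conv _ u hu))
  choose r hr using @hsup
  let d : Step w.toWIntro hY (D : (ofTopos E).Ty ((ofTopos E).ext Y)) :=
    { run := r
      tp_run := hr
      run_restrict := fun σ n u hu Θ τ => by
        refine uniq (comp_pair _ _ _ _ (w.tp_sup hY σ n) _ (w.sup_restrict hY σ n τ).symm _ rfl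
          (w.tp_sup hY _ (n.restrict τ))) ?_ (hr _ _ _ _)
        exact (congrArg (LFam.sub τ) (hr σ n u hu)).trans ((ofTopos E).tySub_comp _ _ D).symm }
  exact conv m ((ofTopos E).tmSub m (w.elim hY D d)) (congrArg (LFam.sub m) (w.tp_elim hY D d))

end Induction

end CwF

/-! ### The transport structure of a W-type and its stability. -/

namespace Fib

open CwF MPath OrderedCommRingObj KripkeJoyal

variable {E : Type u} [Category.{v} E] [CartesianMonoidalCategory E] [BraidedCategory E]
  [HasFiniteLimits E] [MonoidalClosed E] [HasSubobjectClassifier E]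
  {R : OrderedCommRingObj E} {𝒞 : CwF.{w} E}

theorem PathTransport.tr_eq {I : 𝒞.WIntro} (hI : 𝒞.HasInduction I) {Γ : E} {A : Fib 𝒞 R Γ}
    {B : Fib 𝒞 R (𝒞.ext A.ty)} {Y Y' : 𝒞.Ty Γ} {hY : Y = I.W A.ty B.ty} {hY' : Y' = I.W A.ty B.ty}
    {X : E} {p p' : MPath R Γ X} (hp : p = p') (t : PathTransport I hY p)
    (t' : PathTransport I hY' p') {Δ : E} {θ θ' : Δ ⟶ X} (hθ : θ = θ') (a : 𝒞.Tm Δ) (h) (h') :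
    t.tr θ a h = t'.tr θ' a h' := by
  obtain rfl := hY.trans hY'.symm
  subst hp hθ
  exact t.tr_unique hI t' θ a h

/-- The chosen transport in a `W`-type along a path. -/
noncomputable def wTransport (w : 𝒞.WTypes) {Γ : E} (A : Fib 𝒞 R Γ) (B : Fib 𝒞 R (𝒞.ext A.ty))
    {X : E} (p : MPath R Γ X) :
    PathTransport (A := A) (B := B) w.toWIntro rfl p :=
  (PathTransport.nonempty w rfl p).some

/-- The transport structure of a `W`-type. -/
noncomputable def wTap (w : 𝒞.WTypes) (hI : 𝒞.HasInduction w.toWIntro) {Γ : E} (A : Fib 𝒞 R Γ)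
    (B : Fib 𝒞 R (𝒞.ext A.ty)) : Tap 𝒞 R (w.W A.ty B.ty) where
  tr {X} p a ha := (wTransport w A B p).tr (𝟙 X) a (by rw [ha, Category.id_comp])
  tp_tr p a ha := by rw [PathTransport.tp_tr, Category.id_comp]
  tr_restrict {X} p a ha Y u := by
    rw [PathTransport.tmSub_tr]
    exact (PathTransport.tr_congr _ ((Category.comp_id u).trans (Category.id_comp u).symm) rfl _
      _).trans (((wTransport w A B p).restrict u).tr_unique hI _ (𝟙 Y) _
        (by rw [𝒞.tp_sub, ha, ← 𝒞.tySub_comp, Category.id_comp, src_restrict]))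
  tr_idp x a ha := (wTransport w A B (MPath.idp R x)).tr_unique hI (PathTransport.idp x) _ a _

/-- Transports for different paths are chosen independently. Uniqueness identifies the one for `p`
at stage `θ` with the one chosen for `p.restrict θ`, the form in which the recursion equation calls
it on branches. -/
theorem PathTransport.tr_eq_wTap (w : 𝒞.WTypes) (hI : 𝒞.HasInduction w.toWIntro) {Γ : E}
    {A : Fib 𝒞 R Γ} {B : Fib 𝒞 R (𝒞.ext A.ty)} {X : E} {p : MPath R Γ X}
    (t : PathTransport (A := A) (B := B) w.toWIntro rfl p) {Δ : E} (θ : Δ ⟶ X) (a : 𝒞.Tm Δ) (h)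
    (h') : t.tr θ a h = (wTap w hI A B).tr (p.restrict θ) a h' :=
  (t.tr_congr (Category.id_comp θ).symm rfl _ (by rw [h, Category.id_comp])).trans
    ((t.restrict θ).tr_unique hI _ (𝟙 Δ) a (by rw [h', Category.id_comp]))

theorem wTransportEq_wTap (w : 𝒞.WTypes) (hI : 𝒞.HasInduction w.toWIntro) {Γ : E} (A : Fib 𝒞 R Γ)
    (B : Fib 𝒞 R (𝒞.ext A.ty)) : WTransportEq w.toWIntro A B (wTap w hI A B) := by
  intro X p n
  have hk := PathTransport.tp_branch_src (θ := 𝟙 X) (Category.id_comp p.src).symm n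
  have hu : 𝒞.tp ((wTransport w A B p).tr (𝒞.disp n.T ≫ 𝟙 X) n.branch hk) =
      𝒞.tySub (𝒞.disp n.T ≫ p.tgt) (w.W A.ty B.ty) := by
    rw [PathTransport.tp_tr, Category.comp_id]
  have hg := B.backHom_disp (nodePath p rfl n) (node_T_eq p rfl n) rfl
  have hb : 𝒞.tp (𝒞.tmSub (B.backHom (nodePath p rfl n) (node_T_eq p rfl n) rfl) n.branch) =
      𝒞.tySub (p.restrict (𝒞.disp (𝒞.tySub (nodePath p rfl n).tgt B.ty))).src (w.W A.ty B.ty) := by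
    rw [𝒞.tp_sub, n.tp_branch, ← 𝒞.tySub_comp, ← Category.assoc, hg, src_restrict]
  refine ⟨nodePath p rfl n, (nodePath p rfl n).rev, trNode p rfl rfl n rfl _ hu, _,
    A.isLift_liftPath _ _ _, isRev_rev _, rfl, hg, ⟨_, B.backHom_var _ _ _⟩, ⟨hb, ?_⟩, ?_⟩
  · refine (PathTransport.tmSub_tr _ _ _ _ _).trans ?_
    refine (PathTransport.tr_congr _ (?_ : _ = 𝒞.disp (𝒞.tySub (nodePath p rfl n).tgt B.ty)) rfl _
      ?_).trans (PathTransport.tr_eq_wTap w hI _ _ _ _ _)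
    · rw [Category.comp_id, hg]
    · rw [𝒞.tp_sub, n.tp_branch, ← 𝒞.tySub_comp, ← Category.assoc, hg]
  · exact (wTransport w A B p).tr_sup_of p.restrict_id.symm rfl rfl n _ rfl hk rfl hu

/-- Transport along `p.map γ` solves the recursion equation for the re-indexed data along `p`, so it
is the chosen solution. -/
theorem sub_wTap (w : 𝒞.WTypes) (hI : 𝒞.HasInduction w.toWIntro) {Δ Γ : E} (γ : Δ ⟶ Γ)
    (A : Fib 𝒞 R Γ) (B : Fib 𝒞 R (𝒞.ext A.ty)) :
    Fib.sub γ ⟨w.W A.ty B.ty, wTap w hI A B⟩ =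
      ⟨w.W (A.sub γ).ty (B.sub (𝒞.wk γ A.ty)).ty, wTap w hI (A.sub γ) (B.sub (𝒞.wk γ A.ty))⟩ :=
  Fib.ext_of (w.W_sub γ A.ty B.ty) fun p a ha ha' =>
    PathTransport.tr_eq hI rfl ((wTransport w A B (p.map γ)).reindex γ)
      (wTransport w (A.sub γ) (B.sub (𝒞.wk γ A.ty)) p) rfl a
        (by rw [Category.id_comp]; exact ha) (by rw [Category.id_comp]; exact ha')

end Fib

/-! ### W-types of fibrations. -/

namespace CwF

theorem Step.ext_of {C : Type u} [Category.{v} C] {𝒞 : CwF.{w} C} {I : 𝒞.WIntro} {Γ : C}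
    {A : 𝒞.Ty Γ} {B : 𝒞.Ty (𝒞.ext A)} {Y : 𝒞.Ty Γ} {hY : Y = I.W A B} {D : 𝒞.Ty (𝒞.ext Y)}
    {d d' : Step I hY D}
    (h : ∀ {Δ : C} (σ : Δ ⟶ Γ) (n : 𝒞.Node A B Y σ) (u) (hu), d.run σ n u hu = d'.run σ n u hu) :
    d = d' := by
  obtain ⟨r, _, _⟩ := d
  obtain ⟨r', _, _⟩ := d'
  have : @r = @r' := by
    funext Δ σ n u hu
    exact h σ n u hu
  subst this
  rfl

end CwF

namespace Fib

open CwF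

section WTypes

variable {E : Type u} [Category.{v} E] [CartesianMonoidalCategory E] [BraidedCategory E]
  [HasPullbacks E] {R : OrderedCommRingObj E} {𝒞 : CwF.{w} E}

/-- Transport structures in a node are dictated by its equations, so the underlying data decide
equality. -/
theorem node_ext {Γ : E} {A : Fib 𝒞 R Γ} {B : Fib 𝒞 R (𝒞.ext A.ty)} {Y : Fib 𝒞 R Γ} {Δ : E}
    {σ : Δ ⟶ Γ} {n n' : (cwf 𝒞 R).Node A B Y σ} (h : forgetNode n = forgetNode n') : n = n' := by
  obtain ⟨⟨F, l, hl⟩, tl, T, hT, ⟨G, b, hb⟩, tb⟩ := n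
  obtain ⟨⟨F', l', hl'⟩, tl', T', hT', ⟨G', b', hb'⟩, tb'⟩ := n'
  change F = A.sub σ at tl
  change F' = A.sub σ at tl'
  subst tl tl'
  obtain rfl : l = l' := congrArg Node.label h
  obtain rfl := hT.trans hT'.symm
  have e : ∀ m m' : 𝒞.Node A.ty B.ty Y.ty σ, m = m' → HEq m.branch m'.branch := by
    rintro m _ rfl
    rfl
  have hbb := e _ _ h
  obtain rfl : b = b' := eq_of_heq hbb
  obtain rfl : G = G' := Eq.trans tb tb'.symm
  rfl

/-- A fibration with its family replaced by an equal one. -/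
noncomputable def withTy {Γ : E} (F : Fib 𝒞 R Γ) (T : 𝒞.Ty Γ) (h : T = F.ty) : Fib 𝒞 R Γ :=
  ⟨T, h.symm.rec F.tap⟩

theorem withTy_eq {Γ : E} (F : Fib 𝒞 R Γ) (T : 𝒞.Ty Γ) (h : T = F.ty) : F.withTy T h = F := by
  subst h
  rfl

/-- The node of fibrations with a given node of underlying families and elements. -/
noncomputable def liftNode {Γ : E} {A : Fib 𝒞 R Γ} {B : Fib 𝒞 R (𝒞.ext A.ty)} {Y : Fib 𝒞 R Γ}
    {Δ : E} {σ : Δ ⟶ Γ} (n : 𝒞.Node A.ty B.ty Y.ty σ) : (cwf 𝒞 R).Node A B Y σ where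
  label := (⟨A.sub σ, n.label, n.tp_label⟩ : Elt 𝒞 R Δ)
  tp_label := rfl
  -- The underlying family is made definitionally `n.T`, so that branches of `n` need no cast.
  T := (B.sub (𝒞.pair σ A.ty n.label n.tp_label)).withTy n.T n.T_eq
  T_eq := withTy_eq _ _ _
  branch := (⟨Y.sub (𝒞.disp n.T ≫ σ), n.branch, n.tp_branch⟩ : Elt 𝒞 R (𝒞.ext n.T))
  tp_branch := rfl

/-- The typing hypotheses fix the fibrations of `u` and `u'`, so only the underlying elements have
to be compared. -/
theorem step_run_congr {I : (cwf 𝒞 R).WIntro} {Γ : E} {A : Fib 𝒞 R Γ} {B : Fib 𝒞 R (𝒞.ext A.ty)}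
    {Y : Fib 𝒞 R Γ} {hY : Y = I.W A B} {D : Fib 𝒞 R (𝒞.ext Y.ty)}
    (d : Step (𝒞 := cwf 𝒞 R) I hY D) {Δ : E} {σ : Δ ⟶ Γ} {n n' : (cwf 𝒞 R).Node A B Y σ}
    (hn : n = n') {u : Elt 𝒞 R (𝒞.ext n.T.ty)} {u' : Elt 𝒞 R (𝒞.ext n'.T.ty)}
    (hu : HEq u.tm u'.tm) (h) (h') : d.run σ n u h = d.run σ n' u' h' := by
  subst hn
  obtain rfl : u = u' := Elt.ext_of (Eq.trans h h'.symm) (eq_of_heq hu)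
  rfl

variable {w : 𝒞.WTypes} {tap : ∀ {Γ : E} (A : Fib 𝒞 R Γ) (B : Fib 𝒞 R (𝒞.ext A.ty)),
    Tap 𝒞 R (w.W A.ty B.ty)}
  (hsub : ∀ {Δ Γ : E} (γ : Δ ⟶ Γ) (A : Fib 𝒞 R Γ) (B : Fib 𝒞 R (𝒞.ext A.ty)),
    Fib.sub γ ⟨w.W A.ty B.ty, tap A B⟩ =
      ⟨w.W (A.sub γ).ty (B.sub (𝒞.wk γ A.ty)).ty, tap (A.sub γ) (B.sub (𝒞.wk γ A.ty))⟩)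

/-- Formation and introduction of `W`-types of fibrations. -/
noncomputable def wIntro : (cwf 𝒞 R).WIntro where
  W A B := (⟨w.W A.ty B.ty, tap A B⟩ : Fib 𝒞 R _)
  W_sub σ A B := hsub σ A B
  sup {_ A B Y} hY _ σ n := (⟨Fib.sub σ Y, w.sup (A := A.ty) (B := B.ty) (congrArg Fib.ty hY) σ
    (forgetNode n), w.tp_sup _ _ _⟩ : Elt 𝒞 R _)
  tp_sup _ _ _ _ := rfl
  sup_restrict {_ _ _ Y} hY _ σ n _ τ := Elt.ext_of (Fib.sub_comp τ σ Y).symm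
    (w.sup_restrict (congrArg Fib.ty hY) σ (forgetNode n) τ)
  sup_push {_ _ _ Y} hY _ σ _ τ n := Elt.ext_of (Fib.sub_comp τ σ Y).symm
    (w.sup_push (congrArg Fib.ty hY) σ τ (forgetNode n))

variable {Γ : E} {A : Fib 𝒞 R Γ} {B : Fib 𝒞 R (𝒞.ext A.ty)} {Y : Fib 𝒞 R Γ}
  {hY : Y = (wIntro hsub).W A B} {D : Fib 𝒞 R (𝒞.ext Y.ty)}

/-- The underlying premise of `W`-elimination. -/
noncomputable def forgetStep (d : Step (𝒞 := cwf 𝒞 R) (wIntro hsub) hY D) :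
    Step w.toWIntro (congrArg Fib.ty hY) D.ty where
  run {_} σ n u hu := (show Elt 𝒞 R _ from d.run σ (liftNode n)
    (⟨D.sub (𝒞.pair (𝒞.disp n.T ≫ σ) Y.ty n.branch n.tp_branch), u, hu⟩ :
      Elt 𝒞 R (𝒞.ext n.T)) rfl).tm
  tp_run σ n u hu := (Elt.tp_tm _).trans (congrArg Fib.ty (d.tp_run σ (liftNode n) _ _))
  run_restrict σ n u hu Θ τ := by
    refine (congrArg Elt.tm (d.run_restrict σ (liftNode n) _ _ τ)).trans (congrArg Elt.tm
      (step_run_congr d (n := (liftNode n).restrict τ) (n' := liftNode (n.restrict τ))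
        (node_ext rfl) ?_ _ _))
    exact HEq.rfl

theorem forgetStep_reindex (d : Step (𝒞 := cwf 𝒞 R) (wIntro hsub) hY D) {Δ : E} (σ : Δ ⟶ Γ) :
    (forgetStep hsub d).reindex σ = forgetStep hsub (d.reindex σ) :=
  Step.ext_of fun τ n u hu =>
    congrArg Elt.tm (step_run_congr d
      (n := liftNode (Node.push (A := A.ty) (B := B.ty) (Y := Y.ty) σ n))
      (n' := Node.push (𝒞 := cwf 𝒞 R) σ (liftNode n)) (node_ext rfl) (by exact HEq.rfl) _ _)

/-- The `W`-types of fibrations. -/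
noncomputable def wTypes : (cwf 𝒞 R).WTypes where
  toWIntro := wIntro hsub
  elim {_ A B Y} hY D d := (⟨D, w.elim (A := A.ty) (B := B.ty) (congrArg Fib.ty hY) D.ty
    (forgetStep hsub d), w.tp_elim _ _ _⟩ : Elt 𝒞 R _)
  tp_elim _ _ _ := rfl
  elim_sup hY D d Δ σ n := Elt.ext_of (d.tp_run _ _ _ _).symm
    ((w.elim_sup (congrArg Fib.ty hY) _ (forgetStep hsub d) σ (forgetNode n)).trans
      (congrArg Elt.tm (step_run_congr d (n := liftNode (forgetNode n)) (n' := n) (node_ext rfl)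
        (by exact HEq.rfl) _ _)))
  elim_sub hY D d Δ σ := Elt.ext_of rfl
    ((w.elim_sub (congrArg Fib.ty hY) _ (forgetStep hsub d) σ).trans
      (congrArg (w.elim _ _) (forgetStep_reindex hsub d σ)))

end WTypes

end Fib

theorem theorem4p6 {E : Type u} [Category.{v} E] [CartesianMonoidalCategory E]
    [BraidedCategory E] [HasFiniteLimits E] [MonoidalClosed E] [HasSubobjectClassifier E]
    (hN : HasNNO E) (R : OrderedCommRingObj E) :
    Nonempty (CwF.ofTopos E).WTypes ∧
    ∀ w : (CwF.ofTopos E).WTypes,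
      ∃ tap : ∀ {Γ : E} (A : Fib (CwF.ofTopos E) R Γ)
          (B : Fib (CwF.ofTopos E) R ((CwF.ofTopos E).ext A.ty)),
          Tap (CwF.ofTopos E) R (w.W A.ty B.ty),
        (∀ {Γ : E} (A : Fib (CwF.ofTopos E) R Γ)
          (B : Fib (CwF.ofTopos E) R ((CwF.ofTopos E).ext A.ty)),
          Fib.WTransportEq w.toWIntro A B (tap A B)) ∧
        (∀ {Δ Γ : E} (γ : Δ ⟶ Γ) (A : Fib (CwF.ofTopos E) R Γ)
          (B : Fib (CwF.ofTopos E) R ((CwF.ofTopos E).ext A.ty)),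
          Fib.sub γ ⟨w.W A.ty B.ty, tap A B⟩ =
            ⟨w.W (A.sub γ).ty (B.sub ((CwF.ofTopos E).wk γ A.ty)).ty,
              tap (A.sub γ) (B.sub ((CwF.ofTopos E).wk γ A.ty))⟩) ∧
        ∃ w' : (Fib.cwf (CwF.ofTopos E) R).WTypes,
          ∃ hW : ∀ {Γ : E} (A : Fib (CwF.ofTopos E) R Γ)
            (B : Fib (CwF.ofTopos E) R ((CwF.ofTopos E).ext A.ty)),
            w'.W A B = ⟨w.W A.ty B.ty, tap A B⟩,
          ∀ {Γ : E} {A : Fib (CwF.ofTopos E) R Γ}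
            {B : Fib (CwF.ofTopos E) R ((CwF.ofTopos E).ext A.ty)} {Y : Fib (CwF.ofTopos E) R Γ}
            (hY : Y = w'.W A B) {Δ : E} (σ : Δ ⟶ Γ)
            (n : (Fib.cwf (CwF.ofTopos E) R).Node A B Y σ),
            (w'.sup hY σ n).tm =
              w.sup (congrArg Fib.ty (hY.trans (hW A B))) σ (Fib.forgetNode n) := by
  refine ⟨(CwF.exists_trees hN).elim fun 𝒯 => 𝒯.nonempty_wTypes, fun w => ?_⟩
  have hI : (CwF.ofTopos E).HasInduction w.toWIntro := w.hasInduction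
  refine ⟨fun A B => Fib.wTap w hI A B, fun A B => Fib.wTransportEq_wTap w hI A B,
    fun γ A B => Fib.sub_wTap w hI γ A B, Fib.wTypes fun γ A B => Fib.sub_wTap w hI γ A B,
    fun A B => rfl, fun _ _ _ _ => rfl⟩
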